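/- Let $N\ge 1$, let $\Omega\subset\mathbb{R}^N$ be a bounded connected open set with smooth boundary and outer unit normal $\nu$, let $1<p<\infty$, $q=p/(p-1)$, and let $f\in L^q(\partial\Omega)$. Let $V:\mathbb{R}^N\to\mathbb{R}^N$ be a smooth, globally Lipschitz vector field with $\langle V,\nu\rangle=0$ on $\partial\Omega$, let $\psi_t$ be its flow, that is $\frac{d}{dt}\psi_t(x)=V(\psi_t(x))$, $\psi_0(x)=x$ for $t\in\mathbb{R}$, $x\in\mathbb{R}^N$, and let $f_t=f\circ\psi_t^{-1}$. For each $t$ there is a unique weak solution $u_t\in W^{1,p}(\Omega)$ of $$-\Delta_p u_t+|u_t|^{p-2}u_t=0\ \text{ in }\Omega,\qquad |\nabla u_t|^{p-2}\frac{\partial u_t}{\partial\nu}=f_t\ \text{ on }\partial\Omega,$$ that is, $\int_\Omega\left(|\nabla u_t|^{p-2}\langle\nabla u_t,\nabla v\rangle+|u_t|^{p-2}u_tv\right)dx=\int_{\partial\Omega}f_tv\,d\mathcal{H}^{N-1}$ for all $v\in W^{1,p}(\Omega)$ (boundary values being traces). The function $$I(t)=\int_{\partial\Omega}u_t f_t\,d\mathcal{H}^{N-1}$$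 is differentiable at $t=0$, and $$I'(0)=\frac{1}{p-1}\left\{p\int_{\partial\Omega}u_0\,f\,\mathrm{div}_\tau V\,d\mathcal{H}^{N-1}+p\int_\Omega|\nabla u_0|^{p-2}\langle\nabla u_0,(V')^{T}\nabla u_0\rangle\,dx-\int_\Omega\left(|\nabla u_0|^p+|u_0|^p\right)\mathrm{div}\,V\,dx\right\},$$ where $V'$ is the Jacobian matrix of $V$ and $\mathrm{div}_\tau V=\mathrm{div}\,V-\langle V'\nu,\nu\rangle$ is the tangential divergence of $V$ on $\partial\Omega$. -/

import Mathlib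

open MeasureTheory Filter Topology
open scoped ENNReal ContDiff

noncomputable section

namespace PLaplace

variable {N : ℕ}

/-- `ρ` is a smooth local defining function of `Ω` at `x`: near `x` the set `Ω` is `{ρ < 0}`,
with `ρ x = 0` and `∇ρ x ≠ 0`. -/
structure IsLocalDefiningFunction (Ω : Set (EuclideanSpace ℝ (Fin N)))
    (x : EuclideanSpace ℝ (Fin N)) (ρ : EuclideanSpace ℝ (Fin N) → ℝ) : Prop where
  contDiff : ContDiff ℝ ∞ ρ
  map_eq_zero : ρ x = 0
  gradient_ne_zero : gradient ρ x ≠ 0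
  eventually_mem_iff : ∀ᶠ y in 𝓝 x, (y ∈ Ω ↔ ρ y < 0)

/-- A bounded domain (open, connected, nonempty) with smooth boundary. -/
structure IsBoundedSmoothDomain (Ω : Set (EuclideanSpace ℝ (Fin N))) : Prop where
  isOpen : IsOpen Ω
  isConnected : IsConnected Ω
  isBounded : Bornology.IsBounded Ω
  smooth_boundary : ∀ x ∈ frontier Ω, ∃ ρ, IsLocalDefiningFunction Ω x ρ

/-- `n` is the outer unit normal of `Ω` at the boundary point `x`. -/
def IsOuterUnitNormal (Ω : Set (EuclideanSpace ℝ (Fin N)))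
    (x n : EuclideanSpace ℝ (Fin N)) : Prop :=
  ∃ ρ, IsLocalDefiningFunction Ω x ρ ∧ n = ‖gradient ρ x‖⁻¹ • gradient ρ x

/-- The `(N - 1)`-dimensional Hausdorff measure (normalized as usual, so that in integer
dimensions it extends Lebesgue measure) on the boundary of `Ω ⊆ ℝᴺ`, `N ≥ 1`. -/
def surfaceMeasure (Ω : Set (EuclideanSpace ℝ (Fin N))) :
    Measure (EuclideanSpace ℝ (Fin N)) :=
  (μHE[N - 1]).restrict (frontier Ω)

/-- `G` is the weak gradient of `u` in `Ω`. -/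
def HasWeakGradient (Ω : Set (EuclideanSpace ℝ (Fin N)))
    (u : EuclideanSpace ℝ (Fin N) → ℝ)
    (G : EuclideanSpace ℝ (Fin N) → EuclideanSpace ℝ (Fin N)) : Prop :=
  ∀ φ : EuclideanSpace ℝ (Fin N) → ℝ,
    ContDiff ℝ ∞ φ → HasCompactSupport φ → tsupport φ ⊆ Ω →
    ∀ e : EuclideanSpace ℝ (Fin N),
      ∫ x in Ω, u x * fderiv ℝ φ x e = - ∫ x in Ω, φ x * inner ℝ (G x) e

/-- `u` belongs to the Sobolev space `W^{1,p}(Ω)` and has weak gradient `G`. -/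
structure MemSobolev (p : ℝ) (Ω : Set (EuclideanSpace ℝ (Fin N)))
    (u : EuclideanSpace ℝ (Fin N) → ℝ)
    (G : EuclideanSpace ℝ (Fin N) → EuclideanSpace ℝ (Fin N)) : Prop where
  memLp : MemLp u (ENNReal.ofReal p) (volume.restrict Ω)
  memLp_gradient : MemLp G (ENNReal.ofReal p) (volume.restrict Ω)
  hasWeakGradient : HasWeakGradient Ω u G

/-- `g ∈ L^p(∂Ω)` is the boundary trace of `u ∈ W^{1,p}(Ω)` (with weak gradient `G`): there are
functions `φ k` smooth up to the boundary that converge to `u` in `W^{1,p}(Ω)` and whose boundary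
values converge to `g` in `L^p(∂Ω)`. -/
def IsTrace (p : ℝ) (Ω : Set (EuclideanSpace ℝ (Fin N)))
    (u : EuclideanSpace ℝ (Fin N) → ℝ)
    (G : EuclideanSpace ℝ (Fin N) → EuclideanSpace ℝ (Fin N))
    (g : EuclideanSpace ℝ (Fin N) → ℝ) : Prop :=
  MemLp g (ENNReal.ofReal p) (surfaceMeasure Ω) ∧
  ∃ φ : ℕ → EuclideanSpace ℝ (Fin N) → ℝ,
    (∀ k, ContDiff ℝ ∞ (φ k)) ∧
    Tendsto (fun k => eLpNorm (fun x => φ k x - u x) (ENNReal.ofReal p) (volume.restrict Ω))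
      atTop (𝓝 0) ∧
    Tendsto (fun k => eLpNorm (fun x => gradient (φ k) x - G x) (ENNReal.ofReal p)
      (volume.restrict Ω)) atTop (𝓝 0) ∧
    Tendsto (fun k => eLpNorm (fun x => φ k x - g x) (ENNReal.ofReal p) (surfaceMeasure Ω))
      atTop (𝓝 0)

/-- `u ∈ W^{1,p}(Ω)`, with weak gradient `G` and boundary trace `g`, is a weak solution of
`-Δ_p u + |u|^{p-2} u = 0` in `Ω`, `|∇u|^{p-2} ∂u/∂ν = f` on `∂Ω`. -/
structure IsWeakSolution (p : ℝ) (Ω : Set (EuclideanSpace ℝ (Fin N)))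
    (f : EuclideanSpace ℝ (Fin N) → ℝ)
    (u : EuclideanSpace ℝ (Fin N) → ℝ)
    (G : EuclideanSpace ℝ (Fin N) → EuclideanSpace ℝ (Fin N))
    (g : EuclideanSpace ℝ (Fin N) → ℝ) : Prop where
  memSobolev : MemSobolev p Ω u G
  isTrace : IsTrace p Ω u G g
  weak_equation : ∀ (v : EuclideanSpace ℝ (Fin N) → ℝ)
    (H : EuclideanSpace ℝ (Fin N) → EuclideanSpace ℝ (Fin N))
    (h : EuclideanSpace ℝ (Fin N) → ℝ),
    MemSobolev p Ω v H → IsTrace p Ω v H h →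
      ∫ x in Ω, (‖G x‖ ^ (p - 2) * inner ℝ (G x) (H x) + |u x| ^ (p - 2) * u x * v x) =
        ∫ x, f x * h x ∂(surfaceMeasure Ω)

/-- The divergence of a vector field: the trace of its derivative. -/
def divergence (V : EuclideanSpace ℝ (Fin N) → EuclideanSpace ℝ (Fin N))
    (x : EuclideanSpace ℝ (Fin N)) : ℝ :=
  ∑ i : Fin N, (fderiv ℝ V x (EuclideanSpace.single i 1)) i

/-- The tangential divergence at `x` on a hypersurface with unit normal `n` at `x`:
`div_τ V = div V - ⟨V' n, n⟩`. -/
def tangentialDivergence (V : EuclideanSpace ℝ (Fin N) → EuclideanSpace ℝ (Fin N))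
    (n x : EuclideanSpace ℝ (Fin N)) : ℝ :=
  divergence V x - inner ℝ (fderiv ℝ V x n) n

/-- `ψ` is the flow of the vector field `V`: `d/dt ψ_t(x) = V(ψ_t(x))`, `ψ_0(x) = x`. -/
structure IsFlowOf (V : EuclideanSpace ℝ (Fin N) → EuclideanSpace ℝ (Fin N))
    (ψ : ℝ → EuclideanSpace ℝ (Fin N) → EuclideanSpace ℝ (Fin N)) : Prop where
  map_zero : ∀ x, ψ 0 x = x
  hasDerivAt : ∀ t x, HasDerivAt (fun s => ψ s x) (V (ψ t x)) t

/-- The perturbed load `f_t = f ∘ ψ_t⁻¹` (the maps `ψ_t` of a flow are bijections). -/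
def perturbedLoad (ψ : ℝ → EuclideanSpace ℝ (Fin N) → EuclideanSpace ℝ (Fin N))
    (f : EuclideanSpace ℝ (Fin N) → ℝ) (t : ℝ) : EuclideanSpace ℝ (Fin N) → ℝ :=
  f ∘ Function.invFun (ψ t)

end PLaplace

end

/-! The solution `u_t` is the unique minimizer of the strictly convex energy E_t(u) = (1/p)∫(|∇u|^p
+ |u|^p) - ∫_{∂Ω} f_t u. Testing the weak equation with `u_t` itself gives I(t) = -(p/(p-1)) m(t),
where m(t) is the minimum of E_t (`loadedEnergy_eq_of_energyForm_eq`). It therefore suffices to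
differentiate a minimum value, and an envelope argument does this without differentiating `u_t` in t
and without any regularity of `u_t`.

Since f_t = f ∘ ψ_{-t}, the natural competitor for E_t is u ∘ ψ_{-t}. Three first order expansions
describe its energy: volume integrals acquire the factor 1 + t div V, boundary integrals the factor
1 + t div_τ V, and |∇(u ∘ ψ_{-t})|^p equals (|∇u|^p - pt|∇u|^{p-2}⟨∇u, (V')^T ∇u⟩) ∘ ψ_{-t}, all up
to o(t). Tangency of V makes Ω and ∂Ω invariant (`IsFlowOf.mem_frontier`, `IsFlowOf.mem_domain`).
The result is `IsFlowOf.exists_perturbation_inequality`: m(t) ≤ m(0) + tD(0) + o(t), where D is the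
variation of the energy at the minimizer. The threshold on t there does not depend on the load or on
the competitor, so the same inequality may be applied from time t back to time 0, giving m(0) ≤ m(t)
- tD(t) + o(t). Once D(t) → D(0), the two bounds yield m'(0) = D(0) (`hasDerivAt_of_envelope`), and
multiplication by -p/(p-1) gives the formula.

Convergence D(t) → D(0) follows from strong convergence of the minimizers. The energies are treated
on `traceSpace`, the closure of the triples (function, gradient, boundary values) of smooth
functions; the trace inequality `exists_trace_inequality` makes them coercive. A uniform convexity
inequality for p-th powers (`exists_norm_sub_rpow_le`, integrated in `uniformlyConvexRpow_Lp`) shows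
that almost minimizers are close in norm, whence existence, uniqueness and continuous dependence on
the load (`exists_minimizer`, `minimizer_unique`, `tendsto_minimizer`).

The flow enters only through Lipschitz estimates in space: ψ_t - id - tV has Lipschitz constant
O(t²) on bounded sets (`IsFlowOf.exists_norm_remainder_sub_le`). Mollifying this remainder alone
gives smooth maps close to ψ_t with derivative id + tV' + O(t²), hence smooth competitors. The same
estimate, combined with the behaviour of Hausdorff measure under Lipschitz maps and with local
tangent spaces, gives the first order change of variables on Ω and on ∂Ω by one proof
(`IsFlowOf.hasFirstOrderDistortion`). -/

noncomputable section

namespace PLaplace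

/-! ### Pointwise inequalities for p-th powers of norms. -/

section Pointwise

variable {W : Type*} [NormedAddCommGroup W]

/-- Comparison of two functions that are homogeneous of degree `p` in a pair of vectors. -/
theorem exists_le_add_mul_of_homogeneous {Z : Type*} [TopologicalSpace Z] [NormedSpace ℝ W]
    [FiniteDimensional ℝ W] {K : Set Z} (hK : IsCompact K) {p : ℝ} (hp : 0 < p)
    {A B : Z → W → W → ℝ}
    (hA : ContinuousOn (fun q : Z × W × W => A q.1 q.2.1 q.2.2) (K ×ˢ Set.univ))
    (hB : ContinuousOn (fun q : Z × W × W => B q.1 q.2.1 q.2.2) (K ×ˢ Set.univ))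
    (hAh : ∀ z ∈ K, ∀ r : ℝ, 0 ≤ r → ∀ a b, A z (r • a) (r • b) = r ^ p * A z a b)
    (hBh : ∀ z ∈ K, ∀ r : ℝ, 0 ≤ r → ∀ a b, B z (r • a) (r • b) = r ^ p * B z a b)
    (hB0 : ∀ z ∈ K, ∀ a b, 0 ≤ B z a b)
    (hAB : ∀ z ∈ K, ∀ a b, B z a b = 0 → A z a b ≤ 0) {ε : ℝ} (hε : 0 < ε) :
    ∃ C : ℝ, 0 ≤ C ∧ ∀ z ∈ K, ∀ a b, A z a b ≤ ε * (‖a‖ ^ p + ‖b‖ ^ p) + C * B z a b := by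
  have hS : IsCompact (K ×ˢ Metric.sphere (0 : W × W) 1) := hK.prod (isCompact_sphere 0 1)
  have hsub : K ×ˢ Metric.sphere (0 : W × W) 1 ⊆ K ×ˢ Set.univ :=
    Set.prod_mono le_rfl (Set.subset_univ _)
  have hA' := hA.mono hsub
  have hB' := hB.mono hsub
  obtain ⟨M, hM⟩ := hS.bddAbove_image hA'
  -- Over the compact set of parameters and unit pairs, `B` stays away from zero wherever `A` is at
  -- least `ε`: a cluster point of counterexamples would satisfy `B = 0` and `A ≥ ε`, against `hAB`.
  obtain ⟨δ, hδ, hδB⟩ : ∃ δ : ℝ, 0 < δ ∧ ∀ q ∈ K ×ˢ Metric.sphere (0 : W × W) 1,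
      ε ≤ A q.1 q.2.1 q.2.2 → δ ≤ B q.1 q.2.1 q.2.2 := by
    by_contra! hcon
    have h1 : ∀ n : ℕ, ∃ q ∈ K ×ˢ Metric.sphere (0 : W × W) 1,
        ε ≤ A q.1 q.2.1 q.2.2 ∧ B q.1 q.2.1 q.2.2 < 1 / ((n : ℝ) + 1) :=
      fun n => hcon _ (by positivity)
    choose q hq hqA hqB using h1
    -- `Z` need not be first countable, so an ultrafilter takes the place of a convergent
    -- subsequence.
    obtain ⟨x, hx, hcl⟩ := hS.exists_mapClusterPt_of_frequently (f := q) (l := atTop)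
      (Frequently.of_forall hq)
    obtain ⟨U, hU, hUx⟩ := mapClusterPt_iff_ultrafilter.1 hcl
    have hqw : Tendsto q U (𝓝[K ×ˢ Metric.sphere (0 : W × W) 1] x) :=
      tendsto_nhdsWithin_iff.2 ⟨hUx, Eventually.of_forall hq⟩
    have hAx := (hA' x hx).tendsto.comp hqw
    have hBx := (hB' x hx).tendsto.comp hqw
    have hA1 : ε ≤ A x.1 x.2.1 x.2.2 := ge_of_tendsto hAx (Eventually.of_forall hqA)
    have hB1 : B x.1 x.2.1 x.2.2 ≤ 0 := by
      refine le_of_tendsto_of_tendsto hBx (tendsto_one_div_add_atTop_nhds_zero_nat.mono_left hU)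
        (Eventually.of_forall fun n => (hqB n).le)
    have := hAB x.1 hx.1 x.2.1 x.2.2 (le_antisymm hB1 (hB0 _ hx.1 _ _))
    linarith
  -- On unit pairs, `M` bounds `A` from above. Where `A` is at least `ε` this constant times `B`
  -- dominates it; elsewhere the `ε` term does. Homogeneity carries both cases to all pairs.
  refine ⟨max M 0 / δ, by positivity, fun z hz a b => ?_⟩
  set r : ℝ := ‖((a, b) : W × W)‖ with hr
  have hBz := hB0 z hz a b
  rcases eq_or_ne r 0 with h0 | h0
  · have hab : ((a, b) : W × W) = 0 := norm_eq_zero.1 h0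
    obtain ⟨rfl, rfl⟩ := Prod.mk_eq_zero.1 hab
    have h1 := hAh z hz 0 le_rfl 0 0
    rw [Real.zero_rpow hp.ne', smul_zero, zero_mul] at h1
    rw [h1]
    positivity
  have hr0 : 0 < r := lt_of_le_of_ne (norm_nonneg _) (Ne.symm h0)
  have hrp : 0 < r ^ p := Real.rpow_pos_of_pos hr0 p
  have ha : a = r • (r⁻¹ • a) := by rw [smul_smul, mul_inv_cancel₀ h0, one_smul]
  have hb : b = r • (r⁻¹ • b) := by rw [smul_smul, mul_inv_cancel₀ h0, one_smul]
  have hmem : (z, r⁻¹ • a, r⁻¹ • b) ∈ K ×ˢ Metric.sphere (0 : W × W) 1 := by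
    refine ⟨hz, ?_⟩
    have : ((r⁻¹ • a, r⁻¹ • b) : W × W) = r⁻¹ • (a, b) := rfl
    rw [mem_sphere_zero_iff_norm, this, norm_smul, ← hr, norm_inv, Real.norm_of_nonneg hr0.le,
      inv_mul_cancel₀ h0]
  have hsum : r ^ p ≤ ‖a‖ ^ p + ‖b‖ ^ p := by
    rw [hr, Prod.norm_def]
    rcases max_choice ‖a‖ ‖b‖ with h | h <;> simp only [h] <;>
      nlinarith [Real.rpow_nonneg (norm_nonneg a) p, Real.rpow_nonneg (norm_nonneg b) p]
  have hAr := hAh z hz r hr0.le (r⁻¹ • a) (r⁻¹ • b)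
  have hBr := hBh z hz r hr0.le (r⁻¹ • a) (r⁻¹ • b)
  rw [← ha, ← hb] at hAr hBr
  by_cases hcase : ε ≤ A z (r⁻¹ • a) (r⁻¹ • b)
  · have h1 := hδB _ hmem hcase
    have h2 : A z (r⁻¹ • a) (r⁻¹ • b) ≤ max M 0 :=
      (hM ⟨_, hmem, rfl⟩).trans (le_max_left _ _)
    have h3 : A z (r⁻¹ • a) (r⁻¹ • b) ≤ max M 0 / δ * B z (r⁻¹ • a) (r⁻¹ • b) := by
      refine h2.trans ?_
      rw [div_mul_eq_mul_div, le_div_iff₀ hδ]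
      exact mul_le_mul_of_nonneg_left h1 (le_max_right _ _)
    have h4 : 0 ≤ ε * (‖a‖ ^ p + ‖b‖ ^ p) := by positivity
    have h5 := mul_le_mul_of_nonneg_left h3 hrp.le
    rw [← hAr, mul_left_comm, ← hBr] at h5
    linarith
  · push Not at hcase
    have h5 := mul_le_mul_of_nonneg_left hcase.le hrp.le
    have h6 := mul_le_mul_of_nonneg_left hsum hε.le
    have h4 : 0 ≤ max M 0 / δ * B z a b := by positivity
    rw [← hAr] at h5
    linarith

theorem norm_midpoint_rpow_le [NormedSpace ℝ W] {p : ℝ} (hp : 1 < p) (a b : W) :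
    ‖(1 / 2 : ℝ) • (a + b)‖ ^ p ≤ (‖a‖ ^ p + ‖b‖ ^ p) / 2 := by
  have h1 : ‖(1 / 2 : ℝ) • (a + b)‖ ≤ (1 / 2) * ‖a‖ + (1 / 2) * ‖b‖ := by
    rw [norm_smul, Real.norm_of_nonneg (by norm_num)]
    linarith [norm_add_le a b]
  have h2 := (strictConvexOn_rpow hp).convexOn.2 (norm_nonneg a) (norm_nonneg b)
    (show (0 : ℝ) ≤ 1 / 2 by norm_num) (show (0 : ℝ) ≤ 1 / 2 by norm_num) (by norm_num)
  simp only [smul_eq_mul] at h2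
  have h3 := Real.rpow_le_rpow (norm_nonneg _) h1 (by linarith : 0 ≤ p)
  linarith

variable [InnerProductSpace ℝ W]

/-- Strict convexity of `x ↦ x ^ p` forces equal norms, the triangle inequality for the midpoint is
then an equality, and the parallelogram law finishes. -/
theorem eq_of_norm_midpoint_rpow_eq {p : ℝ} (hp : 1 < p) {a b : W}
    (h : (‖a‖ ^ p + ‖b‖ ^ p) / 2 - ‖(1 / 2 : ℝ) • (a + b)‖ ^ p = 0) : a = b := by
  have hp0 : 0 < p := by linarith
  have h1 : ‖(1 / 2 : ℝ) • (a + b)‖ ≤ (1 / 2) * ‖a‖ + (1 / 2) * ‖b‖ := by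
    rw [norm_smul, Real.norm_of_nonneg (by norm_num)]
    linarith [norm_add_le a b]
  have h3 := Real.rpow_le_rpow (norm_nonneg _) h1 hp0.le
  have hab : ‖a‖ = ‖b‖ := by
    by_contra hne
    have h2 := (strictConvexOn_rpow hp).2 (norm_nonneg a) (norm_nonneg b) hne
      (show (0 : ℝ) < 1 / 2 by norm_num) (show (0 : ℝ) < 1 / 2 by norm_num) (by norm_num)
    simp only [smul_eq_mul] at h2
    linarith
  have h4 : ‖(1 / 2 : ℝ) • (a + b)‖ = ‖b‖ := by
    rw [hab] at h
    have h5 : ‖(1 / 2 : ℝ) • (a + b)‖ ^ p = ‖b‖ ^ p := by linarith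
    exact (Real.rpow_left_inj (norm_nonneg _) (norm_nonneg _) hp0.ne').1 h5
  have h6 : ‖a + b‖ = 2 * ‖b‖ := by
    rw [norm_smul, Real.norm_of_nonneg (by norm_num)] at h4
    linarith
  have h7 := parallelogram_law_with_norm ℝ a b
  rw [h6, hab] at h7
  have h8 : ‖a - b‖ = 0 := by nlinarith [norm_nonneg (a - b)]
  exact sub_eq_zero.1 (norm_eq_zero.1 h8)

/-- Uniform convexity for all exponents at once, in place of Clarkson's inequalities: the convexity
gap is homogeneous and vanishes only on the diagonal. For `p < 2` the gap is merely quadratic in `a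
- b` near nonzero diagonal points, which is why the `ε` term is kept. -/
theorem exists_norm_sub_rpow_le [FiniteDimensional ℝ W] {p : ℝ} (hp : 1 < p) {ε : ℝ}
    (hε : 0 < ε) :
    ∃ C : ℝ, 0 ≤ C ∧ ∀ a b : W, ‖a - b‖ ^ p ≤ ε * (‖a‖ ^ p + ‖b‖ ^ p) +
      C * ((‖a‖ ^ p + ‖b‖ ^ p) / 2 - ‖(1 / 2 : ℝ) • (a + b)‖ ^ p) := by
  have hp0 : 0 < p := by linarith
  have hpow : ∀ {f : Unit × W × W → W}, Continuous f → Continuous fun q => ‖f q‖ ^ p :=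
    fun hf => hf.norm.rpow_const fun _ => Or.inr hp0.le
  have hh : ∀ (r : ℝ), 0 ≤ r → ∀ a : W, ‖r • a‖ ^ p = r ^ p * ‖a‖ ^ p := fun r hr a => by
    rw [norm_smul, Real.norm_of_nonneg hr, Real.mul_rpow hr (norm_nonneg _)]
  obtain ⟨C, hC, h⟩ := exists_le_add_mul_of_homogeneous (Z := Unit) (W := W) (K := Set.univ)
    isCompact_univ hp0 (A := fun _ a b => ‖a - b‖ ^ p)
    (B := fun _ a b => (‖a‖ ^ p + ‖b‖ ^ p) / 2 - ‖(1 / 2 : ℝ) • (a + b)‖ ^ p)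
    (Continuous.continuousOn (hpow (by fun_prop)))
    (Continuous.continuousOn ((((hpow (by fun_prop)).add (hpow (by fun_prop))).div_const 2).sub
      (hpow (by fun_prop))))
    (fun _ _ r hr a b => by rw [← smul_sub, hh r hr])
    (fun _ _ r hr a b => by
      rw [← smul_add, smul_comm, hh r hr, hh r hr, hh r hr]; ring)
    (fun _ _ a b => sub_nonneg.2 (norm_midpoint_rpow_le hp a b))
    (fun _ _ a b hab => by
      rw [eq_of_norm_midpoint_rpow_eq hp hab, sub_self, norm_zero, Real.zero_rpow hp0.ne'])
    hε
  exact ⟨C, hC, fun a b => h () trivial a b⟩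

/-- Homogeneous comparison again, since the left side vanishes when `a = b`. It gives integrability
and `L^p` continuity of every functional with a continuous `p`-homogeneous integrand, with no
differentiability of the integrand. -/
theorem exists_abs_sub_le_of_homogeneous [FiniteDimensional ℝ W] {Z : Type*} [TopologicalSpace Z]
    {K : Set Z} (hK : IsCompact K) {p : ℝ} (hp : 0 < p) {F : Z → W → ℝ}
    (hF : ContinuousOn (fun q : Z × W => F q.1 q.2) (K ×ˢ Set.univ))
    (hFh : ∀ z ∈ K, ∀ r : ℝ, 0 ≤ r → ∀ a, F z (r • a) = r ^ p * F z a) {ε : ℝ} (hε : 0 < ε) :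
    ∃ C : ℝ, 0 ≤ C ∧ ∀ z ∈ K, ∀ a b,
      |F z a - F z b| ≤ ε * (‖a‖ ^ p + ‖b‖ ^ p) + C * ‖a - b‖ ^ p := by
  have hh : ∀ (r : ℝ), 0 ≤ r → ∀ a : W, ‖r • a‖ ^ p = r ^ p * ‖a‖ ^ p := fun r hr a => by
    rw [norm_smul, Real.norm_of_nonneg hr, Real.mul_rpow hr (norm_nonneg _)]
  refine exists_le_add_mul_of_homogeneous hK hp (A := fun z a b => |F z a - F z b|)
    (B := fun _ a b => ‖a - b‖ ^ p) ?_ ?_ ?_ ?_ ?_ ?_ hε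
  · refine (ContinuousOn.sub ?_ ?_).abs
    · exact hF.comp (f := fun q : Z × W × W => (q.1, q.2.1)) (by fun_prop)
        (fun q hq => ⟨hq.1, trivial⟩)
    · exact hF.comp (f := fun q : Z × W × W => (q.1, q.2.2)) (by fun_prop)
        (fun q hq => ⟨hq.1, trivial⟩)
  · refine Continuous.continuousOn ?_
    exact Continuous.rpow_const (by fun_prop) fun _ => Or.inr hp.le
  · intro z hz r hr a b
    rw [hFh z hz r hr, hFh z hz r hr, ← mul_sub, abs_mul,
      abs_of_nonneg (Real.rpow_nonneg hr p)]
  · intro z hz r hr a b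
    rw [← smul_sub, hh r hr]
  · intro z _ a b; positivity
  · intro z _ a b h
    have h1 : ‖a - b‖ = 0 := by
      by_contra hne
      exact absurd h (Real.rpow_pos_of_pos (lt_of_le_of_ne (norm_nonneg _) (Ne.symm hne)) p).ne'
    rw [sub_eq_zero.1 (norm_eq_zero.1 h1)]
    simp

/-- First order convexity of `‖·‖ ^ p`. -/
theorem norm_rpow_add_le_norm_rpow {p : ℝ} (hp : 1 < p) (a b : W) :
    ‖a‖ ^ p + p * (‖a‖ ^ (p - 2) * inner ℝ a (b - a)) ≤ ‖b‖ ^ p := by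
  have hconv : ConvexOn ℝ Set.univ (fun x : W => ‖x‖ ^ p) := by
    refine ⟨convex_univ, fun x _ y _ s t hs ht hst => ?_⟩
    have h1 : ‖s • x + t • y‖ ≤ s * ‖x‖ + t * ‖y‖ := by
      refine (norm_add_le _ _).trans ?_
      rw [norm_smul, norm_smul, Real.norm_of_nonneg hs, Real.norm_of_nonneg ht]
    exact (Real.rpow_le_rpow (norm_nonneg _) h1 (by linarith)).trans
      ((strictConvexOn_rpow hp).convexOn.2 (norm_nonneg x) (norm_nonneg y) hs ht hst)
  have hline : ConvexOn ℝ Set.univ (fun s : ℝ => ‖a + s • (b - a)‖ ^ p) := by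
    refine ⟨convex_univ, fun x _ y _ s t hs ht hst => ?_⟩
    have := hconv.2 (Set.mem_univ (a + x • (b - a))) (Set.mem_univ (a + y • (b - a))) hs ht hst
    refine le_trans (le_of_eq ?_) this
    have h1 : a + (s • x + t • y) • (b - a) =
        s • (a + x • (b - a)) + t • (a + y • (b - a)) := by
      have h2 : t = 1 - s := by linarith
      rw [h2]
      module
    exact congrArg (fun w : W => ‖w‖ ^ p) h1
  have hd : HasDerivAt (fun s : ℝ => ‖a + s • (b - a)‖ ^ p)
      (p * (‖a‖ ^ (p - 2) * inner ℝ a (b - a))) 0 := by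
    have h1 : HasDerivAt (fun s : ℝ => a + s • (b - a)) (b - a) 0 := by
      simpa using ((hasDerivAt_id (0 : ℝ)).smul_const (b - a)).const_add a
    have h2 := (hasFDerivAt_norm_rpow (a + (0 : ℝ) • (b - a)) hp).comp_hasDerivAt (0 : ℝ) h1
    have h3 : ((p * ‖a + (0 : ℝ) • (b - a)‖ ^ (p - 2)) • innerSL ℝ (a + (0 : ℝ) • (b - a)))
        (b - a) = p * (‖a‖ ^ (p - 2) * inner ℝ a (b - a)) := by
      simp [mul_assoc]
    rw [h3] at h2
    exact h2
  have := hline.le_slope_of_hasDerivAt (Set.mem_univ 0) (Set.mem_univ 1) one_pos hd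
  simp [slope_def_field] at this
  linarith

theorem abs_norm_rpow_mul_inner_le {p : ℝ} (hp : 1 < p) (a b : W) :
    |‖a‖ ^ (p - 2) * inner ℝ a b| ≤ ‖a‖ ^ (p - 1) * ‖b‖ := by
  rw [abs_mul, abs_of_nonneg (Real.rpow_nonneg (norm_nonneg _) _)]
  calc ‖a‖ ^ (p - 2) * |inner ℝ a b| ≤ ‖a‖ ^ (p - 2) * (‖a‖ * ‖b‖) := by
        gcongr; exact abs_real_inner_le_norm a b
    _ = ‖a‖ ^ (p - 1) * ‖b‖ := by
        rw [← mul_assoc, ← Real.rpow_add_one' (norm_nonneg _) (by linarith)]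
        ring_nf

theorem rpow_sub_one_mul_le {p : ℝ} (hp : 1 < p) {x y : ℝ} (hx : 0 ≤ x) (hy : 0 ≤ y) :
    x ^ (p - 1) * y ≤ x ^ p + y ^ p := by
  have hp0 : 0 ≤ p := by linarith
  have key : ∀ z : ℝ, 0 ≤ z → z ^ (p - 1) * z = z ^ p := fun z hz => by
    rw [← Real.rpow_add_one' hz (by linarith)]; ring_nf
  rcases le_total x y with h | h
  · calc x ^ (p - 1) * y ≤ y ^ (p - 1) * y := by gcongr
      _ = y ^ p := key y hy
      _ ≤ _ := by linarith [Real.rpow_nonneg hx p]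
  · calc x ^ (p - 1) * y ≤ x ^ (p - 1) * x := by gcongr
      _ = x ^ p := key x hx
      _ ≤ _ := by linarith [Real.rpow_nonneg hy p]

/-- After squaring, the terms linear in `t` cancel. What remains is a sum of squares plus `K ^ 2 * t
^ 2 * (1 - 2 * t * x)`, nonnegative because `|t * x| ≤ 1 / 2`. -/
theorem norm_sub_smul_le {K : ℝ} {t : ℝ} (ht : |t| * K ≤ 1 / 2)
    {M : W →L[ℝ] W} (hM : ‖M‖ ≤ K) {z : W} {x : ℝ} (hx : |x| ≤ K)
    (hxi : inner ℝ z (M z) = x * ‖z‖ ^ 2) :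
    ‖z - t • M z‖ ≤ (1 - t * x + K ^ 2 * t ^ 2) * ‖z‖ := by
  have hMz : ‖M z‖ ≤ K * ‖z‖ := (M.le_opNorm z).trans (by gcongr)
  have htx : |t * x| ≤ 1 / 2 := by
    rw [abs_mul]
    exact (mul_le_mul_of_nonneg_left hx (abs_nonneg t)).trans ht
  have h3 : t * x ≤ 1 / 2 := (abs_le.1 htx).2
  have hy : 0 ≤ K ^ 2 * t ^ 2 := by positivity
  have h0 : 0 ≤ 1 - t * x + K ^ 2 * t ^ 2 := by linarith
  refine abs_le_of_sq_le_sq' ?_ (by positivity) |>.2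
  rw [norm_sub_sq_real, inner_smul_right, hxi, norm_smul, mul_pow, mul_pow, Real.norm_eq_abs,
    sq_abs]
  have h1 : ‖M z‖ ^ 2 ≤ (K * ‖z‖) ^ 2 := by gcongr
  have h2 : (1 - 2 * (t * x) + t ^ 2 * K ^ 2) ≤ (1 - t * x + K ^ 2 * t ^ 2) ^ 2 := by
    have h4 : 0 ≤ (K ^ 2 * t ^ 2) * (1 - 2 * (t * x)) := mul_nonneg hy (by linarith)
    nlinarith [sq_nonneg (t * x), sq_nonneg (K ^ 2 * t ^ 2)]
  calc ‖z‖ ^ 2 - 2 * (t * (x * ‖z‖ ^ 2)) + t ^ 2 * ‖M z‖ ^ 2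
      ≤ ‖z‖ ^ 2 - 2 * (t * (x * ‖z‖ ^ 2)) + t ^ 2 * (K * ‖z‖) ^ 2 := by gcongr
    _ = (1 - 2 * (t * x) + t ^ 2 * K ^ 2) * ‖z‖ ^ 2 := by ring
    _ ≤ _ := by gcongr

theorem exists_one_add_rpow_le {p : ℝ} {ε : ℝ} (hε : 0 < ε) :
    ∃ δ : ℝ, 0 < δ ∧ ∀ s : ℝ, |s| < δ → (1 + s) ^ p ≤ 1 + p * s + ε * |s| := by
  have hder : HasDerivAt (fun x : ℝ => x ^ p) (p * 1 ^ (p - 1)) 1 :=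
    Real.hasDerivAt_rpow_const (Or.inl one_ne_zero)
  rw [Real.one_rpow, mul_one, hasDerivAt_iff_isLittleO] at hder
  obtain ⟨δ, hδ, hball⟩ := Metric.eventually_nhds_iff.1 (hder.def hε)
  refine ⟨δ, hδ, fun s hs => ?_⟩
  have h2 := hball (y := 1 + s) (by rwa [Real.dist_eq, add_sub_cancel_left])
  simp only [Real.one_rpow, add_sub_cancel_left, smul_eq_mul, Real.norm_eq_abs] at h2
  have h3 := (abs_le.1 h2).2
  linarith

/-- First order expansion of `‖z - t M z‖ ^ p`, uniformly in `z`, in bounded `M`, and under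
perturbations of order `t ^ 2`. -/
theorem exists_norm_sub_smul_rpow_le {p : ℝ} (hp : 1 < p) {K C : ℝ} (hK : 0 ≤ K) (hC : 0 ≤ C)
    {η : ℝ} (hη : 0 < η) :
    ∃ t₀ : ℝ, 0 < t₀ ∧ ∀ t : ℝ, |t| ≤ t₀ → ∀ M : W →L[ℝ] W, ‖M‖ ≤ K → ∀ z : W,
      (‖z - t • M z‖ + C * t ^ 2 * ‖z‖) ^ p ≤
        ‖z‖ ^ p - p * t * (‖z‖ ^ (p - 2) * inner ℝ z (M z)) + η * |t| * ‖z‖ ^ p := by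
  have hp0 : 0 < p := by linarith
  set D : ℝ := K ^ 2 + C with hD
  have hD0 : 0 ≤ D := by positivity
  set L : ℝ := K + D + 1 with hL
  have hL0 : 0 < L := by positivity
  obtain ⟨δ, hδ, hpow⟩ := exists_one_add_rpow_le (p := p) (show (0 : ℝ) < η / (2 * L) by positivity)
  -- The four bounds give in turn `t ^ 2 ≤ |t|`, the range `|s| < δ` of the scalar expansion, the
  -- conditions `|t| * K ≤ 1 / 2` and `1 + s ≥ 0`, and the absorption of `p * D * t ^ 2` into `η / 2
  -- * |t|`.
  refine ⟨min 1 (min (δ / (2 * L)) (min (1 / (2 * L)) (η / (2 * p * (D + 1))))),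
    by positivity, fun t ht M hM z => ?_⟩
  rw [le_min_iff, le_min_iff, le_min_iff, le_div_iff₀ (by positivity), le_div_iff₀ (by positivity),
    le_div_iff₀ (by positivity)] at ht
  obtain ⟨ht1, ht2, ht3, ht4⟩ := ht
  rcases eq_or_ne z 0 with rfl | hz
  · simp [Real.zero_rpow hp0.ne']
  have hz0 : 0 < ‖z‖ := norm_pos_iff.2 hz
  -- The Rayleigh quotient of `M` at `z`. The left side is at most `(1 + s) * ‖z‖` with `s = -t * x
  -- + O(t ^ 2)`, so only the scalar function `(1 + s) ^ p` has to be expanded.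
  set x : ℝ := inner ℝ z (M z) / ‖z‖ ^ 2 with hx
  have hxK : |x| ≤ K := by
    rw [hx, abs_div, abs_of_nonneg (sq_nonneg ‖z‖), div_le_iff₀ (by positivity)]
    calc |inner ℝ z (M z)| ≤ ‖z‖ * ‖M z‖ := abs_real_inner_le_norm _ _
      _ ≤ ‖z‖ * (K * ‖z‖) := by gcongr; exact (M.le_opNorm z).trans (by gcongr)
      _ = K * ‖z‖ ^ 2 := by ring
  have hxi : inner ℝ z (M z) = x * ‖z‖ ^ 2 := by
    rw [hx]; field_simp
  have ht0 := abs_nonneg t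
  have htK : |t| * K ≤ 1 / 2 := by
    have : 0 ≤ |t| * (D + 1) := by positivity
    have h : |t| * (2 * L) = 2 * (|t| * K) + 2 * (|t| * (D + 1)) := by rw [hL]; ring
    linarith
  have htx : |t * x| ≤ |t| * K := by rw [abs_mul]; gcongr
  have ht2' : t ^ 2 ≤ |t| := by
    rw [← sq_abs, sq]; exact mul_le_of_le_one_left ht0 ht1
  have hDt : D * t ^ 2 ≤ D * |t| := by gcongr
  set s : ℝ := -(t * x) + D * t ^ 2 with hs
  have hsabs : |s| ≤ L * |t| := by
    have h1 : |s| ≤ |t * x| + D * t ^ 2 := by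
      rw [hs]
      refine (abs_add_le _ _).trans ?_
      rw [abs_neg, abs_of_nonneg (by positivity : 0 ≤ D * t ^ 2)]
    have h : L * |t| = |t| * K + D * |t| + |t| := by rw [hL]; ring
    linarith
  have hnorm := norm_sub_smul_le htK hM hxK hxi
  have hle : ‖z - t • M z‖ + C * t ^ 2 * ‖z‖ ≤ (1 + s) * ‖z‖ := by
    have : (1 + s) * ‖z‖ = (1 - t * x + K ^ 2 * t ^ 2) * ‖z‖ + C * t ^ 2 * ‖z‖ := by
      rw [hs, hD]; ring
    linarith
  have hs1 : 0 ≤ 1 + s := by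
    have := (abs_le.1 hsabs).1
    linarith
  have hexp : (1 + s) ^ p ≤ 1 + p * s + η / 2 * |t| := by
    have h2 := hpow s (by linarith)
    have h4 : η / (2 * L) * |s| ≤ η / (2 * L) * (L * |t|) := by gcongr
    have h5 : η / (2 * L) * (L * |t|) = η / 2 * |t| := by field_simp
    linarith
  have hquad : p * (D * t ^ 2) ≤ η / 2 * |t| := by
    have h1 : |t| * (p * D) ≤ η / 2 := by
      have : 0 ≤ |t| * p := by positivity
      linarith
    calc p * (D * t ^ 2) = |t| * (p * D) * |t| := by rw [← sq_abs t]; ring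
      _ ≤ η / 2 * |t| := by gcongr
  have hzz : ‖z‖ ^ (p - 2) * inner ℝ z (M z) = x * ‖z‖ ^ p := by
    rw [hxi, mul_left_comm, ← Real.rpow_natCast ‖z‖ 2, ← Real.rpow_add hz0]
    norm_num
  calc (‖z - t • M z‖ + C * t ^ 2 * ‖z‖) ^ p ≤ ((1 + s) * ‖z‖) ^ p := by
        gcongr
    _ = (1 + s) ^ p * ‖z‖ ^ p := Real.mul_rpow hs1 hz0.le
    _ ≤ (1 + p * s + η / 2 * |t|) * ‖z‖ ^ p := by gcongr
    _ ≤ (1 - p * t * x + η * |t|) * ‖z‖ ^ p := by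
        refine mul_le_mul_of_nonneg_right ?_ (by positivity)
        have : p * s = - p * t * x + p * (D * t ^ 2) := by rw [hs]; ring
        linarith
    _ = _ := by rw [hzz]; ring

end Pointwise

/-! ### Abstract minimization of a uniformly convex energy with a linear load. -/

section Minimization

/-- Uniform convexity of the `p`-th power of the norm. -/
def UniformlyConvexRpow (p : ℝ) (Z : Type*) [NormedAddCommGroup Z] [NormedSpace ℝ Z] : Prop :=
  ∀ ε : ℝ, 0 < ε → ∃ C : ℝ, 0 ≤ C ∧ ∀ a b : Z, ‖a - b‖ ^ p ≤ ε * (‖a‖ ^ p + ‖b‖ ^ p) +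
      C * ((‖a‖ ^ p + ‖b‖ ^ p) / 2 - ‖(1 / 2 : ℝ) • (a + b)‖ ^ p)

section

variable {Z₁ Z₂ Z₃ : Type*} [NormedAddCommGroup Z₁] [NormedAddCommGroup Z₂]

/-- The sum of the `p`-th powers of the norms of the first two components. -/
def powerEnergy (p : ℝ) (U : Z₁ × Z₂ × Z₃) : ℝ := ‖U.1‖ ^ p + ‖U.2.1‖ ^ p

theorem powerEnergy_nonneg (p : ℝ) (U : Z₁ × Z₂ × Z₃) : 0 ≤ powerEnergy p U := by
  unfold powerEnergy; positivity

theorem continuous_powerEnergy [TopologicalSpace Z₃] {p : ℝ} (hp : 0 ≤ p) :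
    Continuous (powerEnergy p : Z₁ × Z₂ × Z₃ → ℝ) := by
  unfold powerEnergy
  exact (Continuous.rpow_const (by fun_prop) fun _ => Or.inr hp).add
    (Continuous.rpow_const (by fun_prop) fun _ => Or.inr hp)

end

variable {Z₁ Z₂ Z₃ : Type*} [NormedAddCommGroup Z₁] [NormedSpace ℝ Z₁]
  [NormedAddCommGroup Z₂] [NormedSpace ℝ Z₂] [NormedAddCommGroup Z₃] [NormedSpace ℝ Z₃]

/-- The energy functional with a load acting on the third component. -/
def loadedEnergy (p : ℝ) (l : Z₃ →L[ℝ] ℝ) (U : Z₁ × Z₂ × Z₃) : ℝ :=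
  powerEnergy p U / p - l U.2.2

theorem continuous_loadedEnergy {p : ℝ} (hp : 0 ≤ p) (l : Z₃ →L[ℝ] ℝ) :
    Continuous (loadedEnergy p l : Z₁ × Z₂ × Z₃ → ℝ) := by
  unfold loadedEnergy
  exact ((continuous_powerEnergy hp).div_const p).sub (by fun_prop)

/-- Young's inequality with a small coefficient, by comparing `x` with the threshold at which `x ^
(p - 1) = L * M`. -/
theorem exists_mul_le_rpow_div_add {p : ℝ} (hp : 1 < p) {L M : ℝ} (hL : 0 ≤ L) (hM : 0 < M) :
    ∃ c : ℝ, 0 ≤ c ∧ ∀ l x : ℝ, l ≤ L → 0 ≤ x → l * x ≤ x ^ p / M + c := by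
  have hp1 : 0 < p - 1 := by linarith
  refine ⟨L * (L * M) ^ (p - 1)⁻¹, by positivity, fun l x hl hx => ?_⟩
  have hlx : l * x ≤ L * x := by gcongr
  refine hlx.trans ?_
  rcases le_total x ((L * M) ^ (p - 1)⁻¹) with h | h
  · have h1 : L * x ≤ L * (L * M) ^ (p - 1)⁻¹ := by gcongr
    have : 0 ≤ x ^ p / M := by positivity
    linarith
  · have h1 : L * M ≤ x ^ (p - 1) := by
      have := Real.rpow_le_rpow (by positivity) h hp1.le
      rwa [Real.rpow_inv_rpow (by positivity) hp1.ne'] at this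
    have h2 : L * x ≤ x ^ p / M := by
      rw [le_div_iff₀ hM]
      calc L * x * M = L * M * x := by ring
        _ ≤ x ^ (p - 1) * x := by gcongr
        _ = x ^ p := by rw [← Real.rpow_add_one' hx (by linarith)]; ring_nf
    have : 0 ≤ L * (L * M) ^ (p - 1)⁻¹ := by positivity
    linarith

variable {X : Submodule ℝ (Z₁ × Z₂ × Z₃)} {p Ctr : ℝ}

/-- Coercivity, uniform over loads in a ball. Through the trace inequality, half of `powerEnergy p U
/ p` absorbs the load; the Young parameter `2 * p * (Ctr + 1)` is chosen for this, and the added `1`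
keeps it positive when `Ctr = 0`. -/
theorem exists_powerEnergy_le_loadedEnergy (hp : 1 < p) (hC : 0 ≤ Ctr)
    (htr : ∀ U ∈ X, ‖U.2.2‖ ^ p ≤ Ctr * powerEnergy p U) {L : ℝ} (hL : 0 ≤ L) :
    ∃ c : ℝ, 0 ≤ c ∧ ∀ l : Z₃ →L[ℝ] ℝ, ‖l‖ ≤ L → ∀ U ∈ X,
      powerEnergy p U ≤ 2 * p * loadedEnergy p l U + c := by
  have hp0 : 0 < p := by linarith
  obtain ⟨c, hc, h⟩ := exists_mul_le_rpow_div_add hp hL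
    (show 0 < 2 * p * (Ctr + 1) by positivity)
  refine ⟨2 * p * c, by positivity, fun l hl U hU => ?_⟩
  have h1 : l U.2.2 ≤ ‖l‖ * ‖U.2.2‖ := (le_abs_self _).trans (l.le_opNorm _)
  have h2 := h ‖l‖ ‖U.2.2‖ hl (norm_nonneg _)
  have hN := powerEnergy_nonneg p U
  have h3 : ‖U.2.2‖ ^ p / (2 * p * (Ctr + 1)) ≤ powerEnergy p U / (2 * p) := by
    rw [div_le_div_iff₀ (by positivity) (by positivity)]
    have := htr U hU
    have h4 : ‖U.2.2‖ ^ p ≤ (Ctr + 1) * powerEnergy p U := by linarith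
    calc ‖U.2.2‖ ^ p * (2 * p) ≤ (Ctr + 1) * powerEnergy p U * (2 * p) := by gcongr
      _ = _ := by ring
  have h5 : l U.2.2 ≤ powerEnergy p U / (2 * p) + c := by linarith
  have h6 := mul_le_mul_of_nonneg_left h5 (show 0 ≤ 2 * p by positivity)
  have h7 : 2 * p * (powerEnergy p U / (2 * p) + c) = powerEnergy p U + 2 * p * c := by
    field_simp
  have h8 : 2 * p * loadedEnergy p l U = 2 * powerEnergy p U - 2 * p * l U.2.2 := by
    unfold loadedEnergy; field_simp
  linarith

/-- Almost minimizers of the loaded energy are close to each other. -/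
theorem exists_dist_le_of_almost_minimizer (hp : 1 < p) (hC : 0 ≤ Ctr)
    (htr : ∀ U ∈ X, ‖U.2.2‖ ^ p ≤ Ctr * powerEnergy p U)
    (h₁ : UniformlyConvexRpow p Z₁) (h₂ : UniformlyConvexRpow p Z₂)
    (l : Z₃ →L[ℝ] ℝ) {m : ℝ} (hm : ∀ U ∈ X, m ≤ loadedEnergy p l U) {ε : ℝ} (hε : 0 < ε) :
    ∃ δ : ℝ, 0 < δ ∧ ∀ U ∈ X, ∀ V ∈ X, loadedEnergy p l U ≤ m + δ → loadedEnergy p l V ≤ m + δ →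
      ‖U - V‖ ≤ ε := by
  have hp0 : 0 < p := by linarith
  obtain ⟨c, hc, hco⟩ := exists_powerEnergy_le_loadedEnergy hp hC htr (norm_nonneg l)
  set R : ℝ := 2 * p * (|m| + 1) + c with hR
  have hR0 : 0 < R := by positivity
  have hεp : 0 < ε ^ p := Real.rpow_pos_of_pos hε p
  -- The size of `powerEnergy p (U - V)` below which all three components of `U - V`, the trace
  -- included, have norm at most `ε`.
  set κ : ℝ := ε ^ p / (1 + Ctr) with hκ
  have hκ0 : 0 < κ := by positivity
  obtain ⟨C₁, hC₁, hu₁⟩ := h₁ (κ / (4 * R)) (by positivity)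
  obtain ⟨C₂, hC₂, hu₂⟩ := h₂ (κ / (4 * R)) (by positivity)
  refine ⟨min 1 (κ / (2 * (p * (C₁ + C₂ + 1)))), by positivity, fun U hU V hV hUm hVm => ?_⟩
  set δ : ℝ := min 1 (κ / (2 * (p * (C₁ + C₂ + 1)))) with hδ
  have hδ1 : δ ≤ 1 := min_le_left _ _
  have hδ2 : δ * (2 * (p * (C₁ + C₂ + 1))) ≤ κ := by
    rw [← le_div_iff₀ (by positivity)]; exact min_le_right _ _
  have hNR : ∀ W ∈ X, loadedEnergy p l W ≤ m + δ → powerEnergy p W ≤ R := fun W hW hWm => by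
    have h1 := hco l le_rfl W hW
    have h2 : 2 * p * loadedEnergy p l W ≤ 2 * p * (|m| + 1) := by
      gcongr; linarith [le_abs_self m]
    linarith
  have hNU := hNR U hU hUm
  have hNV := hNR V hV hVm
  -- The midpoint is a competitor and the load is linear, so the whole convexity gap of `powerEnergy
  -- p / p` is at most `δ`.
  have hmid : (1 / 2 : ℝ) • (U + V) ∈ X := X.smul_mem _ (X.add_mem hU hV)
  have hJmid := hm _ hmid
  have hgap : (powerEnergy p U + powerEnergy p V) / 2 - powerEnergy p ((1 / 2 : ℝ) • (U + V)) ≤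
      p * δ := by
    have h3 : l ((1 / 2 : ℝ) • (U + V)).2.2 = (l U.2.2 + l V.2.2) / 2 := by
      simp [map_smul]; ring
    unfold loadedEnergy at hUm hVm hJmid
    rw [h3] at hJmid
    have h4 : ((powerEnergy p U + powerEnergy p V) / 2 - powerEnergy p ((1 / 2 : ℝ) • (U + V))) / p
        ≤ δ := by
      have : ((powerEnergy p U + powerEnergy p V) / 2 -
          powerEnergy p ((1 / 2 : ℝ) • (U + V))) / p =
          (powerEnergy p U / p + powerEnergy p V / p) / 2 -
          powerEnergy p ((1 / 2 : ℝ) • (U + V)) / p := by ring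
      rw [this]; linarith
    rw [div_le_iff₀ hp0] at h4
    linarith
  set g₁ : ℝ := (‖U.1‖ ^ p + ‖V.1‖ ^ p) / 2 - ‖(1 / 2 : ℝ) • (U.1 + V.1)‖ ^ p with hg₁
  set g₂ : ℝ := (‖U.2.1‖ ^ p + ‖V.2.1‖ ^ p) / 2 - ‖(1 / 2 : ℝ) • (U.2.1 + V.2.1)‖ ^ p with hg₂
  have hg : g₁ + g₂ ≤ p * δ := by
    refine le_trans (le_of_eq ?_) hgap
    simp only [powerEnergy, hg₁, hg₂, Prod.smul_fst, Prod.smul_snd, Prod.fst_add, Prod.snd_add]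
    ring
  have hg₁0 : 0 ≤ g₁ := sub_nonneg.2 (norm_midpoint_rpow_le hp _ _)
  have hg₂0 : 0 ≤ g₂ := sub_nonneg.2 (norm_midpoint_rpow_le hp _ _)
  have e₁ := hu₁ U.1 V.1
  have e₂ := hu₂ U.2.1 V.2.1
  rw [← hg₁] at e₁
  rw [← hg₂] at e₂
  have hNdiff : powerEnergy p (U - V) ≤ κ := by
    have h5 : powerEnergy p (U - V) = ‖U.1 - V.1‖ ^ p + ‖U.2.1 - V.2.1‖ ^ p := rfl
    have h6 : κ / (4 * R) * (‖U.1‖ ^ p + ‖V.1‖ ^ p) + κ / (4 * R) * (‖U.2.1‖ ^ p + ‖V.2.1‖ ^ p) ≤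
        κ / 2 := by
      have : κ / (4 * R) * (‖U.1‖ ^ p + ‖V.1‖ ^ p) + κ / (4 * R) * (‖U.2.1‖ ^ p + ‖V.2.1‖ ^ p) =
          κ / (4 * R) * (powerEnergy p U + powerEnergy p V) := by unfold powerEnergy; ring
      rw [this]
      calc κ / (4 * R) * (powerEnergy p U + powerEnergy p V) ≤ κ / (4 * R) * (R + R) := by gcongr
        _ = κ / 2 := by field_simp; ring
    have h7 : C₁ * g₁ + C₂ * g₂ ≤ (C₁ + C₂ + 1) * (g₁ + g₂) := by
      nlinarith [mul_nonneg hC₁ hg₂0, mul_nonneg hC₂ hg₁0]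
    have h8 : (C₁ + C₂ + 1) * (g₁ + g₂) ≤ (C₁ + C₂ + 1) * (p * δ) := by gcongr
    rw [h5]
    linarith
  have hmemd : U - V ∈ X := X.sub_mem hU hV
  have hbound : ∀ x : ℝ, 0 ≤ x → x ^ p ≤ (1 + Ctr) * powerEnergy p (U - V) → x ≤ ε :=
    fun x hx hxp => by
    have h9 : x ^ p ≤ ε ^ p := by
      refine hxp.trans ?_
      calc (1 + Ctr) * powerEnergy p (U - V) ≤ (1 + Ctr) * κ := by gcongr
        _ = ε ^ p := by rw [hκ]; field_simp
    exact (Real.rpow_le_rpow_iff hx hε.le hp0).1 h9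
  have hNd := powerEnergy_nonneg p (U - V)
  have hx1 : 0 ≤ ‖(U - V).1‖ ^ p := by positivity
  have hx2 : 0 ≤ ‖(U - V).2.1‖ ^ p := by positivity
  have hdef : powerEnergy p (U - V) = ‖(U - V).1‖ ^ p + ‖(U - V).2.1‖ ^ p := rfl
  have hCN : 0 ≤ Ctr * powerEnergy p (U - V) := by positivity
  refine norm_prod_le_iff.2 ⟨?_, norm_prod_le_iff.2 ⟨?_, ?_⟩⟩
  · exact hbound _ (norm_nonneg _) (by linarith)
  · exact hbound _ (norm_nonneg _) (by linarith)
  · exact hbound _ (norm_nonneg _) (by linarith [htr _ hmemd])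

/-- Minimizing sequences consist of almost minimizers and are therefore Cauchy in norm; no weak
compactness or weak lower semicontinuity is needed. -/
theorem exists_minimizer [CompleteSpace Z₁] [CompleteSpace Z₂] [CompleteSpace Z₃]
    (hX : IsClosed (X : Set (Z₁ × Z₂ × Z₃))) (hp : 1 < p) (hC : 0 ≤ Ctr)
    (htr : ∀ U ∈ X, ‖U.2.2‖ ^ p ≤ Ctr * powerEnergy p U)
    (h₁ : UniformlyConvexRpow p Z₁) (h₂ : UniformlyConvexRpow p Z₂) (l : Z₃ →L[ℝ] ℝ) :
    ∃ U ∈ X, ∀ V ∈ X, loadedEnergy p l U ≤ loadedEnergy p l V := by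
  have hp0 : 0 < p := by linarith
  obtain ⟨c, hc, hco⟩ := exists_powerEnergy_le_loadedEnergy hp hC htr (norm_nonneg l)
  set S : Set ℝ := loadedEnergy p l '' (X : Set (Z₁ × Z₂ × Z₃)) with hS
  have hne : S.Nonempty := ⟨_, 0, X.zero_mem, rfl⟩
  have hbdd : BddBelow S := by
    refine ⟨-c / (2 * p), ?_⟩
    rintro _ ⟨U, hU, rfl⟩
    rw [div_le_iff₀ (by positivity)]
    linarith [hco l le_rfl U hU, powerEnergy_nonneg p U]
  set m := sInf S
  have hm : ∀ U ∈ X, m ≤ loadedEnergy p l U := fun U hU => csInf_le hbdd ⟨U, hU, rfl⟩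
  have hseq : ∀ n : ℕ, ∃ U ∈ X, loadedEnergy p l U < m + 1 / ((n : ℝ) + 1) := fun n => by
    obtain ⟨_, ⟨U, hU, rfl⟩, h⟩ := exists_lt_of_csInf_lt hne
      (show m < m + 1 / ((n : ℝ) + 1) by have : 0 < 1 / ((n : ℝ) + 1) := by positivity
                                         linarith)
    exact ⟨U, hU, h⟩
  choose U hUX hUm using hseq
  have hcau : CauchySeq U := by
    rw [Metric.cauchySeq_iff']
    intro ε hε
    obtain ⟨δ, hδ, hd⟩ := exists_dist_le_of_almost_minimizer hp hC htr h₁ h₂ l hm (half_pos hε)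
    obtain ⟨n, hn⟩ := exists_nat_one_div_lt hδ
    refine ⟨n, fun k hk => ?_⟩
    have hle : 1 / ((k : ℝ) + 1) ≤ 1 / ((n : ℝ) + 1) := by gcongr
    have := hd (U k) (hUX k) (U n) (hUX n) (by linarith [hUm k]) (by linarith [hUm n])
    rw [dist_eq_norm]
    linarith
  obtain ⟨U₀, hU₀⟩ := cauchySeq_tendsto_of_complete hcau
  refine ⟨U₀, hX.mem_of_tendsto hU₀ (Eventually.of_forall hUX), fun V hV => ?_⟩
  have h1 : Tendsto (fun n => loadedEnergy p l (U n)) atTop (𝓝 (loadedEnergy p l U₀)) :=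
    ((continuous_loadedEnergy hp0.le l).tendsto U₀).comp hU₀
  have h2 : Tendsto (fun n : ℕ => m + 1 / ((n : ℝ) + 1)) atTop (𝓝 (m + 0)) :=
    tendsto_const_nhds.add tendsto_one_div_add_atTop_nhds_zero_nat
  rw [add_zero] at h2
  exact (le_of_tendsto_of_tendsto h1 h2 (Eventually.of_forall fun n => (hUm n).le)).trans (hm V hV)

theorem minimizer_unique (hp : 1 < p) (hC : 0 ≤ Ctr)
    (htr : ∀ U ∈ X, ‖U.2.2‖ ^ p ≤ Ctr * powerEnergy p U)
    (h₁ : UniformlyConvexRpow p Z₁) (h₂ : UniformlyConvexRpow p Z₂) (l : Z₃ →L[ℝ] ℝ)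
    {U V : Z₁ × Z₂ × Z₃} (hU : U ∈ X) (hV : V ∈ X)
    (hUm : ∀ W ∈ X, loadedEnergy p l U ≤ loadedEnergy p l W)
    (hVm : ∀ W ∈ X, loadedEnergy p l V ≤ loadedEnergy p l W) : U = V := by
  refine eq_of_norm_sub_le_zero (le_of_forall_pos_le_add fun ε hε => ?_)
  obtain ⟨δ, hδ, hd⟩ := exists_dist_le_of_almost_minimizer hp hC htr h₁ h₂ l hUm hε
  rw [zero_add]
  exact hd U hU V hV (by linarith) (by linarith [hVm U hU])

/-- Minimizers depend continuously on the load. -/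
theorem tendsto_minimizer (hp : 1 < p) (hC : 0 ≤ Ctr)
    (htr : ∀ U ∈ X, ‖U.2.2‖ ^ p ≤ Ctr * powerEnergy p U)
    (h₁ : UniformlyConvexRpow p Z₁) (h₂ : UniformlyConvexRpow p Z₂)
    {ι : Type*} {F : Filter ι} {l : ι → Z₃ →L[ℝ] ℝ} {l₀ : Z₃ →L[ℝ] ℝ} (hl : Tendsto l F (𝓝 l₀))
    {U : ι → Z₁ × Z₂ × Z₃} {U₀ : Z₁ × Z₂ × Z₃} (hU : ∀ i, U i ∈ X) (hU₀ : U₀ ∈ X)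
    (hUm : ∀ i, ∀ W ∈ X, loadedEnergy p (l i) (U i) ≤ loadedEnergy p (l i) W)
    (hU₀m : ∀ W ∈ X, loadedEnergy p l₀ U₀ ≤ loadedEnergy p l₀ W) :
    Tendsto U F (𝓝 U₀) := by
  have hp0 : 0 < p := by linarith
  obtain ⟨c, hc, hco⟩ := exists_powerEnergy_le_loadedEnergy hp hC htr
    (show 0 ≤ ‖l₀‖ + 1 by positivity)
  -- Comparison with the zero competitor bounds the minimal energies; coercivity and the trace
  -- inequality then bound the traces of all `U i` whose load is close to `l₀` by the one constant
  -- `D`.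
  have hzero : ∀ i, loadedEnergy p (l i) (U i) ≤ 0 := fun i => by
    have := hUm i 0 X.zero_mem
    simpa [loadedEnergy, powerEnergy, Real.zero_rpow hp0.ne'] using this
  have hdiff : ∀ i (W : Z₁ × Z₂ × Z₃), loadedEnergy p l₀ W =
      loadedEnergy p (l i) W + (l i - l₀) W.2.2 := fun i W => by
    simp [loadedEnergy]
  set D : ℝ := (Ctr * c) ^ p⁻¹ with hD
  have hgb : ∀ i, ‖l i‖ ≤ ‖l₀‖ + 1 → ‖(U i).2.2‖ ≤ D := fun i hi => by
    have h3 := hco (l i) hi (U i) (hU i)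
    have h4 : 2 * p * loadedEnergy p (l i) (U i) ≤ 0 :=
      mul_nonpos_of_nonneg_of_nonpos (by positivity) (hzero i)
    have h5 : ‖(U i).2.2‖ ^ p ≤ Ctr * c := (htr _ (hU i)).trans (by gcongr; linarith)
    rw [hD, Real.le_rpow_inv_iff_of_pos (norm_nonneg _) (by positivity) hp0]
    exact h5
  rw [tendsto_iff_norm_sub_tendsto_zero, Metric.tendsto_nhds]
  intro ε hε
  obtain ⟨δ, hδ, hd⟩ := exists_dist_le_of_almost_minimizer hp hC htr h₁ h₂ l₀ hU₀m (half_pos hε)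
  have hsmall : ∀ᶠ i in F, ‖l i - l₀‖ < min 1 (δ / (D + ‖U₀.2.2‖ + 1)) := by
    have := tendsto_iff_norm_sub_tendsto_zero.1 hl
    exact this.eventually_lt_const (by positivity)
  filter_upwards [hsmall] with i hi
  rw [lt_min_iff, lt_div_iff₀ (by positivity)] at hi
  have hli : ‖l i‖ ≤ ‖l₀‖ + 1 := by
    have := norm_add_le (l i - l₀) l₀
    rw [sub_add_cancel] at this
    linarith
  -- Exchanging the load at both `U i` and `U₀` costs `‖l i - l₀‖` times bounded traces, so `U i`
  -- almost minimizes the limit energy.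
  have h6 : loadedEnergy p l₀ (U i) ≤ loadedEnergy p l₀ U₀ + δ := by
    have h7 := hUm i U₀ hU₀
    have h8 := hdiff i (U i)
    have h9 := hdiff i U₀
    have h10 : (l i - l₀) (U i).2.2 ≤ ‖l i - l₀‖ * D :=
      (le_abs_self _).trans (((l i - l₀).le_opNorm _).trans (by gcongr; exact hgb i hli))
    have h11 : -(l i - l₀) U₀.2.2 ≤ ‖l i - l₀‖ * ‖U₀.2.2‖ :=
      (neg_le_abs _).trans ((l i - l₀).le_opNorm _)
    have := norm_nonneg (l i - l₀)
    nlinarith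
  have := hd (U i) (hU i) U₀ hU₀ h6 (by linarith)
  rw [Real.dist_eq, sub_zero, abs_of_nonneg (norm_nonneg _)]
  linarith

end Minimization

/-! ### Integrated inequalities and differentiation in `L^p`. -/

section LpSpaces

variable {α : Type*} [MeasurableSpace α] {μ : Measure α}
  {W : Type*} [NormedAddCommGroup W] {p : ℝ}

theorem one_le_ofReal_of_one_lt (hp : 1 < p) : Fact (1 ≤ ENNReal.ofReal p) :=
  ⟨by simpa using ENNReal.ofReal_le_ofReal hp.le⟩

theorem integrable_norm_rpow_of_memLp (hp : 0 < p) {a : α → W}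
    (ha : MemLp a (ENNReal.ofReal p) μ) : Integrable (fun x => ‖a x‖ ^ p) μ := by
  simpa [ENNReal.toReal_ofReal hp.le] using ha.integrable_norm_rpow (by simpa using hp) (by simp)

theorem norm_rpow_eq_integral (hp : 0 < p) (a : Lp W (ENNReal.ofReal p) μ) :
    ‖a‖ ^ p = ∫ x, ‖a x‖ ^ p ∂μ := by
  have h0 : 0 ≤ ∫ x, ‖a x‖ ^ p ∂μ := integral_nonneg fun x => by positivity
  rw [Lp.norm_def, (Lp.memLp a).eLpNorm_eq_integral_rpow_norm (by simpa using hp) (by simp),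
    ENNReal.toReal_ofReal hp.le, ENNReal.toReal_ofReal (by positivity),
    Real.rpow_inv_rpow h0 hp.ne']

theorem norm_toLp_rpow_eq_integral (hp : 0 < p) {a : α → W}
    (ha : MemLp a (ENNReal.ofReal p) μ) : ‖ha.toLp a‖ ^ p = ∫ x, ‖a x‖ ^ p ∂μ := by
  rw [norm_rpow_eq_integral hp]
  refine integral_congr_ae ?_
  filter_upwards [ha.coeFn_toLp] with x hx
  rw [hx]

variable [InnerProductSpace ℝ W]

/-- The pointwise inequality involves only p-th powers and has constants independent of the point,
so it integrates term by term to the same inequality for the norms. -/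
theorem uniformlyConvexRpow_Lp [FiniteDimensional ℝ W] (hp : 1 < p) [Fact (1 ≤ ENNReal.ofReal p)] :
    UniformlyConvexRpow p (Lp W (ENNReal.ofReal p) μ) := by
  intro ε hε
  have hp0 : 0 < p := by linarith
  obtain ⟨C, hC, h⟩ := exists_norm_sub_rpow_le (W := W) hp hε
  refine ⟨C, hC, fun a b => ?_⟩
  have ha := integrable_norm_rpow_of_memLp hp0 (Lp.memLp a)
  have hb := integrable_norm_rpow_of_memLp hp0 (Lp.memLp b)
  have hm := integrable_norm_rpow_of_memLp hp0 (Lp.memLp ((1 / 2 : ℝ) • (a + b)))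
  have hd := integrable_norm_rpow_of_memLp hp0 (Lp.memLp (a - b))
  have hab : Integrable (fun x => ‖a x‖ ^ p + ‖b x‖ ^ p) μ := ha.add hb
  have hgap : Integrable (fun x => (‖a x‖ ^ p + ‖b x‖ ^ p) / 2 -
      ‖((1 / 2 : ℝ) • (a + b) : Lp W (ENNReal.ofReal p) μ) x‖ ^ p) μ := (hab.div_const 2).sub hm
  rw [norm_rpow_eq_integral hp0 a, norm_rpow_eq_integral hp0 b, norm_rpow_eq_integral hp0 (a - b),
    norm_rpow_eq_integral hp0 ((1 / 2 : ℝ) • (a + b)), ← integral_add ha hb, ← integral_div,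
    ← integral_sub (hab.div_const 2) hm, ← integral_const_mul, ← integral_const_mul,
    ← integral_add (hab.const_mul ε) (hgap.const_mul C)]
  refine integral_mono_ae hd ((hab.const_mul ε).add (hgap.const_mul C)) ?_
  filter_upwards [Lp.coeFn_sub a b, Lp.coeFn_smul (1 / 2 : ℝ) (a + b), Lp.coeFn_add a b]
    with x h1 h2 h3
  simp only [h1, h2, h3, Pi.sub_apply, Pi.smul_apply, Pi.add_apply]
  exact h (a x) (b x)

section Homogeneous

variable [FiniteDimensional ℝ W] {Z : Type*} [TopologicalSpace Z] {K : Set Z} {F : Z → W → ℝ} {z : α → Z}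

theorem integrable_of_homogeneous (hp : 0 < p) (hK : IsCompact K)
    (hF : Continuous fun q : Z × W => F q.1 q.2)
    (hFh : ∀ z ∈ K, ∀ r : ℝ, 0 ≤ r → ∀ a, F z (r • a) = r ^ p * F z a)
    (hz : AEStronglyMeasurable z μ) (hzK : ∀ᵐ x ∂μ, z x ∈ K) {a : α → W}
    (ha : MemLp a (ENNReal.ofReal p) μ) : Integrable (fun x => F (z x) (a x)) μ := by
  obtain ⟨C, hC, h⟩ := exists_abs_sub_le_of_homogeneous hK hp hF.continuousOn hFh one_pos
  have hi := integrable_norm_rpow_of_memLp hp ha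
  refine Integrable.mono' (hi.const_mul (1 + C))
    (hF.comp_aestronglyMeasurable (hz.prodMk ha.1)) ?_
  filter_upwards [hzK] with x hx
  have h1 := h (z x) hx (a x) 0
  have h2 := hFh (z x) hx 0 le_rfl 0
  rw [Real.zero_rpow hp.ne', zero_mul, smul_zero] at h2
  rw [h2, sub_zero, sub_zero, norm_zero, Real.zero_rpow hp.ne'] at h1
  rw [Real.norm_eq_abs]
  linarith

theorem continuous_integral_of_homogeneous (hp : 0 < p) [Fact (1 ≤ ENNReal.ofReal p)]
    (hK : IsCompact K) (hF : Continuous fun q : Z × W => F q.1 q.2)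
    (hFh : ∀ z ∈ K, ∀ r : ℝ, 0 ≤ r → ∀ a, F z (r • a) = r ^ p * F z a)
    (hz : AEStronglyMeasurable z μ) (hzK : ∀ᵐ x ∂μ, z x ∈ K) :
    Continuous fun a : Lp W (ENNReal.ofReal p) μ => ∫ x, F (z x) (a x) ∂μ := by
  rw [continuous_iff_continuousAt]
  intro a
  rw [ContinuousAt, tendsto_iff_norm_sub_tendsto_zero, Metric.tendsto_nhds]
  intro ε hε
  -- An upper bound for `‖a‖ ^ p + ‖b‖ ^ p` over the unit ball around `a`; the comparison is used
  -- with parameter `ε / (2 * R)`, so its first term stays below `ε / 2`.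
  set R : ℝ := ‖a‖ ^ p + (‖a‖ + 1) ^ p + 1 with hR
  have hR0 : 0 < R := by positivity
  obtain ⟨C, hC, h⟩ := exists_abs_sub_le_of_homogeneous hK hp hF.continuousOn hFh
    (show 0 < ε / (2 * R) by positivity)
  have hsmall : ∀ᶠ b : Lp W (ENNReal.ofReal p) μ in 𝓝 a, C * ‖b - a‖ ^ p < ε / 2 := by
    have : Tendsto (fun b : Lp W (ENNReal.ofReal p) μ => C * ‖b - a‖ ^ p) (𝓝 a) (𝓝 0) := by
      have hc : Continuous fun b : Lp W (ENNReal.ofReal p) μ => C * ‖b - a‖ ^ p :=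
        continuous_const.mul (Continuous.rpow_const (by fun_prop) fun _ => Or.inr hp.le)
      have := hc.tendsto a
      simpa [Real.zero_rpow hp.ne'] using this
    exact this.eventually_lt_const (by positivity)
  filter_upwards [hsmall, Metric.ball_mem_nhds a one_pos] with b hb hba
  have hia := integrable_of_homogeneous hp hK hF hFh hz hzK (Lp.memLp a)
  have hib := integrable_of_homogeneous hp hK hF hFh hz hzK (Lp.memLp b)
  have ha := integrable_norm_rpow_of_memLp hp (Lp.memLp a)
  have hb' := integrable_norm_rpow_of_memLp hp (Lp.memLp b)
  have hd := integrable_norm_rpow_of_memLp hp (Lp.memLp (b - a))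
  have hbn : ‖b‖ ≤ ‖a‖ + 1 := by
    have h1 := norm_add_le (b - a) a
    rw [sub_add_cancel] at h1
    rw [Metric.mem_ball, dist_eq_norm] at hba
    linarith
  have hbp : ‖b‖ ^ p ≤ (‖a‖ + 1) ^ p := Real.rpow_le_rpow (norm_nonneg _) hbn hp.le
  rw [dist_zero_right, norm_norm, ← integral_sub hib hia]
  have hab : Integrable (fun x => ‖b x‖ ^ p + ‖a x‖ ^ p) μ := hb'.add ha
  have key : ‖∫ x, (F (z x) (b x) - F (z x) (a x)) ∂μ‖ ≤
      ε / (2 * R) * (‖b‖ ^ p + ‖a‖ ^ p) + C * ‖b - a‖ ^ p := by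
    rw [norm_rpow_eq_integral hp a, norm_rpow_eq_integral hp b,
      norm_rpow_eq_integral hp (b - a), ← integral_add hb' ha, ← integral_const_mul,
      ← integral_const_mul, ← integral_add (hab.const_mul _) (hd.const_mul C)]
    refine norm_integral_le_of_norm_le ((hab.const_mul _).add (hd.const_mul C)) ?_
    filter_upwards [hzK, Lp.coeFn_sub b a] with x hx h1
    simp only [h1, Pi.sub_apply]
    exact h (z x) hx (b x) (a x)
  have h3 : ε / (2 * R) * (‖b‖ ^ p + ‖a‖ ^ p) ≤ ε / 2 := by
    calc ε / (2 * R) * (‖b‖ ^ p + ‖a‖ ^ p) ≤ ε / (2 * R) * R := by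
          gcongr; rw [hR]; linarith
      _ = ε / 2 := by field_simp
  linarith

end Homogeneous

theorem integrable_norm_rpow_mul_inner (hp : 1 < p) {a b : α → W}
    (ha : MemLp a (ENNReal.ofReal p) μ) (hb : MemLp b (ENNReal.ofReal p) μ) :
    Integrable (fun x => ‖a x‖ ^ (p - 2) * inner ℝ (a x) (b x)) μ := by
  have hp0 : 0 < p := by linarith
  refine Integrable.mono' ((integrable_norm_rpow_of_memLp hp0 ha).add
    (integrable_norm_rpow_of_memLp hp0 hb))
    ((ha.1.norm.aemeasurable.pow_const (p - 2)).aestronglyMeasurable.mul (ha.1.inner hb.1)) ?_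
  refine Eventually.of_forall fun x => ?_
  exact (abs_norm_rpow_mul_inner_le hp _ _).trans
    (rpow_sub_one_mul_le hp (norm_nonneg _) (norm_nonneg _))

/-- Differentiation under the integral sign for `|s| < 1`, where `(‖a‖ + ‖b‖) ^ p + ‖b‖ ^ p` times
`p` dominates the derivative. -/
theorem hasDerivAt_integral_norm_add_smul_rpow (hp : 1 < p) {a b : α → W}
    (ha : MemLp a (ENNReal.ofReal p) μ) (hb : MemLp b (ENNReal.ofReal p) μ) :
    HasDerivAt (fun s : ℝ => ∫ x, ‖a x + s • b x‖ ^ p ∂μ)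
      (p * ∫ x, ‖a x‖ ^ (p - 2) * inner ℝ (a x) (b x) ∂μ) 0 := by
  have hp0 : 0 < p := by linarith
  have hs : ∀ s : ℝ, MemLp (fun x => a x + s • b x) (ENNReal.ofReal p) μ :=
    fun s => ha.add (hb.const_smul s)
  have hF' : ∀ s : ℝ, Integrable (fun x => p * (‖a x + s • b x‖ ^ (p - 2) *
      inner ℝ (a x + s • b x) (b x))) μ :=
    fun s => (integrable_norm_rpow_mul_inner hp (hs s) hb).const_mul p
  have hab : MemLp (fun x => ‖a x‖ + ‖b x‖) (ENNReal.ofReal p) μ := ha.norm.add hb.norm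
  have key := hasDerivAt_integral_of_dominated_loc_of_deriv_le (μ := μ) (x₀ := (0 : ℝ))
    (s := Metric.ball (0 : ℝ) 1) (F := fun s x => ‖a x + s • b x‖ ^ p)
    (F' := fun s x => p * (‖a x + s • b x‖ ^ (p - 2) * inner ℝ (a x + s • b x) (b x)))
    (bound := fun x => p * (‖‖a x‖ + ‖b x‖‖ ^ p + ‖b x‖ ^ p))
    (Metric.ball_mem_nhds 0 one_pos)
    (Eventually.of_forall fun s => (integrable_norm_rpow_of_memLp hp0 (hs s)).1)
    (integrable_norm_rpow_of_memLp hp0 (hs 0)) (hF' 0).1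
    (Eventually.of_forall fun x s hs1 => ?_)
    (((integrable_norm_rpow_of_memLp hp0 hab).add
      (integrable_norm_rpow_of_memLp hp0 hb)).const_mul p)
    (Eventually.of_forall fun x s _ => ?_)
  · have := key.2
    simp only [zero_smul, add_zero] at this
    rwa [integral_const_mul] at this
  · rw [norm_mul, Real.norm_of_nonneg hp0.le]
    gcongr
    refine (abs_norm_rpow_mul_inner_le hp _ _).trans ?_
    refine le_trans ?_ (rpow_sub_one_mul_le hp (norm_nonneg _) (norm_nonneg _))
    have h1 : ‖a x + s • b x‖ ≤ ‖a x‖ + ‖b x‖ := by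
      refine (norm_add_le _ _).trans ?_
      rw [norm_smul]
      rw [Metric.mem_ball, dist_zero_right] at hs1
      nlinarith [norm_nonneg (b x)]
    rw [Real.norm_of_nonneg (show 0 ≤ ‖a x‖ + ‖b x‖ by positivity)]
    gcongr
  · have h1 : HasDerivAt (fun s : ℝ => a x + s • b x) (b x) s := by
      simpa using ((hasDerivAt_id s).smul_const (b x)).const_add (a x)
    have h2 := (hasFDerivAt_norm_rpow (a x + s • b x) hp).comp_hasDerivAt s h1
    have h3 : ((p * ‖a x + s • b x‖ ^ (p - 2)) • innerSL ℝ (a x + s • b x)) (b x) =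
        p * (‖a x + s • b x‖ ^ (p - 2) * inner ℝ (a x + s • b x) (b x)) := by
      rw [smul_apply, innerSL_apply_apply, smul_eq_mul, mul_assoc]
    rw [h3] at h2
    exact h2

theorem integral_norm_rpow_add_le (hp : 1 < p) {a b : α → W}
    (ha : MemLp a (ENNReal.ofReal p) μ) (hb : MemLp b (ENNReal.ofReal p) μ) :
    (∫ x, ‖a x‖ ^ p ∂μ) + p * ∫ x, ‖a x‖ ^ (p - 2) * inner ℝ (a x) (b x - a x) ∂μ ≤
      ∫ x, ‖b x‖ ^ p ∂μ := by
  have hp0 : 0 < p := by linarith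
  have h1 := integrable_norm_rpow_of_memLp hp0 ha
  have h2 := integrable_norm_rpow_of_memLp hp0 hb
  have h3 : Integrable (fun x => p * (‖a x‖ ^ (p - 2) * inner ℝ (a x) (b x - a x))) μ :=
    (integrable_norm_rpow_mul_inner hp ha (hb.sub ha)).const_mul p
  rw [← integral_const_mul, ← integral_add h1 h3]
  exact integral_mono (h1.add h3) h2 fun x => norm_rpow_add_le_norm_rpow hp (a x) (b x)

end LpSpaces

/-! ### Spatial estimates for the flow, and its smooth approximations. -/

section Flow

variable {N : ℕ} {V : EuclideanSpace ℝ (Fin N) → EuclideanSpace ℝ (Fin N)} {K : NNReal}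
  {ψ : ℝ → EuclideanSpace ℝ (Fin N) → EuclideanSpace ℝ (Fin N)}

theorem IsFlowOf.add (hψ : IsFlowOf V ψ) (hL : LipschitzWith K V) (s t : ℝ)
    (x : EuclideanSpace ℝ (Fin N)) : ψ (s + t) x = ψ s (ψ t x) := by
  have h := ODE_solution_unique_univ (v := fun _ => V) (s := fun _ => Set.univ) (K := K)
    (f := fun s => ψ (s + t) x) (g := fun s => ψ s (ψ t x)) (t₀ := 0)
    (fun _ => hL.lipschitzOnWith)
    (fun s => ⟨(hψ.hasDerivAt (s + t) x).comp_add_const s t, trivial⟩)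
    (fun s => ⟨hψ.hasDerivAt s _, trivial⟩) (by simp [hψ.map_zero])
  exact congrFun h s

theorem IsFlowOf.neg_apply_apply (hψ : IsFlowOf V ψ) (hL : LipschitzWith K V) (t : ℝ)
    (x : EuclideanSpace ℝ (Fin N)) : ψ (-t) (ψ t x) = x := by
  rw [← hψ.add hL, neg_add_cancel, hψ.map_zero]

theorem IsFlowOf.apply_neg_apply (hψ : IsFlowOf V ψ) (hL : LipschitzWith K V) (t : ℝ)
    (x : EuclideanSpace ℝ (Fin N)) : ψ t (ψ (-t) x) = x := by
  rw [← hψ.add hL, add_neg_cancel, hψ.map_zero]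

theorem IsFlowOf.invFun_eq (hψ : IsFlowOf V ψ) (hL : LipschitzWith K V) (t : ℝ) :
    Function.invFun (ψ t) = ψ (-t) := by
  have hl : Function.LeftInverse (ψ (-t)) (ψ t) := hψ.neg_apply_apply hL t
  funext x
  have h1 := Function.leftInverse_invFun hl.injective (ψ (-t) x)
  rwa [hψ.apply_neg_apply hL] at h1

theorem IsFlowOf.perturbedLoad_eq (hψ : IsFlowOf V ψ) (hL : LipschitzWith K V)
    (f : EuclideanSpace ℝ (Fin N) → ℝ) (t : ℝ) : perturbedLoad ψ f t = fun x => f (ψ (-t) x) := by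
  unfold perturbedLoad
  rw [hψ.invFun_eq hL]
  rfl

/-- Reduces statements about negative times to nonnegative ones. -/
theorem IsFlowOf.reverse (hψ : IsFlowOf V ψ) :
    IsFlowOf (fun x => -V x) (fun t => ψ (-t)) where
  map_zero x := by simp [hψ.map_zero]
  hasDerivAt t x := by
    have h := (hψ.hasDerivAt (-t) x).scomp t (hasDerivAt_neg t)
    simpa [Function.comp_def] using h

theorem IsFlowOf.dist_le_of_nonneg (hψ : IsFlowOf V ψ) (hL : LipschitzWith K V) {t : ℝ}
    (ht : 0 ≤ t) (x y : EuclideanSpace ℝ (Fin N)) :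
    dist (ψ t x) (ψ t y) ≤ dist x y * Real.exp (K * t) := by
  have h := dist_le_of_trajectories_ODE (v := fun _ => V) (K := K) (f := fun s => ψ s x)
    (g := fun s => ψ s y) (a := 0) (b := t) (δ := dist x y) (fun _ => hL)
    (fun s _ => (hψ.hasDerivAt s x).continuousAt.continuousWithinAt)
    (fun s _ => (hψ.hasDerivAt s x).hasDerivWithinAt)
    (fun s _ => (hψ.hasDerivAt s y).continuousAt.continuousWithinAt)
    (fun s _ => (hψ.hasDerivAt s y).hasDerivWithinAt)
    (by simp [hψ.map_zero]) t ⟨ht, le_rfl⟩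
  simpa using h

theorem IsFlowOf.dist_le (hψ : IsFlowOf V ψ) (hL : LipschitzWith K V) (t : ℝ)
    (x y : EuclideanSpace ℝ (Fin N)) :
    dist (ψ t x) (ψ t y) ≤ dist x y * Real.exp (K * |t|) := by
  rcases le_total 0 t with h | h
  · rw [abs_of_nonneg h]; exact hψ.dist_le_of_nonneg hL h x y
  · have := hψ.reverse.dist_le_of_nonneg hL.neg (neg_nonneg.2 h) x y
    rw [abs_of_nonpos h]
    simpa using this

theorem IsFlowOf.lipschitzWith (hψ : IsFlowOf V ψ) (hL : LipschitzWith K V) (t : ℝ) :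
    LipschitzWith (Real.toNNReal (Real.exp (K * |t|))) (ψ t) :=
  LipschitzWith.of_dist_le_mul fun x y => by
    rw [Real.coe_toNNReal _ (Real.exp_pos _).le, mul_comm]
    exact hψ.dist_le hL t x y

theorem IsFlowOf.continuous (hψ : IsFlowOf V ψ) (hL : LipschitzWith K V) (t : ℝ) :
    Continuous (ψ t) := (hψ.lipschitzWith hL t).continuous

theorem IsFlowOf.exists_norm_le (hψ : IsFlowOf V ψ) (hL : LipschitzWith K V) (R : ℝ) :
    ∃ R' : ℝ, R ≤ R' ∧ ∀ t : ℝ, |t| ≤ 1 → ∀ x, ‖x‖ ≤ R → ‖ψ t x‖ ≤ R' := by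
  have hc : ContinuousOn (fun t => ψ t 0) (Set.Icc (-1) 1) :=
    fun s _ => (hψ.hasDerivAt s 0).continuousAt.continuousWithinAt
  obtain ⟨B, hB⟩ := isCompact_Icc.exists_bound_of_continuousOn hc
  refine ⟨max R (R * Real.exp K + B), le_max_left _ _, fun t ht x hx => ?_⟩
  refine le_trans ?_ (le_max_right _ _)
  have h1 := hψ.dist_le hL t x 0
  rw [dist_eq_norm, dist_zero_right] at h1
  have h2 := hB t (abs_le.1 ht)
  have h3 : ‖ψ t x‖ ≤ ‖ψ t x - ψ t 0‖ + ‖ψ t 0‖ := by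
    simpa using norm_add_le (ψ t x - ψ t 0) (ψ t 0)
  have h4 : ‖x‖ * Real.exp (K * |t|) ≤ R * Real.exp K := by
    have : Real.exp (K * |t|) ≤ Real.exp K :=
      Real.exp_le_exp.2 (mul_le_of_le_one_right K.2 ht)
    gcongr
    exact (norm_nonneg x).trans hx
  linarith

theorem norm_sub_le_of_norm_hasDerivAt_le {W : Type*} [NormedAddCommGroup W] [NormedSpace ℝ W]
    {g g' : ℝ → W} {C t : ℝ} (hg : ∀ s, HasDerivAt g (g' s) s)
    (hb : ∀ s, |s| ≤ |t| → ‖g' s‖ ≤ C) : ‖g t - g 0‖ ≤ C * |t| := by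
  have h := Convex.norm_image_sub_le_of_norm_hasDerivWithin_le (f := g) (f' := g') (C := C)
    (s := Set.Icc (-|t|) |t|) (x := 0) (y := t) (fun s _ => (hg s).hasDerivWithinAt)
    (fun s hs => hb s (abs_le.2 hs)) (convex_Icc _ _) (by simp) (abs_le.1 le_rfl)
  simpa using h

theorem IsFlowOf.exists_norm_sub_le (hψ : IsFlowOf V ψ) (hL : LipschitzWith K V) (R : ℝ) :
    ∃ M : ℝ, 0 ≤ M ∧ ∀ t : ℝ, |t| ≤ 1 → ∀ x, ‖x‖ ≤ R → ‖ψ t x - x‖ ≤ M * |t| := by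
  obtain ⟨R', hR', hb⟩ := hψ.exists_norm_le hL R
  obtain ⟨M, hM⟩ := (isCompact_closedBall (0 : EuclideanSpace ℝ (Fin N)) R'
    ).exists_bound_of_continuousOn hL.continuous.continuousOn
  refine ⟨max M 0, le_max_right _ _, fun t ht x hx => ?_⟩
  have h := norm_sub_le_of_norm_hasDerivAt_le (C := max M 0) (t := t) (fun s => hψ.hasDerivAt s x)
    fun s hs => (hM _ (by simpa using hb s (hs.trans ht) x hx)).trans (le_max_left _ _)
  simpa [hψ.map_zero] using h

/-- The derivative of `V` is integrated along the segments from `b` to `a` and from `d` to `c`. Its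
bound `K` acts on the difference of the two directions; its Lipschitz constant on the ball acts on
the distance between the segments. Along the flow this says that `V ∘ ψ s - V` has spatial Lipschitz
constant `O(|s|)`. -/
theorem exists_norm_four_point_le (hV : ContDiff ℝ ∞ V) (hL : LipschitzWith K V) (R : ℝ) :
    ∃ C : ℝ, 0 ≤ C ∧ ∀ a b c d : EuclideanSpace ℝ (Fin N), ‖a‖ ≤ R → ‖b‖ ≤ R → ‖c‖ ≤ R → ‖d‖ ≤ R →
      ‖(V a - V b) - (V c - V d)‖ ≤
        K * ‖(a - b) - (c - d)‖ + C * (‖a - c‖ + ‖b - d‖) * ‖a - b‖ := by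
  have hd : ContDiff ℝ 1 (fderiv ℝ V) := hV.fderiv_right (by norm_cast)
  obtain ⟨C, hC⟩ := (hd.locallyLipschitz.locallyLipschitzOn
    (s := Metric.closedBall (0 : EuclideanSpace ℝ (Fin N)) R)).exists_lipschitzOnWith_of_compact
    (isCompact_closedBall _ _)
  have hVd : Differentiable ℝ V := hV.differentiable (by simp)
  have hDV : ∀ x, ‖fderiv ℝ V x‖ ≤ K := fun x => norm_fderiv_le_of_lipschitz ℝ hL
  refine ⟨C, C.2, fun a b c d ha hb hc hdd => ?_⟩
  have hseg : ∀ u v : EuclideanSpace ℝ (Fin N), ∀ θ : ℝ,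
      HasDerivAt (fun θ : ℝ => V (v + θ • (u - v))) (fderiv ℝ V (v + θ • (u - v)) (u - v)) θ := by
    intro u v θ
    have h1 : HasDerivAt (fun s : ℝ => v + s • (u - v)) (u - v) θ := by
      simpa using ((hasDerivAt_id θ).smul_const (u - v)).const_add v
    exact (hVd (v + θ • (u - v))).hasFDerivAt.comp_hasDerivAt θ h1
  have hmem : ∀ u v : EuclideanSpace ℝ (Fin N), ‖u‖ ≤ R → ‖v‖ ≤ R → ∀ θ ∈ Set.Ico (0 : ℝ) 1,
      v + θ • (u - v) ∈ Metric.closedBall (0 : EuclideanSpace ℝ (Fin N)) R := by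
    intro u v hu hv θ hθ
    exact (convex_closedBall (0 : EuclideanSpace ℝ (Fin N)) R).add_smul_sub_mem (by simpa using hv)
      (by simpa using hu) ⟨hθ.1, hθ.2.le⟩
  have h := norm_image_sub_le_of_norm_deriv_le_segment_01'
    (f := fun θ : ℝ => V (b + θ • (a - b)) - V (d + θ • (c - d)))
    (C := K * ‖(a - b) - (c - d)‖ + C * (‖a - c‖ + ‖b - d‖) * ‖a - b‖)
    (fun θ _ => ((hseg a b θ).sub (hseg c d θ)).hasDerivWithinAt) (fun θ hθ => ?_)
  · simp only [one_smul, zero_smul, add_zero, add_sub_cancel] at h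
    refine le_trans (le_of_eq ?_) h
    congr 1; abel
  · set P := b + θ • (a - b)
    set Q := d + θ • (c - d)
    have hPQ : ‖P - Q‖ ≤ ‖a - c‖ + ‖b - d‖ := by
      have : P - Q = θ • (a - c) + (1 - θ) • (b - d) := by simp only [P, Q]; module
      rw [this]
      refine (norm_add_le _ _).trans ?_
      rw [norm_smul, norm_smul, Real.norm_of_nonneg hθ.1, Real.norm_of_nonneg (by linarith [hθ.2])]
      nlinarith [norm_nonneg (a - c), norm_nonneg (b - d), hθ.1, hθ.2]
    have hlip := hC.dist_le_mul P (hmem a b ha hb θ hθ) Q (hmem c d hc hdd θ hθ)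
    rw [dist_eq_norm, dist_eq_norm] at hlip
    have : fderiv ℝ V P (a - b) - fderiv ℝ V Q (c - d) =
        fderiv ℝ V Q ((a - b) - (c - d)) + (fderiv ℝ V P - fderiv ℝ V Q) (a - b) := by
      rw [map_sub (fderiv ℝ V Q) (a - b), sub_apply]; abel
    rw [this]
    refine (norm_add_le _ _).trans (add_le_add ?_ ?_)
    · exact (ContinuousLinearMap.le_opNorm _ _).trans (by gcongr; exact hDV Q)
    · refine (ContinuousLinearMap.le_opNorm _ _).trans ?_
      gcongr
      exact hlip.trans (by gcongr)

/-- The second order remainder of a flow is Lipschitz in space with constant `O(t ^ 2)`. -/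
theorem IsFlowOf.exists_norm_remainder_sub_le (hψ : IsFlowOf V ψ) (hV : ContDiff ℝ ∞ V)
    (hL : LipschitzWith K V) (R : ℝ) :
    ∃ C : ℝ, 0 ≤ C ∧ ∀ t : ℝ, |t| ≤ 1 → ∀ x y : EuclideanSpace ℝ (Fin N), ‖x‖ ≤ R → ‖y‖ ≤ R →
      ‖(ψ t x - x - t • V x) - (ψ t y - y - t • V y)‖ ≤ C * t ^ 2 * ‖x - y‖ := by
  obtain ⟨R', hR', hb⟩ := hψ.exists_norm_le hL R
  obtain ⟨M, hM, hdis⟩ := hψ.exists_norm_sub_le hL R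
  obtain ⟨C, hC, h4⟩ := exists_norm_four_point_le hV hL R'
  set e : ℝ := Real.exp K with he
  have he0 : 0 < e := Real.exp_pos _
  refine ⟨K * (K * e) + C * (2 * M) * e, by positivity, fun t ht x y hx hy => ?_⟩
  have hexp : ∀ s : ℝ, |s| ≤ 1 → ‖ψ s x - ψ s y‖ ≤ e * ‖x - y‖ := fun s hs => by
    have h1 := hψ.dist_le hL s x y
    rw [dist_eq_norm, dist_eq_norm] at h1
    refine h1.trans ?_
    rw [mul_comm]
    gcongr
    exact Real.exp_le_exp.2 (mul_le_of_le_one_right K.2 hs)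
  have hdiff : ∀ s : ℝ, |s| ≤ 1 → ‖(ψ s x - ψ s y) - (x - y)‖ ≤ K * e * |s| * ‖x - y‖ :=
    fun s hs => by
    have h := norm_sub_le_of_norm_hasDerivAt_le (C := K * (e * ‖x - y‖)) (t := s)
      (fun r => (hψ.hasDerivAt r x).sub (hψ.hasDerivAt r y)) fun r hr => by
        have := hL.dist_le_mul (ψ r x) (ψ r y)
        rw [dist_eq_norm, dist_eq_norm] at this
        exact this.trans (by gcongr; exact hexp r (hr.trans hs))
    simp only [Pi.sub_apply, hψ.map_zero] at h
    refine h.trans (le_of_eq ?_)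
    ring
  -- The time derivative of the difference of remainders is a four point difference of `V` of size
  -- `O(|s|) * ‖x - y‖`; integration over time supplies the second factor of `t`.
  have key := norm_sub_le_of_norm_hasDerivAt_le
    (g := fun s => (ψ s x - x - s • V x) - (ψ s y - y - s • V y))
    (g' := fun s => (V (ψ s x) - V x) - (V (ψ s y) - V y))
    (C := (K * (K * e) + C * (2 * M) * e) * |t| * ‖x - y‖) (t := t) (fun s => ?_) fun s hs => ?_
  · simp only [hψ.map_zero, sub_self, zero_smul, sub_zero] at key
    refine key.trans (le_of_eq ?_)
    rw [← sq_abs t]; ring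
  · have h1 : ∀ z, HasDerivAt (fun s : ℝ => ψ s z - z - s • V z) (V (ψ s z) - V z) s := fun z => by
      have := ((hψ.hasDerivAt s z).sub_const z).sub ((hasDerivAt_id s).smul_const (V z))
      rw [one_smul] at this
      exact this
    exact (h1 x).sub (h1 y)
  · have hs1 : |s| ≤ 1 := hs.trans ht
    have h5 := h4 (ψ s x) (ψ s y) x y (hb s hs1 x hx) (hb s hs1 y hy) (hx.trans hR')
      (hy.trans hR')
    have e1 : (V (ψ s x) - V x) - (V (ψ s y) - V y) = (V (ψ s x) - V (ψ s y)) - (V x - V y) := by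
      abel
    rw [e1]
    refine h5.trans ?_
    have h6 := hdiff s hs1
    have h7 := hdis s hs1 x hx
    have h8 := hdis s hs1 y hy
    have h9 := hexp s hs1
    calc K * ‖ψ s x - ψ s y - (x - y)‖ + C * (‖ψ s x - x‖ + ‖ψ s y - y‖) * ‖ψ s x - ψ s y‖
        ≤ K * (K * e * |s| * ‖x - y‖) + C * (M * |s| + M * |s|) * (e * ‖x - y‖) := by gcongr
      _ = (K * (K * e) + C * (2 * M) * e) * |s| * ‖x - y‖ := by ring
      _ ≤ _ := by gcongr

theorem exists_contDiffBump_rOut_eq {W : Type*} [NormedAddCommGroup W] [NormedSpace ℝ W] {r : ℝ}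
    (hr : 0 < r) : ∃ η : ContDiffBump (0 : W), η.rOut = r :=
  ⟨⟨r / 2, r, by positivity, by linarith⟩, rfl⟩

/-- Mollification of a map that is Lipschitz on a ball. -/
theorem exists_contDiff_norm_sub_le_of_lipschitz {W : Type*} [NormedAddCommGroup W]
    [NormedSpace ℝ W] [FiniteDimensional ℝ W] [MeasurableSpace W] [BorelSpace W]
    {ρ : W → W} (hρ : Continuous ρ) {R L : ℝ} (hL : 0 ≤ L)
    (hlip : ∀ x y, ‖x‖ ≤ R + 1 → ‖y‖ ≤ R + 1 → ‖ρ x - ρ y‖ ≤ L * ‖x - y‖)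
    {r : ℝ} (hr : 0 < r) (hr1 : r ≤ 1) :
    ∃ σ : W → W, ContDiff ℝ ∞ σ ∧ (∀ x, ‖x‖ ≤ R → ‖σ x - ρ x‖ ≤ L * r) ∧
      ∀ x, ‖x‖ < R → ‖fderiv ℝ σ x‖ ≤ L := by
  obtain ⟨η, hη⟩ := exists_contDiffBump_rOut_eq (W := W) hr
  let μ : Measure W := Measure.addHaar
  refine ⟨convolution (η.normed μ) ρ (ContinuousLinearMap.lsmul ℝ ℝ) μ, ?_, fun x hx => ?_,
    fun x hx => ?_⟩
  · exact η.hasCompactSupport_normed.contDiff_convolution_left _ η.contDiff_normed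
      hρ.locallyIntegrable
  · have h1 := ContDiffBump.dist_normed_convolution_le (μ := μ) (φ := η) (g := ρ) (x₀ := x)
      (ε := L * r) hρ.aestronglyMeasurable fun y hy => by
        rw [Metric.mem_ball, hη, dist_eq_norm] at hy
        have hyR : ‖y‖ ≤ R + 1 := by
          have := norm_add_le (y - x) x
          rw [sub_add_cancel] at this
          linarith
        rw [dist_eq_norm]
        exact (hlip y x hyR (by linarith)).trans (by gcongr)
    rwa [dist_eq_norm] at h1
  · have hball : Metric.ball (0 : W) R ∈ 𝓝 x := Metric.isOpen_ball.mem_nhds (by simpa using hx)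
    -- Averaging over translates preserves the Lipschitz constant, and this alone bounds the
    -- derivative of the mollification; `ρ` need not be differentiable.
    have hlip' : LipschitzOnWith (Real.toNNReal L)
        (convolution (η.normed μ) ρ (ContinuousLinearMap.lsmul ℝ ℝ) μ) (Metric.ball (0 : W) R) := by
      refine LipschitzOnWith.of_dist_le_mul fun y hy z hz => ?_
      rw [Real.coe_toNNReal _ hL, dist_eq_norm, dist_eq_norm]
      rw [mem_ball_zero_iff] at hy hz
      have hval : ∀ w, Integrable (fun v => η.normed μ v • ρ (w - v)) μ := fun w =>
        ((η.continuous_normed).smul (hρ.comp (continuous_const.sub continuous_id))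
          ).integrable_of_hasCompactSupport (η.hasCompactSupport_normed.smul_right)
      rw [convolution_lsmul, convolution_lsmul, ← integral_sub (hval y) (hval z)]
      simp_rw [← smul_sub]
      have hb := norm_integral_le_of_norm_le (μ := μ)
        (f := fun v => η.normed μ v • (ρ (y - v) - ρ (z - v)))
        (g := fun v => η.normed μ v * (L * ‖y - z‖))
        (η.integrable_normed.mul_const _) (Eventually.of_forall fun v => ?_)
      · rwa [integral_mul_const, η.integral_normed, one_mul] at hb
      · rw [norm_smul, Real.norm_of_nonneg (η.nonneg_normed v)]
        by_cases hv : v ∈ Function.support (η.normed μ)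
        · rw [η.support_normed_eq, mem_ball_zero_iff, hη] at hv
          have := hlip (y - v) (z - v) ((norm_sub_le _ _).trans (by linarith))
            ((norm_sub_le _ _).trans (by linarith))
          rw [sub_sub_sub_cancel_right] at this
          exact mul_le_mul_of_nonneg_left this (η.nonneg_normed v)
        · rw [Function.notMem_support.1 hv]; simp
    have := norm_fderiv_le_of_lipschitzOn ℝ hball hlip'
    rwa [Real.coe_toNNReal _ hL] at this

/-- Smooth maps that approximate a flow, with first order control of the derivative. -/
theorem IsFlowOf.exists_smooth_approx (hψ : IsFlowOf V ψ) (hV : ContDiff ℝ ∞ V)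
    (hL : LipschitzWith K V) (R : ℝ) :
    ∃ C : ℝ, 0 ≤ C ∧ ∀ t : ℝ, |t| ≤ 1 →
      ∃ Φ : ℕ → EuclideanSpace ℝ (Fin N) → EuclideanSpace ℝ (Fin N),
        (∀ n, ContDiff ℝ ∞ (Φ n)) ∧
        (∀ n x, ‖x‖ ≤ R → ‖Φ n x - ψ t x‖ ≤ C * (1 / ((n : ℝ) + 1))) ∧
        (∀ n x, ‖x‖ < R →
          ‖fderiv ℝ (Φ n) x - (ContinuousLinearMap.id ℝ _ + t • fderiv ℝ V x)‖ ≤ C * t ^ 2) := by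
  obtain ⟨C, hC, hrem⟩ := hψ.exists_norm_remainder_sub_le hV hL (R + 1)
  refine ⟨C, hC, fun t ht => ?_⟩
  have hVd : Differentiable ℝ V := hV.differentiable (by simp)
  have hρc : Continuous fun x => ψ t x - x - t • V x :=
    ((hψ.continuous hL t).sub continuous_id).sub (hL.continuous.const_smul t)
  have ht2 : t ^ 2 ≤ 1 := (sq_le_one_iff_abs_le_one t).2 ht
  have hn : ∀ n : ℕ, 1 / ((n : ℝ) + 1) ≤ 1 := fun n => by
    rw [div_le_one (by positivity)]; linarith [(Nat.cast_nonneg n : (0 : ℝ) ≤ n)]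
  have hCt : 0 ≤ C * t ^ 2 := by positivity
  -- Only the remainder is mollified, since `x + t • V x` is already smooth. The derivative error is
  -- then the Lipschitz constant `C * t ^ 2` of the remainder, whatever the mollification radius,
  -- and differentiability of the flow in space is never used.
  have hσ : ∀ n : ℕ, ∃ σ : EuclideanSpace ℝ (Fin N) → EuclideanSpace ℝ (Fin N), ContDiff ℝ ∞ σ ∧
      (∀ x, ‖x‖ ≤ R → ‖σ x - (ψ t x - x - t • V x)‖ ≤ C * t ^ 2 * (1 / ((n : ℝ) + 1))) ∧
      ∀ x, ‖x‖ < R → ‖fderiv ℝ σ x‖ ≤ C * t ^ 2 := fun n =>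
    exists_contDiff_norm_sub_le_of_lipschitz hρc hCt (hrem t ht) (by positivity) (hn n)
  choose σ hσ hσ1 hσ2 using hσ
  refine ⟨fun n x => x + t • V x + σ n x, fun n => ?_, fun n x hx => ?_, fun n x hx => ?_⟩
  · have h1 : ContDiff ℝ ∞ fun x => t • V x := hV.const_smul t
    have h2 : ContDiff ℝ ∞ fun x => x + t • V x := contDiff_id.add h1
    exact h2.add (hσ n)
  · have e1 : x + t • V x + σ n x - ψ t x = σ n x - (ψ t x - x - t • V x) := by abel
    rw [e1]
    refine (hσ1 n x hx).trans ?_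
    exact mul_le_mul_of_nonneg_right (mul_le_of_le_one_right hC ht2) (by positivity)
  · have hd : Differentiable ℝ (σ n) := (hσ n).differentiable (by simp)
    have hfd : HasFDerivAt (fun x => x + t • V x + σ n x)
        (ContinuousLinearMap.id ℝ _ + t • fderiv ℝ V x + fderiv ℝ (σ n) x) x :=
      ((hasFDerivAt_id x).add ((hVd x).hasFDerivAt.const_smul t)).add (hd x).hasFDerivAt
    rw [hfd.fderiv, add_sub_cancel_left]
    exact hσ2 n x hx

end Flow

/-! ### Local geometry of the boundary and invariance under the flow. -/

section Boundary

variable {N : ℕ} {Ω : Set (EuclideanSpace ℝ (Fin N))} {x : EuclideanSpace ℝ (Fin N)}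
  {ρ ρ' : EuclideanSpace ℝ (Fin N) → ℝ}

theorem inner_gradient_left (ρ : EuclideanSpace ℝ (Fin N) → ℝ)
    (y v : EuclideanSpace ℝ (Fin N)) : inner ℝ (gradient ρ y) v = fderiv ℝ ρ y v := by
  rw [gradient, InnerProductSpace.toDual_symm_apply]

theorem norm_gradient (ρ : EuclideanSpace ℝ (Fin N) → ℝ)
    (y : EuclideanSpace ℝ (Fin N)) : ‖gradient ρ y‖ = ‖fderiv ℝ ρ y‖ := by
  rw [gradient, LinearIsometryEquiv.norm_map]

theorem continuous_gradient (hρ : ContDiff ℝ ∞ ρ) : Continuous (gradient ρ) := by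
  unfold gradient
  exact (LinearIsometryEquiv.continuous _).comp (hρ.continuous_fderiv (by simp))

namespace IsLocalDefiningFunction

theorem differentiable (h : IsLocalDefiningFunction Ω x ρ) : Differentiable ℝ ρ :=
  h.contDiff.differentiable (by simp)

theorem hasStrictFDerivAt (h : IsLocalDefiningFunction Ω x ρ) (y : EuclideanSpace ℝ (Fin N)) :
    HasStrictFDerivAt ρ (fderiv ℝ ρ y) y :=
  h.contDiff.contDiffAt.hasStrictFDerivAt (by simp)

theorem tendsto_slope (h : IsLocalDefiningFunction Ω x ρ) (v : EuclideanSpace ℝ (Fin N)) :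
    Tendsto (fun s : ℝ => s⁻¹ * ρ (x + s • v)) (𝓝[>] 0) (𝓝 (inner ℝ (gradient ρ x) v)) := by
  have h1 : HasDerivAt (fun s : ℝ => x + s • v) v 0 := by
    simpa using ((hasDerivAt_id (0 : ℝ)).smul_const v).const_add x
  have h2 : HasFDerivAt ρ (fderiv ℝ ρ x) (x + (0 : ℝ) • v) := by
    simpa using (h.differentiable x).hasFDerivAt
  have h3 := (h2.comp_hasDerivAt (0 : ℝ) h1).tendsto_slope_zero_right
  simp only [Function.comp_apply, zero_add, zero_smul, add_zero, h.map_eq_zero, sub_zero,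
    smul_eq_mul] at h3
  rw [inner_gradient_left]
  exact h3

theorem eventually_mem_of_inner_neg (h : IsLocalDefiningFunction Ω x ρ)
    {v : EuclideanSpace ℝ (Fin N)} (hv : inner ℝ (gradient ρ x) v < 0) :
    ∀ᶠ s : ℝ in 𝓝[>] 0, x + s • v ∈ Ω := by
  have hc : Tendsto (fun s : ℝ => x + s • v) (𝓝[>] 0) (𝓝 x) := by
    have : Continuous fun s : ℝ => x + s • v := by fun_prop
    have := this.tendsto 0
    simp only [zero_smul, add_zero] at this
    exact this.mono_left nhdsWithin_le_nhds
  filter_upwards [hc.eventually h.eventually_mem_iff, (h.tendsto_slope v).eventually_lt_const hv,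
    self_mem_nhdsWithin] with s h1 h2 h3
  rw [h1]
  have hs : (0 : ℝ) < s := h3
  have h4 : 0 < s⁻¹ := inv_pos.2 hs
  by_contra hcon
  exact absurd h2 (not_lt.2 (mul_nonneg h4.le (not_lt.1 hcon)))

theorem inner_nonpos_of_frequently_mem (h : IsLocalDefiningFunction Ω x ρ)
    {v : EuclideanSpace ℝ (Fin N)} (hv : ∀ᶠ s : ℝ in 𝓝[>] 0, x + s • v ∈ Ω) :
    inner ℝ (gradient ρ x) v ≤ 0 := by
  have hc : Tendsto (fun s : ℝ => x + s • v) (𝓝[>] 0) (𝓝 x) := by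
    have : Continuous fun s : ℝ => x + s • v := by fun_prop
    have := this.tendsto 0
    simp only [zero_smul, add_zero] at this
    exact this.mono_left nhdsWithin_le_nhds
  refine le_of_tendsto (h.tendsto_slope v) ?_
  filter_upwards [hv, hc.eventually h.eventually_mem_iff, self_mem_nhdsWithin] with s h1 h2 h3
  have hs : (0 : ℝ) < s := h3
  exact mul_nonpos_of_nonneg_of_nonpos (inv_nonneg.2 hs.le) (h2.1 h1).le

theorem eventually_isLocalDefiningFunction (h : IsLocalDefiningFunction Ω x ρ) :
    ∀ᶠ y in 𝓝 x, ρ y = 0 → IsLocalDefiningFunction Ω y ρ := by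
  filter_upwards [h.eventually_mem_iff.eventually_nhds,
    (continuous_gradient h.contDiff).continuousAt.eventually_ne h.gradient_ne_zero] with y h1 h2 h3
  exact ⟨h.contDiff, h3, h2, h1⟩

theorem mem_frontier (h : IsLocalDefiningFunction Ω x ρ) : x ∈ frontier Ω := by
  rw [frontier_eq_closure_inter_closure]
  have hg : inner ℝ (gradient ρ x) (-gradient ρ x) < 0 := by
    rw [inner_neg_right, real_inner_self_eq_norm_sq]
    have := norm_pos_iff.2 h.gradient_ne_zero
    simpa using pow_pos this 2
  constructor
  · have h1 := h.eventually_mem_of_inner_neg hg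
    have hc : Tendsto (fun s : ℝ => x + s • (-gradient ρ x)) (𝓝[>] 0) (𝓝 x) := by
      have : Continuous fun s : ℝ => x + s • (-gradient ρ x) := by fun_prop
      have := this.tendsto 0
      simp only [zero_smul, add_zero] at this
      exact this.mono_left nhdsWithin_le_nhds
    exact mem_closure_of_tendsto hc h1
  · refine subset_closure fun hx => ?_
    have := h.eventually_mem_iff.self_of_nhds.1 hx
    rw [h.map_eq_zero] at this
    exact lt_irrefl _ this

theorem eventually_eq_zero (hΩ : IsOpen Ω) (h : IsLocalDefiningFunction Ω x ρ) :
    ∀ᶠ y in 𝓝 x, y ∈ frontier Ω → ρ y = 0 := by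
  filter_upwards [h.eventually_mem_iff.eventually_nhds] with y hy hyf
  rw [hΩ.frontier_eq] at hyf
  refine le_antisymm ?_ (not_lt.1 fun hlt => hyf.2 (hy.self_of_nhds.2 hlt))
  by_contra! hpos
  have h1 : ∀ᶠ z in 𝓝 y, z ∉ Ω := by
    filter_upwards [hy, h.contDiff.continuous.continuousAt.eventually_const_lt hpos] with z h2 h3 h4
    exact absurd (h2.1 h4) (not_lt.2 h3.le)
  exact (mem_closure_iff_frequently.1 hyf.1) h1

end IsLocalDefiningFunction

theorem IsOuterUnitNormal.norm_eq_one {n : EuclideanSpace ℝ (Fin N)}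
    (h : IsOuterUnitNormal Ω x n) : ‖n‖ = 1 := by
  obtain ⟨ρ, hρ, rfl⟩ := h
  rw [norm_smul, norm_inv, norm_norm, inv_mul_cancel₀ (norm_ne_zero_iff.2 hρ.gradient_ne_zero)]

/-- If the normals differed, `n' - n` would point strictly inward for the first defining function
and strictly outward for the second. -/
theorem IsOuterUnitNormal.unique {n n' : EuclideanSpace ℝ (Fin N)}
    (h : IsOuterUnitNormal Ω x n) (h' : IsOuterUnitNormal Ω x n') : n = n' := by
  have hn := h.norm_eq_one
  have hn' := h'.norm_eq_one
  obtain ⟨ρ, hρ, e⟩ := h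
  obtain ⟨ρ', hρ', e'⟩ := h'
  have hg : 0 < ‖gradient ρ x‖ := norm_pos_iff.2 hρ.gradient_ne_zero
  have hg' : 0 < ‖gradient ρ' x‖ := norm_pos_iff.2 hρ'.gradient_ne_zero
  have hgn : gradient ρ x = ‖gradient ρ x‖ • n := by
    rw [e, smul_smul, mul_inv_cancel₀ hg.ne', one_smul]
  have hgn' : gradient ρ' x = ‖gradient ρ' x‖ • n' := by
    rw [e', smul_smul, mul_inv_cancel₀ hg'.ne', one_smul]
  by_contra hne
  have hlt : inner ℝ n n' < 1 := inner_lt_one_iff_real_of_norm_eq_one hn hn' |>.2 hne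
  have h1 : inner ℝ (gradient ρ x) (n' - n) < 0 := by
    rw [hgn, inner_smul_left, inner_sub_right, real_inner_self_eq_norm_sq, hn]
    refine mul_neg_of_pos_of_neg hg ?_
    linarith
  have h2 := hρ'.inner_nonpos_of_frequently_mem (hρ.eventually_mem_of_inner_neg h1)
  rw [hgn', inner_smul_left, inner_sub_right, real_inner_self_eq_norm_sq, hn',
    real_inner_comm] at h2
  have h3 : 0 < ‖gradient ρ' x‖ * (1 ^ 2 - inner ℝ n n') := mul_pos hg' (by linarith)
  exact absurd h2 (not_le.2 h3)

/-- One defining function serves at all nearby boundary points, and uniqueness identifies its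
normalized gradient with `ν`. Continuity of `ν`, which is otherwise only prescribed pointwise, comes
from here. -/
theorem IsLocalDefiningFunction.eventually_normal_eq (hΩ : IsOpen Ω)
    {ν : EuclideanSpace ℝ (Fin N) → EuclideanSpace ℝ (Fin N)}
    (hν : ∀ x ∈ frontier Ω, IsOuterUnitNormal Ω x (ν x)) (h : IsLocalDefiningFunction Ω x ρ) :
    ∀ᶠ y in 𝓝 x, y ∈ frontier Ω → ν y = ‖gradient ρ y‖⁻¹ • gradient ρ y := by
  filter_upwards [h.eventually_eq_zero hΩ, h.eventually_isLocalDefiningFunction] with y h1 h2 hy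
  exact (hν y hy).unique ⟨ρ, h2 (h1 hy), rfl⟩

theorem continuousOn_normal (hΩ : IsBoundedSmoothDomain Ω)
    {ν : EuclideanSpace ℝ (Fin N) → EuclideanSpace ℝ (Fin N)}
    (hν : ∀ x ∈ frontier Ω, IsOuterUnitNormal Ω x (ν x)) : ContinuousOn ν (frontier Ω) := by
  intro x hx
  obtain ⟨ρ, hρ⟩ := hΩ.smooth_boundary x hx
  have hc := continuous_gradient hρ.contDiff
  have h1 : ContinuousWithinAt (fun y => ‖gradient ρ y‖⁻¹ • gradient ρ y) (frontier Ω) x :=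
    ((hc.norm.continuousAt.inv₀ (norm_ne_zero_iff.2 hρ.gradient_ne_zero)).smul
      hc.continuousAt).continuousWithinAt
  refine h1.congr_of_eventuallyEq ?_ ((hρ.eventually_normal_eq hΩ.isOpen hν).self_of_nhds hx)
  filter_upwards [mem_nhdsWithin_of_mem_nhds (hρ.eventually_normal_eq hΩ.isOpen hν),
    self_mem_nhdsWithin] with y h2 h3 using h2 h3

/-- Secants of the boundary are nearly tangent. -/
theorem exists_abs_inner_sub_le (hΩ : IsOpen Ω) {n : EuclideanSpace ℝ (Fin N)}
    (hn : IsOuterUnitNormal Ω x n) {ε : ℝ} (hε : 0 < ε) :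
    ∃ U ∈ 𝓝 x, ∀ y ∈ frontier Ω ∩ U, ∀ z ∈ frontier Ω ∩ U,
      |inner ℝ n (y - z)| ≤ ε * ‖y - z‖ := by
  obtain ⟨ρ, hρ, rfl⟩ := hn
  have hg : 0 < ‖gradient ρ x‖ := norm_pos_iff.2 hρ.gradient_ne_zero
  have h1 := (hρ.hasStrictFDerivAt x).isLittleO.def (show 0 < ε * ‖gradient ρ x‖ by positivity)
  rw [nhds_prod_eq] at h1
  obtain ⟨U, hU, hUU⟩ := mem_prod_self_iff.1 h1
  refine ⟨U ∩ {y | y ∈ frontier Ω → ρ y = 0}, inter_mem hU (hρ.eventually_eq_zero hΩ),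
    fun y hy z hz => ?_⟩
  have h2 := hUU (Set.mk_mem_prod hy.2.1 hz.2.1)
  simp only [Set.mem_ofPred_eq, hy.2.2 hy.1, hz.2.2 hz.1, sub_zero, zero_sub, norm_neg] at h2
  rw [inner_smul_left, inner_gradient_left, abs_mul]
  simp only [map_inv₀, conj_trivial, abs_inv, abs_norm]
  rw [inv_mul_le_iff₀ hg]
  rw [Real.norm_eq_abs] at h2
  linarith

/-- Along the fixed direction `gradient ρ x`, strict differentiability lets `ρ` change at a rate at
least half the expected one, so a step proportional to `|ρ y|` reaches a zero by the intermediate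
value theorem. -/
theorem IsLocalDefiningFunction.exists_zero_near (h : IsLocalDefiningFunction Ω x ρ) :
    ∃ c : ℝ, 0 ≤ c ∧ ∀ U ∈ 𝓝 x, ∀ᶠ y in 𝓝 x, ∃ z ∈ U, ρ z = 0 ∧ ‖y - z‖ ≤ c * |ρ y| := by
  set ξ := gradient ρ x with hξ
  have hg : 0 < ‖ξ‖ := norm_pos_iff.2 h.gradient_ne_zero
  refine ⟨2 / ‖ξ‖, by positivity, fun U hU => ?_⟩
  have h1 := (h.hasStrictFDerivAt x).isLittleO.def (show 0 < ‖ξ‖ / 2 by positivity)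
  rw [nhds_prod_eq] at h1
  obtain ⟨U', hU', hUU⟩ := mem_prod_self_iff.1 h1
  obtain ⟨r, hr, hball⟩ := Metric.mem_nhds_iff.1 (inter_mem hU hU')
  have hρ0 : ∀ᶠ y in 𝓝 x, 2 / ‖ξ‖ * |ρ y| < r / 2 := by
    have hc : Continuous fun y => 2 / ‖ξ‖ * |ρ y| :=
      continuous_const.mul h.contDiff.continuous.abs
    have := hc.tendsto x
    rw [h.map_eq_zero, abs_zero, mul_zero] at this
    exact this.eventually_lt_const (by positivity)
  filter_upwards [hρ0, Metric.ball_mem_nhds x (half_pos hr)] with y hy hyx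
  -- Twice the Newton step. The predicted value is `-ρ y` with error at most `|ρ y|`, so `ρ` weakly
  -- changes sign between `y` and `y + s₁ • ξ`.
  set s₁ : ℝ := -(2 * ρ y / ‖ξ‖ ^ 2) with hs₁
  have hs₁' : |s₁| * ‖ξ‖ = 2 / ‖ξ‖ * |ρ y| := by
    rw [hs₁, abs_neg, abs_div, abs_mul, abs_of_nonneg (sq_nonneg ‖ξ‖), abs_two]
    field_simp
  have hmem : ∀ s : ℝ, |s| ≤ |s₁| → y + s • ξ ∈ U ∩ U' := fun s hs => by
    apply hball
    rw [Metric.mem_ball, dist_eq_norm] at hyx ⊢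
    have e1 : y + s • ξ - x = (y - x) + s • ξ := by abel
    rw [e1]
    have h3 : ‖s • ξ‖ ≤ |s₁| * ‖ξ‖ := by rw [norm_smul, Real.norm_eq_abs]; gcongr
    linarith [norm_add_le (y - x) (s • ξ)]
  have hstrict : ∀ s : ℝ, |s| ≤ |s₁| →
      |ρ (y + s • ξ) - ρ y - s * ‖ξ‖ ^ 2| ≤ |s| * ‖ξ‖ ^ 2 / 2 := fun s hs => by
    have h4 := hUU (Set.mk_mem_prod (hmem s hs).2 (by simpa using (hmem 0 (by simp)).2))
    simp only [Set.mem_ofPred_eq, add_sub_cancel_left, ← inner_gradient_left, ← hξ,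
      inner_smul_right, real_inner_self_eq_norm_sq, norm_smul, Real.norm_eq_abs] at h4
    refine h4.trans (le_of_eq ?_)
    ring
  have h5 := hstrict s₁ le_rfl
  have h6 : s₁ * ‖ξ‖ ^ 2 = -(2 * ρ y) := by rw [hs₁]; field_simp
  have h7 : |s₁| * ‖ξ‖ ^ 2 / 2 = |ρ y| := by
    rw [sq, ← mul_assoc, hs₁']; field_simp
  rw [h6, h7] at h5
  have hzero : (0 : ℝ) ∈ Set.uIcc (ρ (y + (0 : ℝ) • ξ)) (ρ (y + s₁ • ξ)) := by
    rw [zero_smul, add_zero, Set.mem_uIcc]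
    have h8 := abs_le.1 h5
    rcases le_total 0 (ρ y) with h9 | h9
    · right
      rw [abs_of_nonneg h9] at h8
      constructor <;> linarith
    · left
      rw [abs_of_nonpos h9] at h8
      constructor <;> linarith
  have hcont : ContinuousOn (fun s : ℝ => ρ (y + s • ξ)) (Set.uIcc 0 s₁) :=
    (h.contDiff.continuous.comp (by fun_prop)).continuousOn
  obtain ⟨s, hs, hs0⟩ := intermediate_value_uIcc hcont hzero
  have hss : |s| ≤ |s₁| := by
    have := Set.abs_sub_left_of_mem_uIcc hs
    simpa using this
  refine ⟨y + s • ξ, (hmem s hss).1, hs0, ?_⟩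
  rw [sub_add_cancel_left, norm_neg, norm_smul, Real.norm_eq_abs, ← hs₁']
  gcongr

variable {V : EuclideanSpace ℝ (Fin N) → EuclideanSpace ℝ (Fin N)} {K : NNReal}
  {ψ : ℝ → EuclideanSpace ℝ (Fin N) → EuclideanSpace ℝ (Fin N)}
  {ν : EuclideanSpace ℝ (Fin N) → EuclideanSpace ℝ (Fin N)}

/-- Along the trajectory the derivative of `ρ` is `Dρ · V`. This function is Lipschitz near `x` and,
by tangency, vanishes on the zero set of `ρ`; the distance to that set is at most `c * |ρ|`. Hence
the derivative is bounded by a multiple of `|ρ|`, and Grönwall's inequality with initial value zero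
keeps `ρ` at zero. -/
theorem exists_forall_mem_frontier_of_nonneg (hΩ : IsBoundedSmoothDomain Ω)
    (hν : ∀ x ∈ frontier Ω, IsOuterUnitNormal Ω x (ν x)) (hV : ContDiff ℝ ∞ V)
    (hVν : ∀ x ∈ frontier Ω, inner ℝ (V x) (ν x) = 0) (hψ : IsFlowOf V ψ)
    (hx : x ∈ frontier Ω) : ∃ δ : ℝ, 0 < δ ∧ ∀ t, 0 ≤ t → t ≤ δ → ψ t x ∈ frontier Ω := by
  obtain ⟨ρ, hρ⟩ := hΩ.smooth_boundary x hx
  obtain ⟨c, hc, hnear⟩ := hρ.exists_zero_near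
  have hd : ContDiff ℝ 1 fun y => fderiv ℝ ρ y (V y) :=
    (hρ.contDiff.fderiv_right (m := 1) (by norm_cast)).clm_apply (hV.of_le (by simp))
  obtain ⟨L, U, hU, hLU⟩ := hd.contDiffAt.exists_lipschitzOnWith (x := x)
  have hzero : ∀ᶠ y in 𝓝 x, ρ y = 0 → fderiv ℝ ρ y (V y) = 0 := by
    filter_upwards [hρ.eventually_isLocalDefiningFunction,
      hρ.eventually_normal_eq hΩ.isOpen hν] with y h1 h2 h3
    have h4 := (h1 h3).mem_frontier
    have h5 := hVν y h4
    rw [h2 h4, inner_smul_right, real_inner_comm, inner_gradient_left] at h5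
    have h6 := norm_ne_zero_iff.2 (h1 h3).gradient_ne_zero
    exact (mul_eq_zero.1 h5).resolve_left (inv_ne_zero h6)
  have hbound : ∀ᶠ y in 𝓝 x, |fderiv ℝ ρ y (V y)| ≤ L * c * |ρ y| := by
    filter_upwards [hnear _ (inter_mem hU hzero), hU] with y hy hyU
    obtain ⟨z, hz, hz0, hyz⟩ := hy
    have h1 := hLU.dist_le_mul y hyU z hz.1
    rw [hz.2 hz0, dist_zero_right, dist_eq_norm, Real.norm_eq_abs] at h1
    rw [mul_assoc]
    exact h1.trans (by gcongr)
  have hψc : Tendsto (fun t => ψ t x) (𝓝 0) (𝓝 x) := by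
    have := (hψ.hasDerivAt 0 x).continuousAt.tendsto
    rwa [hψ.map_zero] at this
  obtain ⟨δ, hδ, hball⟩ := Metric.eventually_nhds_iff.1
    (hψc.eventually (hbound.and hρ.eventually_isLocalDefiningFunction))
  have hderiv : ∀ t, HasDerivAt (fun t => ρ (ψ t x)) (fderiv ℝ ρ (ψ t x) (V (ψ t x))) t :=
    fun t => (hρ.differentiable (ψ t x)).hasFDerivAt.comp_hasDerivAt t (hψ.hasDerivAt t x)
  have hin : ∀ t, 0 ≤ t → t ≤ δ / 2 → dist t 0 < δ := fun t h0 h1 => by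
    rw [Real.dist_eq, sub_zero, abs_of_nonneg h0]; linarith
  refine ⟨δ / 2, by positivity, fun t ht0 ht => ?_⟩
  have hz := eq_zero_of_abs_deriv_le_mul_abs_self_of_eq_zero_right (f := fun t => ρ (ψ t x))
    (f' := fun t => fderiv ℝ ρ (ψ t x) (V (ψ t x))) (K := L * c) (a := 0) (b := δ / 2)
    (fun s _ => (hderiv s).continuousAt.continuousWithinAt)
    (fun s _ => (hderiv s).hasDerivWithinAt) (by simp [hψ.map_zero, hρ.map_eq_zero])
    (fun s hs => (hball (hin s hs.1 hs.2.le)).1) t ⟨ht0, ht⟩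
  exact ((hball (hin t ht0 ht)).2 hz).mem_frontier

/-- The set of times spent on the closed frontier is closed; the local statement for `V` and for
`-V` makes it open, and the time line is connected. -/
theorem IsFlowOf.mem_frontier (hΩ : IsBoundedSmoothDomain Ω)
    (hν : ∀ x ∈ frontier Ω, IsOuterUnitNormal Ω x (ν x)) (hV : ContDiff ℝ ∞ V)
    (hL : LipschitzWith K V) (hVν : ∀ x ∈ frontier Ω, inner ℝ (V x) (ν x) = 0)
    (hψ : IsFlowOf V ψ) (hx : x ∈ frontier Ω) (t : ℝ) : ψ t x ∈ frontier Ω := by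
  have hcl : IsClopen {t | ψ t x ∈ frontier Ω} := by
    constructor
    · exact isClosed_frontier.preimage
        (continuous_iff_continuousAt.2 fun t => (hψ.hasDerivAt t x).continuousAt)
    · rw [Metric.isOpen_iff]
      intro t ht
      obtain ⟨δ₁, hδ₁, h₁⟩ := exists_forall_mem_frontier_of_nonneg hΩ hν hV hVν hψ ht
      obtain ⟨δ₂, hδ₂, h₂⟩ := exists_forall_mem_frontier_of_nonneg hΩ hν hV.neg
        (fun y hy => by rw [inner_neg_left, hVν y hy, neg_zero]) hψ.reverse ht
      refine ⟨min δ₁ δ₂, lt_min hδ₁ hδ₂, fun s hs => ?_⟩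
      rw [Metric.mem_ball, Real.dist_eq] at hs
      obtain ⟨hs1, hs2⟩ := lt_min_iff.1 hs
      have h3 : ψ s x = ψ (s - t) (ψ t x) := by rw [← hψ.add hL, sub_add_cancel]
      rw [Set.mem_ofPred_eq, h3]
      rcases le_total 0 (s - t) with h | h
      · exact h₁ _ h ((le_abs_self _).trans hs1.le)
      · have := h₂ (-(s - t)) (neg_nonneg.2 h) ((neg_le_abs _).trans hs2.le)
        rwa [neg_neg] at this
  have h0 : {t | ψ t x ∈ frontier Ω}.Nonempty := ⟨0, by simpa [hψ.map_zero] using hx⟩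
  have := hcl.eq_univ h0
  exact this.symm.subset (Set.mem_univ t)

/-- A trajectory from `Ω` never meets the invariant frontier, so the times spent in `Ω` and in its
closure coincide and form a clopen set. -/
theorem IsFlowOf.mem_domain (hΩ : IsBoundedSmoothDomain Ω)
    (hν : ∀ x ∈ frontier Ω, IsOuterUnitNormal Ω x (ν x)) (hV : ContDiff ℝ ∞ V)
    (hL : LipschitzWith K V) (hVν : ∀ x ∈ frontier Ω, inner ℝ (V x) (ν x) = 0)
    (hψ : IsFlowOf V ψ) (hx : x ∈ Ω) (t : ℝ) : ψ t x ∈ Ω := by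
  have hc : Continuous fun t => ψ t x :=
    continuous_iff_continuousAt.2 fun t => (hψ.hasDerivAt t x).continuousAt
  have heq : {t | ψ t x ∈ Ω} = {t | ψ t x ∈ closure Ω} := by
    ext s
    refine ⟨fun h => subset_closure h, fun h => ?_⟩
    by_contra hcon
    have hs : ψ s x ∈ frontier Ω := by
      rw [hΩ.isOpen.frontier_eq]; exact ⟨h, hcon⟩
    have h1 := hψ.mem_frontier hΩ hν hV hL hVν hs (-s)
    rw [hψ.neg_apply_apply hL, hΩ.isOpen.frontier_eq] at h1
    exact h1.2 hx
  have hcl : IsClopen {t | ψ t x ∈ Ω} :=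
    ⟨heq ▸ isClosed_closure.preimage hc, hΩ.isOpen.preimage hc⟩
  have h0 : {t | ψ t x ∈ Ω}.Nonempty := ⟨0, by simpa [hψ.map_zero] using hx⟩
  exact (hcl.eq_univ h0).symm.subset (Set.mem_univ t)

end Boundary

/-! ### First order expansion of determinants, and the compressed trace. -/

section Determinant

/-- First order expansion of the determinant, uniform on bounded sets. -/
theorem exists_abs_det_sub_le (E : Type*) [NormedAddCommGroup E] [NormedSpace ℝ E]
    [FiniteDimensional ℝ E] {K : ℝ} (hK : 0 ≤ K) {η : ℝ} (hη : 0 < η) :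
    ∃ t₀ : ℝ, 0 < t₀ ∧ ∀ t : ℝ, |t| ≤ t₀ → ∀ M : E →L[ℝ] E, ‖M‖ ≤ K →
      |LinearMap.det ((ContinuousLinearMap.id ℝ E + t • M : E →L[ℝ] E) : E →ₗ[ℝ] E) - 1
        - t * LinearMap.trace ℝ E (M : E →ₗ[ℝ] E)| ≤ η * |t| := by
  let b : Module.Basis _ ℝ E := Module.finBasis ℝ E
  let D : (E →L[ℝ] E) → ℝ := fun A => LinearMap.det (A : E →ₗ[ℝ] E)
  have hD : ∀ A : E →L[ℝ] E, D A = (LinearMap.toMatrix b b (A : E →ₗ[ℝ] E)).det :=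
    fun A => (LinearMap.det_toMatrix b _).symm
  have hentry : ∀ i j, ContDiff ℝ 1 fun A : E →L[ℝ] E =>
      LinearMap.toMatrix b b (A : E →ₗ[ℝ] E) i j := fun i j => by
    have h : ∀ A : E →L[ℝ] E, LinearMap.toMatrix b b (A : E →ₗ[ℝ] E) i j =
        b.equivFunL (A (b j)) i := fun A => by simp [LinearMap.toMatrix_apply]
    simp_rw [h]
    have h1 : ContDiff ℝ 1 fun A : E →L[ℝ] E => A (b j) :=
      (ContinuousLinearMap.apply ℝ E (b j)).contDiff
    exact (contDiff_apply ℝ ℝ i).comp (b.equivFunL.contDiff.comp h1)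
  have hDc : ContDiff ℝ 1 D := by
    have : D = fun A : E →L[ℝ] E => ∑ σ : Equiv.Perm (Fin (Module.finrank ℝ E)),
        ((Equiv.Perm.sign σ : ℤ) : ℝ) *
        ∏ i, LinearMap.toMatrix b b (A : E →ₗ[ℝ] E) (σ i) i := by
      funext A; rw [hD, Matrix.det_apply']
    rw [this]
    exact ContDiff.sum fun σ _ => contDiff_const.mul (contDiff_prod fun i _ => hentry _ _)
  set L := fderiv ℝ D (ContinuousLinearMap.id ℝ E) with hL
  have hDd : HasFDerivAt D L (ContinuousLinearMap.id ℝ E) :=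
    (hDc.differentiable one_ne_zero _).hasFDerivAt
  -- `D` is polynomial in the matrix entries and hence `C¹`; its derivative at the identity is read
  -- off along lines from the expansion of `det (1 + s A)` as `1 + s tr A` plus a multiple of `s ^
  -- 2`.
  have hLM : ∀ M : E →L[ℝ] E, L M = LinearMap.trace ℝ _ (M : E →ₗ[ℝ] E) := fun M => by
    have h1 : HasDerivAt (fun s : ℝ => ContinuousLinearMap.id ℝ E + s • M) M 0 := by
      simpa using ((hasDerivAt_id (0 : ℝ)).smul_const M).const_add (ContinuousLinearMap.id ℝ E)
    have h2 : HasFDerivAt D L (ContinuousLinearMap.id ℝ E + (0 : ℝ) • M) := by simpa using hDd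
    have h3 := h2.comp_hasDerivAt (0 : ℝ) h1
    set A := LinearMap.toMatrix b b (M : E →ₗ[ℝ] E) with hA
    have h4 : (D ∘ fun s : ℝ => ContinuousLinearMap.id ℝ E + s • M) = fun s =>
        1 + A.trace * s + (Matrix.det (1 + (Polynomial.X : Polynomial ℝ) •
          A.map Polynomial.C)).divX.divX.eval s * s ^ 2 := by
      funext s
      rw [← Matrix.det_one_add_smul, Function.comp_apply, hD]
      congr 1
      have : ((ContinuousLinearMap.id ℝ E + s • M : E →L[ℝ] E) : E →ₗ[ℝ] E) =
        LinearMap.id + s • (M : E →ₗ[ℝ] E) := rfl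
      rw [this, map_add, map_smul, LinearMap.toMatrix_id]
    rw [h4] at h3
    set q := (Matrix.det (1 + (Polynomial.X : Polynomial ℝ) • A.map Polynomial.C)).divX.divX
    have h5 : HasDerivAt (fun s : ℝ => 1 + A.trace * s + q.eval s * s ^ 2)
        (A.trace * 1 + (q.derivative.eval 0 * 0 ^ 2 + q.eval 0 * (2 * 0))) 0 := by
      have h6 := (((hasDerivAt_id (0 : ℝ)).const_mul A.trace).const_add 1).add
        ((q.hasDerivAt 0).mul (hasDerivAt_pow 2 (0 : ℝ)))
      exact HasDerivAt.congr_deriv h6 (by simp)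
    have h7 := h3.unique h5
    rw [h7, LinearMap.trace_eq_matrix_trace ℝ b]
    simp [hA]
  have hb := hDd.isLittleO.def (show 0 < η / (K + 1) by positivity)
  obtain ⟨δ, hδ, hball⟩ := Metric.eventually_nhds_iff.1 hb
  refine ⟨δ / (2 * (K + 1)), by positivity, fun t ht M hM => ?_⟩
  rw [le_div_iff₀ (by positivity)] at ht
  have hnorm : ‖t • M‖ ≤ |t| * (K + 1) := by
    rw [norm_smul, Real.norm_eq_abs]; gcongr; linarith
  have h8 := hball (y := ContinuousLinearMap.id ℝ E + t • M) (by
    rw [dist_eq_norm, add_sub_cancel_left]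
    linarith)
  rw [add_sub_cancel_left, map_smul, hLM] at h8
  have h9 : D (ContinuousLinearMap.id ℝ E) = 1 := LinearMap.det_id
  rw [h9, smul_eq_mul, Real.norm_eq_abs] at h8
  refine h8.trans ?_
  calc η / (K + 1) * ‖t • M‖ ≤ η / (K + 1) * (|t| * (K + 1)) := by gcongr
    _ = η * |t| := by field_simp

theorem trace_eq_divergence {N : ℕ}
    (V : EuclideanSpace ℝ (Fin N) → EuclideanSpace ℝ (Fin N)) (x : EuclideanSpace ℝ (Fin N)) :
    LinearMap.trace ℝ _ (fderiv ℝ V x : EuclideanSpace ℝ (Fin N) →ₗ[ℝ] EuclideanSpace ℝ (Fin N)) =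
      divergence V x := by
  rw [LinearMap.trace_eq_matrix_trace ℝ (EuclideanSpace.basisFun (Fin N) ℝ).toBasis, divergence,
    Matrix.trace]
  refine Finset.sum_congr rfl fun i _ => ?_
  simp [LinearMap.toMatrix_apply]

/-- A linear isometry onto the orthogonal complement of a unit vector. -/
theorem exists_linearIsometry_orthogonal {N : ℕ} {n : EuclideanSpace ℝ (Fin N)} (hN : 1 ≤ N)
    (hn : ‖n‖ = 1) :
    ∃ ι : EuclideanSpace ℝ (Fin (N - 1)) →ₗᵢ[ℝ] EuclideanSpace ℝ (Fin N),
      ∀ w, ι (ContinuousLinearMap.adjoint ι.toContinuousLinearMap w) = w - inner ℝ n w • n := by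
  have hn0 : n ≠ 0 := by
    rintro rfl; simp at hn
  have : Fact (Module.finrank ℝ (EuclideanSpace ℝ (Fin N)) = (N - 1) + 1) :=
    ⟨by rw [finrank_euclideanSpace_fin]; omega⟩
  let b := OrthonormalBasis.fromOrthogonalSpanSingleton (𝕜 := ℝ) (N - 1) hn0
  let ι : EuclideanSpace ℝ (Fin (N - 1)) →ₗᵢ[ℝ] EuclideanSpace ℝ (Fin N) :=
    (Submodule.subtypeₗᵢ (Submodule.span ℝ {n})ᗮ).comp b.repr.symm.toLinearIsometry
  have hperp : ∀ v, inner ℝ n (ι v) = 0 := fun v =>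
    Submodule.mem_orthogonal_singleton_iff_inner_right.1 (b.repr.symm v).2
  have hrange : ∀ w, inner ℝ n w = 0 → ∃ v, ι v = w := fun w hw =>
    ⟨b.repr ⟨w, Submodule.mem_orthogonal_singleton_iff_inner_right.2 hw⟩, by simp [ι]⟩
  have hadj : ∀ v, ContinuousLinearMap.adjoint ι.toContinuousLinearMap (ι v) = v := fun v =>
    congrArg (fun A : EuclideanSpace ℝ (Fin (N - 1)) →L[ℝ] EuclideanSpace ℝ (Fin (N - 1)) => A v)
      (LinearIsometry.adjoint_comp_self ι)
  have hadjn : ContinuousLinearMap.adjoint ι.toContinuousLinearMap n = 0 := by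
    refine ext_inner_right ℝ fun v => ?_
    rw [ContinuousLinearMap.adjoint_inner_left, inner_zero_left]
    exact hperp v
  refine ⟨ι, fun w => ?_⟩
  obtain ⟨v, hv⟩ := hrange (w - inner ℝ n w • n) (by
    rw [inner_sub_right, inner_smul_right, real_inner_self_eq_norm_sq, hn]; ring)
  have hw : w = ι v + inner ℝ n w • n := by rw [hv]; abel
  rw [← hv]
  congr 1
  conv_lhs => rw [hw]
  rw [map_add, map_smul, hadjn, smul_zero, add_zero, hadj]

/-- Cyclicity turns the trace of `ι* A ι` into that of `A ι ι*`, and `ι ι*` is the identity minus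
the projection onto `n`. With `A = V'` this is where the tangential divergence arises. -/
theorem trace_adjoint_comp {N d : ℕ} (ι : EuclideanSpace ℝ (Fin d) →ₗᵢ[ℝ] EuclideanSpace ℝ (Fin N))
    (A : EuclideanSpace ℝ (Fin N) →L[ℝ] EuclideanSpace ℝ (Fin N)) {n : EuclideanSpace ℝ (Fin N)}
    (hι : ∀ w, ι (ContinuousLinearMap.adjoint ι.toContinuousLinearMap w) = w - inner ℝ n w • n) :
    LinearMap.trace ℝ _ (((ContinuousLinearMap.adjoint ι.toContinuousLinearMap).comp
      (A.comp ι.toContinuousLinearMap) :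
        EuclideanSpace ℝ (Fin d) →L[ℝ] EuclideanSpace ℝ (Fin d)) :
        EuclideanSpace ℝ (Fin d) →ₗ[ℝ] EuclideanSpace ℝ (Fin d)) =
      LinearMap.trace ℝ _ (A : EuclideanSpace ℝ (Fin N) →ₗ[ℝ] EuclideanSpace ℝ (Fin N)) -
        inner ℝ (A n) n := by
  let P : EuclideanSpace ℝ (Fin N) →ₗ[ℝ] EuclideanSpace ℝ (Fin d) :=
    (ContinuousLinearMap.adjoint ι.toContinuousLinearMap).toLinearMap
  let J : EuclideanSpace ℝ (Fin d) →ₗ[ℝ] EuclideanSpace ℝ (Fin N) := ι.toLinearMap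
  have h1 : LinearMap.trace ℝ _ (P ∘ₗ (A.toLinearMap ∘ₗ J)) =
      LinearMap.trace ℝ _ ((A.toLinearMap ∘ₗ J) ∘ₗ P) := LinearMap.trace_comp_comm' _ _
  have h2 : (A.toLinearMap ∘ₗ J) ∘ₗ P =
      A.toLinearMap - LinearMap.smulRight (innerSL ℝ n).toLinearMap (A n) := by
    ext1 w
    have : A (ι (ContinuousLinearMap.adjoint ι.toContinuousLinearMap w)) =
        A w - inner ℝ n w • A n := by rw [hι, map_sub, map_smul]
    simpa [P, J] using this
  refine h1.trans ?_
  rw [h2, map_sub, LinearMap.trace_smulRight]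
  simp [real_inner_comm]

end Determinant

/-! ### Hausdorff measure of images under Lipschitz comparison. -/

section HausdorffImages

variable {X Y Z : Type*} [MetricSpace X] [MeasurableSpace X] [BorelSpace X]
  [MetricSpace Y] [MeasurableSpace Y] [BorelSpace Y]

theorem euclideanHausdorffMeasure_image_le (d : ℕ) {L : NNReal} {f : X → Y} {s : Set X}
    (hf : LipschitzOnWith L f s) : μHE[d] (f '' s) ≤ (L : ℝ≥0∞) ^ d * μHE[d] s := by
  have h := hf.hausdorffMeasure_image_le (d := d) (by positivity)
  rw [ENNReal.rpow_natCast] at h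
  rw [Measure.euclideanHausdorffMeasure_def, Measure.euclideanHausdorffMeasure_def,
    Measure.smul_apply, Measure.smul_apply, ENNReal.smul_def, ENNReal.smul_def, smul_eq_mul,
    smul_eq_mul, mul_left_comm]
  gcongr

/-- The distance comparison makes `f` factor on `A` through `g` by a Lipschitz map, even if `g` is
not injective. Two images of one set can thus be compared without constructing charts or inverse
maps. -/
theorem euclideanHausdorffMeasure_image_le_of_dist_le (d : ℕ) {f : Z → Y} {g : Z → X} {A : Set Z}
    {L : ℝ} (hL : 0 ≤ L) (h : ∀ a ∈ A, ∀ b ∈ A, dist (f a) (f b) ≤ L * dist (g a) (g b)) :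
    μHE[d] (f '' A) ≤ ENNReal.ofReal (L ^ d) * μHE[d] (g '' A) := by
  rcases A.eq_empty_or_nonempty with rfl | ⟨a₀, ha₀⟩
  · simp
  have : Nonempty Z := ⟨a₀⟩
  have hinv : ∀ a ∈ A, Function.invFunOn g A (g a) ∈ A ∧ g (Function.invFunOn g A (g a)) = g a :=
    fun a ha => ⟨Function.invFunOn_mem ⟨a, ha, rfl⟩, Function.invFunOn_eq ⟨a, ha, rfl⟩⟩
  have hlip : LipschitzOnWith (Real.toNNReal L) (fun y => f (Function.invFunOn g A y)) (g '' A) := by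
    refine LipschitzOnWith.of_dist_le_mul ?_
    rintro _ ⟨a, ha, rfl⟩ _ ⟨b, hb, rfl⟩
    rw [Real.coe_toNNReal _ hL]
    have := h _ (hinv a ha).1 _ (hinv b hb).1
    rwa [(hinv a ha).2, (hinv b hb).2] at this
  have himg : f '' A ⊆ (fun y => f (Function.invFunOn g A y)) '' (g '' A) := by
    rintro _ ⟨a, ha, rfl⟩
    refine ⟨g a, ⟨a, ha, rfl⟩, ?_⟩
    have := h _ (hinv a ha).1 _ ha
    rw [(hinv a ha).2, dist_self, mul_zero] at this
    exact dist_le_zero.1 this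
  refine (measure_mono himg).trans ((euclideanHausdorffMeasure_image_le d hlip).trans ?_)
  rw [ENNReal.ofReal_pow hL]
  rfl

end HausdorffImages

/-! ### Nearly affine maps compressed to a tangent space. -/

section Distortion

variable {N d : ℕ}

/-- The range of `ι` is the tangent space at `x` of the set `S`, in the strong sense that secants
of `S` near `x` are nearly in this range. -/
def IsTangentAt (S : Set (EuclideanSpace ℝ (Fin N))) (x : EuclideanSpace ℝ (Fin N))
    (ι : EuclideanSpace ℝ (Fin d) →ₗᵢ[ℝ] EuclideanSpace ℝ (Fin N)) : Prop :=
  ∀ ε : ℝ, 0 < ε → ∃ U ∈ 𝓝 x, ∀ y ∈ S ∩ U, ∀ z ∈ S ∩ U,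
    ‖(y - z) - ι (ContinuousLinearMap.adjoint ι.toContinuousLinearMap (y - z))‖ ≤ ε * ‖y - z‖

/-- Compression of an endomorphism to a tangent space. -/
def compress (ι : EuclideanSpace ℝ (Fin d) →ₗᵢ[ℝ] EuclideanSpace ℝ (Fin N))
    (A : EuclideanSpace ℝ (Fin N) →L[ℝ] EuclideanSpace ℝ (Fin N)) :
    EuclideanSpace ℝ (Fin d) →L[ℝ] EuclideanSpace ℝ (Fin d) :=
  (ContinuousLinearMap.adjoint ι.toContinuousLinearMap).comp (A.comp ι.toContinuousLinearMap)

theorem norm_adjoint_apply_le (ι : EuclideanSpace ℝ (Fin d) →ₗᵢ[ℝ] EuclideanSpace ℝ (Fin N))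
    (w : EuclideanSpace ℝ (Fin N)) :
    ‖ContinuousLinearMap.adjoint ι.toContinuousLinearMap w‖ ≤ ‖w‖ := by
  refine (ContinuousLinearMap.le_opNorm _ _).trans ?_
  rw [LinearIsometryEquiv.norm_map]
  exact mul_le_of_le_one_left (norm_nonneg _) ι.norm_toContinuousLinearMap_le

theorem adjoint_apply_apply (ι : EuclideanSpace ℝ (Fin d) →ₗᵢ[ℝ] EuclideanSpace ℝ (Fin N))
    (v : EuclideanSpace ℝ (Fin d)) :
    ContinuousLinearMap.adjoint ι.toContinuousLinearMap (ι v) = v :=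
  congrArg (fun A : EuclideanSpace ℝ (Fin d) →L[ℝ] EuclideanSpace ℝ (Fin d) => A v)
    (LinearIsometry.adjoint_comp_self ι)

theorem norm_compress_le (ι : EuclideanSpace ℝ (Fin d) →ₗᵢ[ℝ] EuclideanSpace ℝ (Fin N))
    {A : EuclideanSpace ℝ (Fin N) →L[ℝ] EuclideanSpace ℝ (Fin N)} {K : ℝ} (hA : ‖A‖ ≤ K) :
    ‖compress ι A‖ ≤ K := by
  refine ContinuousLinearMap.opNorm_le_bound _ ((norm_nonneg _).trans hA) fun v => ?_
  refine (norm_adjoint_apply_le ι _).trans ((A.le_opNorm _).trans ?_)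
  exact mul_le_mul hA (ι.norm_map v).le (norm_nonneg _) ((norm_nonneg _).trans hA)

theorem norm_sub_adjoint_apply_le (ι : EuclideanSpace ℝ (Fin d) →ₗᵢ[ℝ] EuclideanSpace ℝ (Fin N))
    (a : EuclideanSpace ℝ (Fin N)) :
    ‖a - ι (ContinuousLinearMap.adjoint ι.toContinuousLinearMap a)‖ ≤ ‖a‖ := by
  refine abs_le_of_sq_le_sq' ?_ (norm_nonneg _) |>.2
  have h3 : inner ℝ a (ι (ContinuousLinearMap.adjoint ι.toContinuousLinearMap a)) =
      ‖ContinuousLinearMap.adjoint ι.toContinuousLinearMap a‖ ^ 2 := by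
    rw [real_inner_comm, ← real_inner_self_eq_norm_sq]
    exact (ContinuousLinearMap.adjoint_inner_right ι.toContinuousLinearMap _ a).symm
  rw [norm_sub_sq_real, h3, ι.norm_map]
  linarith [sq_nonneg ‖ContinuousLinearMap.adjoint ι.toContinuousLinearMap a‖]

theorem norm_sq_eq_adjoint_add (ι : EuclideanSpace ℝ (Fin d) →ₗᵢ[ℝ] EuclideanSpace ℝ (Fin N))
    (u : EuclideanSpace ℝ (Fin N)) :
    ‖u‖ ^ 2 = ‖ContinuousLinearMap.adjoint ι.toContinuousLinearMap u‖ ^ 2 +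
      ‖u - ι (ContinuousLinearMap.adjoint ι.toContinuousLinearMap u)‖ ^ 2 := by
  have h3 : inner ℝ u (ι (ContinuousLinearMap.adjoint ι.toContinuousLinearMap u)) =
      ‖ContinuousLinearMap.adjoint ι.toContinuousLinearMap u‖ ^ 2 := by
    rw [real_inner_comm, ← real_inner_self_eq_norm_sq]
    exact (ContinuousLinearMap.adjoint_inner_right ι.toContinuousLinearMap _ u).symm
  rw [norm_sub_sq_real, h3, ι.norm_map]
  ring

section Tangent

variable (ι : EuclideanSpace ℝ (Fin d) →ₗᵢ[ℝ] EuclideanSpace ℝ (Fin N))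
  {A : EuclideanSpace ℝ (Fin N) →L[ℝ] EuclideanSpace ℝ (Fin N)} {K t : ℝ}

theorem norm_smul_apply_isometry_le (hA : ‖A‖ ≤ K) (v : EuclideanSpace ℝ (Fin d)) :
    ‖t • A (ι v)‖ ≤ |t| * K * ‖v‖ := by
  rw [norm_smul, Real.norm_eq_abs, mul_assoc]
  refine mul_le_mul_of_nonneg_left ?_ (abs_nonneg _)
  refine (A.le_opNorm _).trans ?_
  rw [ι.norm_map]
  exact mul_le_mul_of_nonneg_right hA (norm_nonneg _)

theorem adjoint_apply_affine (v : EuclideanSpace ℝ (Fin d)) :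
    ContinuousLinearMap.adjoint ι.toContinuousLinearMap (ι v + t • A (ι v)) =
      (ContinuousLinearMap.id ℝ (EuclideanSpace ℝ (Fin d)) + t • compress ι A) v := by
  rw [map_add, map_smul, adjoint_apply_apply]
  rfl

theorem norm_le_two_mul_norm_affine (hA : ‖A‖ ≤ K) (htK : |t| * K ≤ 1 / 2)
    (v : EuclideanSpace ℝ (Fin d)) :
    ‖v‖ ≤ 2 * ‖(ContinuousLinearMap.id ℝ (EuclideanSpace ℝ (Fin d)) + t • compress ι A) v‖ := by
  rw [← adjoint_apply_affine, map_add, adjoint_apply_apply]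
  have h1 := (norm_adjoint_apply_le ι (t • A (ι v))).trans (norm_smul_apply_isometry_le ι hA v)
  have h2 := norm_sub_le (v + ContinuousLinearMap.adjoint ι.toContinuousLinearMap (t • A (ι v)))
    (ContinuousLinearMap.adjoint ι.toContinuousLinearMap (t • A (ι v)))
  rw [add_sub_cancel_right] at h2
  have h3 : |t| * K * ‖v‖ ≤ 1 / 2 * ‖v‖ := mul_le_mul_of_nonneg_right htK (norm_nonneg _)
  linarith

/-- Pythagoras: the component of the image normal to the tangent space is at most `|t| * K * ‖v‖`,
so it changes the length only to second order in `t`. To first order, lengths are those of the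
tangential compression. -/
theorem norm_affine_le (hA : ‖A‖ ≤ K) (htK : |t| * K ≤ 1 / 2) (v : EuclideanSpace ℝ (Fin d)) :
    ‖ι v + t • A (ι v)‖ ≤ (1 + 2 * K ^ 2 * t ^ 2) *
      ‖(ContinuousLinearMap.id ℝ (EuclideanSpace ℝ (Fin d)) + t • compress ι A) v‖ := by
  have hpyth := norm_sq_eq_adjoint_add ι (ι v + t • A (ι v))
  rw [adjoint_apply_affine] at hpyth
  have hb := norm_le_two_mul_norm_affine ι hA htK v
  have hrest : ‖ι v + t • A (ι v) -
      ι ((ContinuousLinearMap.id ℝ (EuclideanSpace ℝ (Fin d)) + t • compress ι A) v)‖ ≤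
      |t| * K * ‖v‖ := by
    refine le_trans ?_ (norm_smul_apply_isometry_le ι hA v)
    refine le_trans (le_of_eq ?_) (norm_sub_adjoint_apply_le ι (t • A (ι v)))
    rw [← adjoint_apply_affine, map_add, adjoint_apply_apply, map_add, add_sub_add_left_eq_sub]
  have hr0 := norm_nonneg (ι v + t • A (ι v) -
      ι ((ContinuousLinearMap.id ℝ (EuclideanSpace ℝ (Fin d)) + t • compress ι A) v))
  generalize ‖ι v + t • A (ι v) -
      ι ((ContinuousLinearMap.id ℝ (EuclideanSpace ℝ (Fin d)) + t • compress ι A) v)‖ = r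
      at hpyth hrest hr0
  generalize hq : ‖(ContinuousLinearMap.id ℝ (EuclideanSpace ℝ (Fin d)) + t • compress ι A) v‖ = q
      at hpyth hb ⊢
  have hq0 : 0 ≤ q := hq ▸ norm_nonneg _
  have hK : 0 ≤ K := (norm_nonneg _).trans hA
  have hr : r ≤ |t| * K * (2 * q) := hrest.trans (mul_le_mul_of_nonneg_left hb (by positivity))
  refine abs_le_of_sq_le_sq' ?_ (by positivity) |>.2
  have h6 : (|t| * K * (2 * q)) ^ 2 = 4 * (K ^ 2 * t ^ 2 * q ^ 2) := by
    rw [mul_pow, mul_pow, sq_abs]; ring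
  have h7 : 0 ≤ (2 * K ^ 2 * t ^ 2 * q) ^ 2 := sq_nonneg _
  have h5 : ‖ι v + t • A (ι v)‖ ^ 2 ≤ q ^ 2 + (|t| * K * (2 * q)) ^ 2 := by
    rw [hpyth]
    refine add_le_add le_rfl (sq_le_sq' ?_ hr)
    have : 0 ≤ |t| * K * (2 * q) := by positivity
    linarith
  rw [h6] at h5
  have e : ((1 + 2 * K ^ 2 * t ^ 2) * q) ^ 2 =
    q ^ 2 + 4 * (K ^ 2 * t ^ 2 * q ^ 2) + (2 * K ^ 2 * t ^ 2 * q) ^ 2 := by ring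
  linarith

end Tangent

/-- Scalar bookkeeping for `norm_le_and_le_norm_of_tangent`. Here `w` is the length of a secant, `b`
that of its tangential part, `u` that of the affine image of the latter, `q` that of the compressed
image, `z` that of the true image, and `e` the distance between the true and the affine image. -/
theorem bounds_of_near {C t k b w q u z e : ℝ} (hb : b ≤ 2 * q) (hw0 : 0 ≤ w)
    (hw1 : w ≤ b + t ^ 2 * w) (ht2 : t ^ 2 ≤ 1 / 2) (htC : C * t ^ 2 ≤ 1 / 8) (hC : 0 ≤ C)
    (hk : 0 ≤ k) (hqu : q ≤ u) (huq : u ≤ (1 + k * t ^ 2) * q) (he : e ≤ C * t ^ 2 * w)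
    (hzu : z ≤ u + e) (huz : u ≤ z + e) :
    z ≤ (1 + (8 * C + k) * t ^ 2) * q ∧ q ≤ (1 + (8 * C + k) * t ^ 2) * z ∧
      w ≤ (1 + 2 * t ^ 2) * b := by
  have ht0 : 0 ≤ t ^ 2 := sq_nonneg t
  have hw3 : w ≤ 2 * b := by nlinarith
  have hw2 : w ≤ (1 + 2 * t ^ 2) * b := by nlinarith
  have hq0 : 0 ≤ q := by linarith
  have hCt : 0 ≤ C * t ^ 2 := mul_nonneg hC ht0
  have h1 : e ≤ C * t ^ 2 * (4 * q) :=
    he.trans (mul_le_mul_of_nonneg_left (by linarith) hCt)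
  have h2 : 0 ≤ C * t ^ 2 * q := mul_nonneg hCt hq0
  have h3 : C * t ^ 2 * q ≤ 1 / 8 * q := mul_le_mul_of_nonneg_right htC hq0
  have h4 : q ≤ 2 * z := by linarith
  have h5 : C * t ^ 2 * q ≤ C * t ^ 2 * (2 * z) := mul_le_mul_of_nonneg_left h4 hCt
  have h6 : 0 ≤ k * t ^ 2 * z := by
    have : 0 ≤ z := by linarith
    positivity
  refine ⟨?_, ?_, hw2⟩
  · have e1 : (1 + (8 * C + k) * t ^ 2) * q = (1 + k * t ^ 2) * q + 8 * (C * t ^ 2 * q) := by ring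
    linarith
  · have e1 : (1 + (8 * C + k) * t ^ 2) * z = z + k * t ^ 2 * z + 4 * (C * t ^ 2 * (2 * z)) := by
      ring
    linarith

/-- Comparison of a nearly affine displacement with its compression to the tangent space. -/
theorem norm_le_and_le_norm_of_tangent
    (ι : EuclideanSpace ℝ (Fin d) →ₗᵢ[ℝ] EuclideanSpace ℝ (Fin N))
    {A : EuclideanSpace ℝ (Fin N) →L[ℝ] EuclideanSpace ℝ (Fin N)} {K C t : ℝ} (hA : ‖A‖ ≤ K)
    (hC : 0 ≤ C) (ht : |t| ≤ 1) (htK : |t| * K ≤ 1 / 2) (ht2 : t ^ 2 ≤ 1 / 2)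
    (htC : (C + 1 + K) * t ^ 2 ≤ 1 / 8)
    {w z : EuclideanSpace ℝ (Fin N)} {v : EuclideanSpace ℝ (Fin d)}
    (hw : ‖w - ι v‖ ≤ t ^ 2 * ‖w‖)
    (hz : ‖z - (w + t • A w)‖ ≤ C * t ^ 2 * ‖w‖) :
    ‖z‖ ≤ (1 + (8 * (C + 1 + K) + 2 * K ^ 2) * t ^ 2) *
      ‖(ContinuousLinearMap.id ℝ (EuclideanSpace ℝ (Fin d)) + t • compress ι A) v‖ ∧
    ‖(ContinuousLinearMap.id ℝ (EuclideanSpace ℝ (Fin d)) + t • compress ι A) v‖ ≤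
      (1 + (8 * (C + 1 + K) + 2 * K ^ 2) * t ^ 2) * ‖z‖ ∧
    ‖w‖ ≤ (1 + 2 * t ^ 2) * ‖v‖ := by
  have hK : 0 ≤ K := (norm_nonneg _).trans hA
  have hzu : ‖z - (ι v + t • A (ι v))‖ ≤ (C + 1 + K) * t ^ 2 * ‖w‖ := by
    have h1 : z - (ι v + t • A (ι v)) =
        (z - (w + t • A w)) + ((w - ι v) + t • A (w - ι v)) := by
      simp only [map_sub, smul_sub]; abel
    rw [h1]
    have h2 : ‖t • A (w - ι v)‖ ≤ 1 * (K * (t ^ 2 * ‖w‖)) := by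
      rw [norm_smul, Real.norm_eq_abs]
      refine mul_le_mul ht ((A.le_opNorm _).trans ?_) (norm_nonneg _) zero_le_one
      exact mul_le_mul hA hw (norm_nonneg _) hK
    have h3 := norm_add_le (z - (w + t • A w)) ((w - ι v) + t • A (w - ι v))
    have h4 := norm_add_le (w - ι v) (t • A (w - ι v))
    have e : (C + 1 + K) * t ^ 2 * ‖w‖ =
      C * t ^ 2 * ‖w‖ + (t ^ 2 * ‖w‖ + 1 * (K * (t ^ 2 * ‖w‖))) := by ring
    linarith
  have h1 := norm_add_le (z - (ι v + t • A (ι v))) (ι v + t • A (ι v))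
  rw [sub_add_cancel] at h1
  have h2 := norm_sub_le z (z - (ι v + t • A (ι v)))
  rw [sub_sub_cancel] at h2
  have h3 := norm_add_le (w - ι v) (ι v)
  rw [sub_add_cancel, ι.norm_map] at h3
  have h4 := norm_adjoint_apply_le ι (ι v + t • A (ι v))
  rw [adjoint_apply_affine] at h4
  exact bounds_of_near (norm_le_two_mul_norm_affine ι hA htK v) (norm_nonneg _)
    (by linarith) ht2 htC (by positivity) (by positivity) h4 (norm_affine_le ι hA htK v) hzu
    (by linarith) h2

variable {V : EuclideanSpace ℝ (Fin N) → EuclideanSpace ℝ (Fin N)} {K : NNReal}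
  {ψ : ℝ → EuclideanSpace ℝ (Fin N) → EuclideanSpace ℝ (Fin N)}

/-- To the remainder of the flow is added the linearization error of `V` at `x`, made smaller than
`|t| * ‖y - z‖` by shrinking the neighbourhood. The neighbourhood may depend on `t` and `x`, the
constant does not; `t ≠ 0` is needed for the shrinking. -/
theorem IsFlowOf.exists_nhds_norm_sub_le (hψ : IsFlowOf V ψ) (hV : ContDiff ℝ ∞ V)
    (hL : LipschitzWith K V) (R : ℝ) :
    ∃ C : ℝ, 0 ≤ C ∧ ∀ t : ℝ, |t| ≤ 1 → t ≠ 0 → ∀ x, ‖x‖ ≤ R →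
      ∃ U ∈ 𝓝 x, ∀ y ∈ U, ∀ z ∈ U,
        ‖(ψ t y - ψ t z) - ((y - z) + t • fderiv ℝ V x (y - z))‖ ≤ C * t ^ 2 * ‖y - z‖ := by
  obtain ⟨C, hC, hrem⟩ := hψ.exists_norm_remainder_sub_le hV hL (R + 1)
  refine ⟨C + 1, by positivity, fun t ht ht0 x hx => ?_⟩
  have hst : HasStrictFDerivAt V (fderiv ℝ V x) x := hV.contDiffAt.hasStrictFDerivAt (by simp)
  have h1 := hst.isLittleO.def (show 0 < |t| by positivity)
  rw [nhds_prod_eq] at h1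
  obtain ⟨U, hU, hUU⟩ := mem_prod_self_iff.1 h1
  refine ⟨U ∩ Metric.ball x 1, inter_mem hU (Metric.ball_mem_nhds x one_pos), fun y hy z hz => ?_⟩
  have hball : ∀ y ∈ Metric.ball x 1, ‖y‖ ≤ R + 1 := fun y hy => by
    rw [Metric.mem_ball, dist_eq_norm] at hy
    have := norm_add_le (y - x) x
    rw [sub_add_cancel] at this
    linarith
  have h2 := hUU (Set.mk_mem_prod hy.1 hz.1)
  simp only [Set.mem_ofPred_eq] at h2
  have h3 := hrem t ht y z (hball y hy.2) (hball z hz.2)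
  have e : (ψ t y - ψ t z) - ((y - z) + t • fderiv ℝ V x (y - z)) =
      ((ψ t y - y - t • V y) - (ψ t z - z - t • V z)) +
        t • (V y - V z - fderiv ℝ V x (y - z)) := by
    simp only [smul_sub]; abel
  rw [e]
  refine (norm_add_le _ _).trans ?_
  rw [norm_smul, Real.norm_eq_abs]
  have h4 : |t| * ‖V y - V z - fderiv ℝ V x (y - z)‖ ≤ t ^ 2 * ‖y - z‖ := by
    calc |t| * ‖V y - V z - fderiv ℝ V x (y - z)‖ ≤ |t| * (|t| * ‖y - z‖) := by gcongr
      _ = t ^ 2 * ‖y - z‖ := by rw [← mul_assoc, ← sq, sq_abs]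
  linarith

end Distortion

/-! ### Local distortion of Hausdorff measure by the flow. -/

section Distortion

variable {N d : ℕ}
variable {V : EuclideanSpace ℝ (Fin N) → EuclideanSpace ℝ (Fin N)} {K : NNReal}
  {ψ : ℝ → EuclideanSpace ℝ (Fin N) → EuclideanSpace ℝ (Fin N)}

theorem exists_abs_trace_le (W : Type*) [NormedAddCommGroup W] [NormedSpace ℝ W]
    [FiniteDimensional ℝ W] :
    ∃ c : ℝ, 0 ≤ c ∧ ∀ M : W →L[ℝ] W, |LinearMap.trace ℝ W (M : W →ₗ[ℝ] W)| ≤ c * ‖M‖ := by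
  let τ : (W →L[ℝ] W) →L[ℝ] ℝ :=
    LinearMap.toContinuousLinearMap ((LinearMap.trace ℝ W) ∘ₗ (ContinuousLinearMap.coeLM ℝ))
  exact ⟨‖τ‖, ContinuousLinearMap.opNorm_nonneg τ, fun M => τ.le_opNorm M⟩

/-- Two-sided estimate of the measure of the image of a set under a map that is, up to the factors
`θ` and `ϑ`, an affine map in a tangent space. -/
theorem euclideanHausdorffMeasure_image_bounds
    {ι : EuclideanSpace ℝ (Fin d) →ₗᵢ[ℝ] EuclideanSpace ℝ (Fin N)}
    {T : EuclideanSpace ℝ (Fin d) →L[ℝ] EuclideanSpace ℝ (Fin d)}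
    {φ : EuclideanSpace ℝ (Fin N) → EuclideanSpace ℝ (Fin N)} {θ ϑ : ℝ} (hθ : 0 ≤ θ) (hϑ : 0 ≤ ϑ)
    {A : Set (EuclideanSpace ℝ (Fin N))}
    (h : ∀ y ∈ A, ∀ z ∈ A,
      ‖φ y - φ z‖ ≤ θ * ‖T (ContinuousLinearMap.adjoint ι.toContinuousLinearMap (y - z))‖ ∧
      ‖T (ContinuousLinearMap.adjoint ι.toContinuousLinearMap (y - z))‖ ≤ θ * ‖φ y - φ z‖ ∧
      ‖y - z‖ ≤ ϑ * ‖ContinuousLinearMap.adjoint ι.toContinuousLinearMap (y - z)‖) :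
    μHE[d] (φ '' A) ≤ ENNReal.ofReal (θ ^ d * |LinearMap.det (T : EuclideanSpace ℝ (Fin d) →ₗ[ℝ]
      EuclideanSpace ℝ (Fin d))|) * μHE[d] A ∧
    ENNReal.ofReal |LinearMap.det (T : EuclideanSpace ℝ (Fin d) →ₗ[ℝ]
      EuclideanSpace ℝ (Fin d))| * μHE[d] A ≤ ENNReal.ofReal (ϑ ^ d * θ ^ d) * μHE[d] (φ '' A) := by
  set P := ContinuousLinearMap.adjoint ι.toContinuousLinearMap with hP
  -- The sets `A`, `P A`, `T P A` and `φ A` are compared by distances, except for the passage from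
  -- `P A` to `T P A`: it takes place in `ℝ^d`, where Hausdorff measure is Lebesgue measure and
  -- scales by the determinant.
  have hT : μHE[d] ((fun y => T (P y)) '' A) =
      ENNReal.ofReal |LinearMap.det (T : EuclideanSpace ℝ (Fin d) →ₗ[ℝ]
        EuclideanSpace ℝ (Fin d))| * μHE[d] ((fun y => P y) '' A) := by
    have e : (fun y => T (P y)) '' A = T '' ((fun y => P y) '' A) := by rw [Set.image_image]
    rw [e, EuclideanSpace.euclideanHausdorffMeasure_eq_volume]
    exact Measure.addHaar_image_continuousLinearMap _ T _
  have hid : (fun y : EuclideanSpace ℝ (Fin N) => y) '' A = A := Set.image_id' A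
  have h1 : μHE[d] (φ '' A) ≤ ENNReal.ofReal (θ ^ d) * μHE[d] ((fun y => T (P y)) '' A) := by
    refine euclideanHausdorffMeasure_image_le_of_dist_le d hθ fun y hy z hz => ?_
    rw [dist_eq_norm, dist_eq_norm, ← map_sub, ← map_sub]
    exact (h y hy z hz).1
  have h2 : μHE[d] ((fun y => T (P y)) '' A) ≤ ENNReal.ofReal (θ ^ d) * μHE[d] (φ '' A) := by
    refine euclideanHausdorffMeasure_image_le_of_dist_le d hθ fun y hy z hz => ?_
    rw [dist_eq_norm, dist_eq_norm, ← map_sub, ← map_sub]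
    exact (h y hy z hz).2.1
  have h3 : μHE[d] ((fun y : EuclideanSpace ℝ (Fin N) => y) '' A) ≤
      ENNReal.ofReal (ϑ ^ d) * μHE[d] ((fun y => P y) '' A) := by
    refine euclideanHausdorffMeasure_image_le_of_dist_le d hϑ fun y hy z hz => ?_
    rw [dist_eq_norm, dist_eq_norm, ← map_sub]
    exact (h y hy z hz).2.2
  have h4 : μHE[d] ((fun y => P y) '' A) ≤
      ENNReal.ofReal (1 ^ d) * μHE[d] ((fun y : EuclideanSpace ℝ (Fin N) => y) '' A) := by
    refine euclideanHausdorffMeasure_image_le_of_dist_le d zero_le_one fun y hy z hz => ?_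
    rw [dist_eq_norm, dist_eq_norm, ← map_sub, one_mul]
    exact norm_adjoint_apply_le ι _
  rw [hid] at h3 h4
  rw [one_pow, ENNReal.ofReal_one, one_mul] at h4
  have hθd : 0 ≤ θ ^ d := by positivity
  have hϑd : 0 ≤ ϑ ^ d := by positivity
  constructor
  · rw [ENNReal.ofReal_mul hθd, mul_assoc]
    refine h1.trans (mul_le_mul_right ?_ _)
    rw [hT]
    exact mul_le_mul_right h4 _
  · rw [ENNReal.ofReal_mul hϑd, mul_assoc]
    calc _ ≤ ENNReal.ofReal |LinearMap.det (T : EuclideanSpace ℝ (Fin d) →ₗ[ℝ]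
          EuclideanSpace ℝ (Fin d))| * (ENNReal.ofReal (ϑ ^ d) * μHE[d] ((fun y => P y) '' A)) :=
          mul_le_mul_right h3 _
      _ = ENNReal.ofReal (ϑ ^ d) * μHE[d] ((fun y => T (P y)) '' A) := by
          rw [hT, mul_left_comm]
      _ ≤ _ := mul_le_mul_right h2 _

theorem exists_one_add_mul_sq_pow_le (d : ℕ) {c η : ℝ} (hη : 0 < η) :
    ∃ t₀ > 0, ∀ t : ℝ, |t| ≤ t₀ → (1 + c * t ^ 2) ^ d ≤ 1 + η * |t| := by
  have h : HasDerivAt (fun t : ℝ => (1 + c * t ^ 2) ^ d) 0 0 := by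
    have h2 : HasDerivAt (fun t : ℝ => 1 + c * t ^ 2) 0 0 := by
      have := ((hasDerivAt_pow 2 (0 : ℝ)).const_mul c).const_add 1
      simpa using this
    simpa using h2.fun_pow d
  have h1 := (hasDerivAt_iff_isLittleO.1 h).def hη
  obtain ⟨t₀, ht₀, h2⟩ := Metric.eventually_nhds_iff.1 h1
  refine ⟨t₀ / 2, by positivity, fun t ht => ?_⟩
  have h3 := h2 (y := t) (by rw [Real.dist_eq, sub_zero]; linarith)
  simp only [sub_zero, smul_zero, ne_eq, OfNat.ofNat_ne_zero, not_false_eq_true, zero_pow,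
    mul_zero, add_zero, one_pow, Real.norm_eq_abs] at h3
  linarith [le_abs_self ((1 + c * t ^ 2) ^ d - 1)]

theorem measure_bounds_of_det {a b D x y : ℝ} {m m' : ℝ≥0∞} (ha : 0 ≤ a) (ha4 : 4 * a ≤ 1 / 4)
    (h1 : -a ≤ D - 1 - b) (h2 : D - 1 - b ≤ a) (hb1 : -(1 / 4) ≤ b) (hb2 : b ≤ 1 / 4)
    (hx1 : x ≤ 1 + a) (hxy : y * x ≤ 1 + a)
    (hm : m' ≤ ENNReal.ofReal (x * D) * m)
    (hm' : ENNReal.ofReal D * m ≤ ENNReal.ofReal (y * x) * m') :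
    m' ≤ ENNReal.ofReal (1 + b + 4 * a) * m ∧ ENNReal.ofReal (1 + b - 4 * a) * m ≤ m' := by
  have hDpos : 0 < D := by linarith
  constructor
  · refine hm.trans (mul_le_mul_left (ENNReal.ofReal_le_ofReal ?_) _)
    refine (mul_le_mul_of_nonneg_right hx1 hDpos.le).trans ?_
    have : a * D ≤ a * 2 := mul_le_mul_of_nonneg_left (by linarith) ha
    linarith
  · have hpos : 0 < 1 + a := by linarith
    have h3 : ENNReal.ofReal (1 + b - 4 * a) ≤ ENNReal.ofReal (D / (1 + a)) := by
      refine ENNReal.ofReal_le_ofReal ?_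
      rw [le_div_iff₀ hpos]
      have : a * (1 + b - 4 * a) ≤ a * 2 := mul_le_mul_of_nonneg_left (by linarith) ha
      linarith
    have h4 : ENNReal.ofReal D * m ≤ ENNReal.ofReal (1 + a) * m' :=
      hm'.trans (mul_le_mul_left (ENNReal.ofReal_le_ofReal hxy) _)
    refine (mul_le_mul_left h3 _).trans ?_
    rw [ENNReal.ofReal_div_of_pos hpos, ENNReal.div_eq_inv_mul, mul_assoc,
      ENNReal.inv_mul_le_iff (by simpa using hpos) ENNReal.ofReal_ne_top]
    exact h4

/-- An infinitesimal first order area formula. Near `x` the flow is, up to factors `1 + O(t ^ 2)`,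
the compression of `id + t V'` to the tangent space, and the determinant of that compression is `1 +
t` times its trace up to `o(t)`. The threshold `t₀` is uniform in the point, while `U` may depend on
`t` and `x`; this is harmless because inequalities between measures are local. -/
theorem IsFlowOf.exists_local_distortion (hψ : IsFlowOf V ψ) (hV : ContDiff ℝ ∞ V)
    (hL : LipschitzWith K V) (d : ℕ) (R : ℝ) {η : ℝ} (hη : 0 < η) :
    ∃ t₀ > 0, ∀ t : ℝ, |t| ≤ t₀ → t ≠ 0 → ∀ (S : Set (EuclideanSpace ℝ (Fin N)))
      (x : EuclideanSpace ℝ (Fin N)), ‖x‖ ≤ R →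
      ∀ ι : EuclideanSpace ℝ (Fin d) →ₗᵢ[ℝ] EuclideanSpace ℝ (Fin N), IsTangentAt S x ι →
      ∃ U ∈ 𝓝 x, ∀ A ⊆ S ∩ U,
        μHE[d] (ψ t '' A) ≤ ENNReal.ofReal (1 + t * LinearMap.trace ℝ _
          (compress ι (fderiv ℝ V x)).toLinearMap + η * |t|) * μHE[d] A ∧
        ENNReal.ofReal (1 + t * LinearMap.trace ℝ _
          (compress ι (fderiv ℝ V x)).toLinearMap - η * |t|) * μHE[d] A ≤ μHE[d] (ψ t '' A) := by
  obtain ⟨C, hC, hloc⟩ := hψ.exists_nhds_norm_sub_le hV hL R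
  obtain ⟨cτ, hcτ, hτ⟩ := exists_abs_trace_le (EuclideanSpace ℝ (Fin d))
  have hη4 : 0 < η / 4 := by positivity
  set c := 8 * (C + 1 + (K : ℝ)) + 2 * (K : ℝ) ^ 2 with hc
  have hc0 : 0 ≤ c := by positivity
  obtain ⟨t₁, ht₁, hdet⟩ := exists_abs_det_sub_le (EuclideanSpace ℝ (Fin d))
    (show (0 : ℝ) ≤ K from K.2) hη4
  -- Exponent `d + d` and constant `c + 2` cover at once the power of `1 + c t²` and its product
  -- with the power of `1 + 2 t²`.
  obtain ⟨t₂, ht₂, hθ⟩ := exists_one_add_mul_sq_pow_le (d + d) (c := c + 2) hη4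
  have hsmall : ∀ᶠ t : ℝ in 𝓝 0, |t| ≤ 1 ∧ |t| * K ≤ 1 / 2 ∧ t ^ 2 ≤ 1 / 2 ∧
      (C + 1 + K) * t ^ 2 ≤ 1 / 8 ∧ |t| * (cτ * K) ≤ 1 / 4 ∧ η * |t| ≤ 1 / 4 := by
    have key : ∀ (g : ℝ → ℝ) (a : ℝ), Continuous g → g 0 < a → ∀ᶠ t : ℝ in 𝓝 0, g t ≤ a :=
      fun g a hg h0 => ((hg.tendsto 0).eventually (gt_mem_nhds h0)).mono fun _ h => h.le
    refine (key _ 1 continuous_abs (by simp)).and ((key _ _ ?_ ?_).and ((key _ _ ?_ ?_).and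
      ((key _ _ ?_ ?_).and ((key _ _ ?_ ?_).and (key _ _ ?_ ?_)))))
    all_goals first | fun_prop | norm_num
  obtain ⟨t₃, ht₃, hsm⟩ := Metric.eventually_nhds_iff.1 hsmall
  refine ⟨min (min t₁ t₂) (t₃ / 2), by positivity, fun t ht ht0 S x hx ι hι => ?_⟩
  obtain ⟨s1, s2, s3, s4, s5, s6⟩ := hsm (y := t) (by
    rw [Real.dist_eq, sub_zero]; linarith [min_le_right (min t₁ t₂) (t₃ / 2)])
  have hA : ‖fderiv ℝ V x‖ ≤ (K : ℝ) := norm_fderiv_le_of_lipschitz ℝ hL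
  have hcA := norm_compress_le ι hA
  have hd := hdet t (ht.trans ((min_le_left _ _).trans (min_le_left _ _))) _ hcA
  have hθt := hθ t (ht.trans ((min_le_left _ _).trans (min_le_right _ _)))
  have htr := (hτ (compress ι (fderiv ℝ V x))).trans (mul_le_mul_of_nonneg_left hcA hcτ)
  obtain ⟨U₁, hU₁, h1⟩ := hloc t s1 ht0 x hx
  -- Secants are required to be tangent up to `t ^ 2`, so that the curvature of `S` enters only at
  -- second order.
  obtain ⟨U₂, hU₂, h2⟩ := hι (t ^ 2) (by positivity)
  refine ⟨U₁ ∩ U₂, inter_mem hU₁ hU₂, fun A hAS => ?_⟩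
  have hb := euclideanHausdorffMeasure_image_bounds (ι := ι)
    (T := ContinuousLinearMap.id ℝ _ + t • compress ι (fderiv ℝ V x)) (φ := ψ t)
    (θ := 1 + c * t ^ 2) (ϑ := 1 + 2 * t ^ 2) (by positivity) (by positivity) (A := A)
    (fun y hy z hz => norm_le_and_le_norm_of_tangent ι hA hC s1 s2 s3 s4
      (h2 y ⟨(hAS hy).1, (hAS hy).2.2⟩ z ⟨(hAS hz).1, (hAS hz).2.2⟩)
      (h1 y (hAS hy).2.1 z (hAS hz).2.1))
  set D := LinearMap.det ((ContinuousLinearMap.id ℝ (EuclideanSpace ℝ (Fin d)) +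
    t • compress ι (fderiv ℝ V x) : EuclideanSpace ℝ (Fin d) →L[ℝ] EuclideanSpace ℝ (Fin d)) :
      EuclideanSpace ℝ (Fin d) →ₗ[ℝ] EuclideanSpace ℝ (Fin d)) with hD
  set δ := LinearMap.trace ℝ _ (compress ι (fderiv ℝ V x)).toLinearMap with hδ
  have htδ : |t * δ| ≤ 1 / 4 := by
    rw [abs_mul]; exact (mul_le_mul_of_nonneg_left htr (abs_nonneg _)).trans s5
  have habs := abs_nonneg t
  obtain ⟨d1, d2⟩ := abs_le.1 hd
  obtain ⟨e1, e2⟩ := abs_le.1 htδ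
  have hDpos : 0 < D := by linarith
  rw [abs_of_pos hDpos] at hb
  have hθ1 : (1 + c * t ^ 2) ^ d ≤ 1 + η / 4 * |t| := by
    refine le_trans ?_ hθt
    refine (pow_le_pow_left₀ (by positivity) ?_ d).trans
      (pow_le_pow_right₀ (le_add_of_nonneg_right (by positivity)) (Nat.le_add_left d d))
    exact add_le_add le_rfl (mul_le_mul_of_nonneg_right (by linarith) (sq_nonneg t))
  have hθ2 : (1 + 2 * t ^ 2) ^ d * (1 + c * t ^ 2) ^ d ≤ 1 + η / 4 * |t| := by
    refine le_trans ?_ hθt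
    rw [pow_add]
    refine mul_le_mul (pow_le_pow_left₀ (by positivity) ?_ d)
      (pow_le_pow_left₀ (by positivity) ?_ d) (by positivity) (by positivity)
    all_goals exact add_le_add le_rfl (mul_le_mul_of_nonneg_right (by linarith) (sq_nonneg t))
  have ha0 : 0 ≤ η / 4 * |t| := by positivity
  have haη : η * |t| = 4 * (η / 4 * |t|) := by ring
  rw [haη] at s6 ⊢
  exact measure_bounds_of_det ha0 s6 d1 d2 e1 e2 hθ1 hθ2 hb.1 hb.2

end Distortion

/-! ### Gluing local inequalities between measures. -/

section Gluing

/-- A countable subcover is made disjoint. Since the local inequality holds for every measurable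
subset of the neighbourhood, the pieces add up with no loss from overlaps. -/
theorem restrict_le_restrict_of_nhds {X : Type*} [TopologicalSpace X] [SecondCountableTopology X]
    [MeasurableSpace X] [BorelSpace X] {α β : Measure X} {S : Set X}
    (h : ∀ x ∈ S, ∃ U ∈ 𝓝 x, ∀ A ⊆ S ∩ U, MeasurableSet A → α A ≤ β A) (hS : MeasurableSet S) :
    α.restrict S ≤ β.restrict S := by
  choose! U hU hUA using h
  obtain ⟨s, hs, hsc, hcov⟩ := TopologicalSpace.countable_cover_nhdsWithin
    (f := fun x => interior (U x)) (s := S) fun x hx =>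
      mem_nhdsWithin_of_mem_nhds (interior_mem_nhds.2 (hU x hx))
  refine Measure.le_iff.2 fun A hA => ?_
  rw [Measure.restrict_apply hA, Measure.restrict_apply hA]
  rcases s.eq_empty_or_nonempty with rfl | hne
  · have : S = ∅ := by simpa using hcov
    simp [this]
  obtain ⟨e, rfl⟩ := hsc.exists_eq_range hne
  have hUm : ∀ n, MeasurableSet (interior (U (e n))) := fun n => isOpen_interior.measurableSet
  have hdm : ∀ n, MeasurableSet (disjointed (fun n => interior (U (e n))) n) :=
    MeasurableSet.disjointed hUm
  have hAS : A ∩ S = ⋃ n, (A ∩ S) ∩ disjointed (fun n => interior (U (e n))) n := by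
    rw [← Set.inter_iUnion, iUnion_disjointed]
    refine (Set.inter_eq_left.2 fun x hx => ?_).symm
    simpa using hcov hx.2
  have hdisj : Pairwise (Function.onFun Disjoint
      fun n => (A ∩ S) ∩ disjointed (fun n => interior (U (e n))) n) := fun i j hij =>
    (disjoint_disjointed _ hij).mono Set.inter_subset_right Set.inter_subset_right
  rw [hAS, measure_iUnion hdisj fun n => (hA.inter hS).inter (hdm n),
    measure_iUnion hdisj fun n => (hA.inter hS).inter (hdm n)]
  refine ENNReal.tsum_le_tsum fun n => hUA (e n) (hs ⟨n, rfl⟩) _ ?_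
    ((hA.inter hS).inter (hdm n))
  exact fun x hx => ⟨hx.1.2, interior_subset (disjointed_subset _ n hx.2)⟩

end Gluing

/-! ### From density bounds to estimates of integrals. -/

section DensityBounds

variable {X : Type*} [MeasurableSpace X] {σ m : Measure X} {w h : X → ℝ} {κ B : ℝ}

theorem integrable_withDensity_ofReal (hw : AEMeasurable w σ) (hB : ∀ᵐ x ∂σ, |w x| ≤ B)
    (hh : Integrable h σ) :
    Integrable h (σ.withDensity fun x => ENNReal.ofReal (w x)) := by
  rw [integrable_withDensity_iff_integrable_smul₀' hw.ennreal_ofReal (by simp)]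
  refine Integrable.mono' (hh.norm.const_mul B) ?_ ?_
  · exact hw.ennreal_ofReal.ennreal_toReal.aestronglyMeasurable.smul hh.aestronglyMeasurable
  · filter_upwards [hB] with x hx
    rw [norm_smul]
    refine mul_le_mul_of_nonneg_right ?_ (norm_nonneg _)
    rw [ENNReal.toReal_ofReal', Real.norm_eq_abs, abs_of_nonneg (le_max_right _ _)]
    exact max_le ((le_abs_self _).trans hx) ((abs_nonneg _).trans hx)

theorem integral_withDensity_ofReal (hw : AEMeasurable w σ) :
    ∫ x, h x ∂(σ.withDensity fun x => ENNReal.ofReal (w x)) = ∫ x, h x * max (w x) 0 ∂σ := by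
  rw [integral_withDensity_eq_integral_toReal_smul₀ hw.ennreal_ofReal (by simp)]
  simp only [ENNReal.toReal_ofReal', smul_eq_mul, mul_comm]

theorem integrable_mul_of_abs_le (hw : AEMeasurable w σ) (hB : ∀ᵐ x ∂σ, |w x| ≤ B)
    (hh : Integrable h σ) : Integrable (fun x => h x * w x) σ :=
  hh.mul_bdd hw.aestronglyMeasurable hB

theorem integrable_of_le_withDensity (hw : AEMeasurable w σ) (hB : ∀ᵐ x ∂σ, |w x| ≤ B)
    (hm : m ≤ σ.withDensity fun x => ENNReal.ofReal (w x + κ)) (hh : Integrable h σ) :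
    Integrable h m := by
  refine (integrable_withDensity_ofReal (hw.add_const κ) (B := B + |κ|) ?_ hh).mono_measure hm
  filter_upwards [hB] with x hx
  exact (abs_add_le _ _).trans (add_le_add hx le_rfl)

theorem integral_bounds_of_nonneg (hκ : 0 ≤ κ) (hw : AEMeasurable w σ) (hB : ∀ᵐ x ∂σ, |w x| ≤ B)
    (hκw : ∀ᵐ x ∂σ, 0 ≤ w x + κ)
    (hm : m ≤ σ.withDensity fun x => ENNReal.ofReal (w x + κ))
    (hm' : (σ.withDensity fun x => ENNReal.ofReal (w x - κ)) ≤ m)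
    (hh : Integrable h σ) (h0 : ∀ x, 0 ≤ h x) :
    |∫ x, h x ∂m - ∫ x, h x * w x ∂σ| ≤ κ * ∫ x, h x ∂σ := by
  have hB1 : ∀ᵐ x ∂σ, |w x + κ| ≤ B + κ := by
    filter_upwards [hB] with x hx
    exact (abs_add_le _ _).trans (add_le_add hx (abs_of_nonneg hκ).le)
  have hB2 : ∀ᵐ x ∂σ, |w x - κ| ≤ B + κ := by
    filter_upwards [hB] with x hx
    exact (abs_sub _ _).trans (add_le_add hx (abs_of_nonneg hκ).le)
  have hi1 := integrable_withDensity_ofReal (hw.add_const κ) hB1 hh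
  have hi := hi1.mono_measure hm
  have h1 : ∫ x, h x ∂m ≤ ∫ x, h x * (w x + κ) ∂σ := by
    refine (integral_mono_measure hm (ae_of_all _ h0) hi1).trans (le_of_eq ?_)
    rw [integral_withDensity_ofReal (hw.add_const κ)]
    refine integral_congr_ae ?_
    filter_upwards [hκw] with x hx
    rw [max_eq_left hx]
  have h2 : ∫ x, h x * (w x - κ) ∂σ ≤ ∫ x, h x ∂m := by
    -- The density `w - κ` may be negative and is truncated at zero by `ENNReal.ofReal`; for `h ≥ 0`
    -- the truncation only increases the integral, so the lower bound survives.
    refine le_trans ?_ (integral_mono_measure hm' (ae_of_all _ h0) hi)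
    rw [integral_withDensity_ofReal (hw.sub_const κ)]
    refine integral_mono (integrable_mul_of_abs_le (hw.sub_const κ) hB2 hh) ?_ fun x =>
      mul_le_mul_of_nonneg_left (le_max_left _ _) (h0 x)
    refine integrable_mul_of_abs_le (w := fun x => max (w x - κ) 0) (B := B + κ)
      ((hw.sub_const κ).max aemeasurable_const) ?_ hh
    filter_upwards [hB2] with x hx
    rw [abs_of_nonneg (le_max_right _ _)]
    exact max_le ((le_abs_self _).trans hx) ((abs_nonneg _).trans hx)
  have hiw := integrable_mul_of_abs_le hw hB hh
  have e1 : ∫ x, h x * (w x + κ) ∂σ = ∫ x, h x * w x ∂σ + κ * ∫ x, h x ∂σ := by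
    simp only [mul_add]
    rw [integral_add hiw (hh.mul_const κ), integral_mul_const, mul_comm κ]
  have e2 : ∫ x, h x * (w x - κ) ∂σ = ∫ x, h x * w x ∂σ - κ * ∫ x, h x ∂σ := by
    simp only [mul_sub]
    rw [integral_sub hiw (hh.mul_const κ), integral_mul_const, mul_comm κ]
  rw [abs_le]
  constructor <;> linarith

/-- The positive and negative parts of `h` are treated separately, and their errors add up to `κ`
times the integral of `|h|`. -/
theorem abs_integral_sub_le_of_withDensity (hκ : 0 ≤ κ) (hw : AEMeasurable w σ)
    (hB : ∀ᵐ x ∂σ, |w x| ≤ B) (hκw : ∀ᵐ x ∂σ, 0 ≤ w x + κ)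
    (hm : m ≤ σ.withDensity fun x => ENNReal.ofReal (w x + κ))
    (hm' : (σ.withDensity fun x => ENNReal.ofReal (w x - κ)) ≤ m) (hh : Integrable h σ) :
    |∫ x, h x ∂m - ∫ x, h x * w x ∂σ| ≤ κ * ∫ x, |h x| ∂σ := by
  have hpi : Integrable (fun x => max (h x) 0) σ := hh.pos_part
  have hni : Integrable (fun x => max (-h x) 0) σ := hh.neg_part
  have hp := integral_bounds_of_nonneg hκ hw hB hκw hm hm' hpi fun x => le_max_right _ _
  have hn := integral_bounds_of_nonneg hκ hw hB hκw hm hm' hni fun x => le_max_right _ _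
  have e : ∀ x, h x = max (h x) 0 - max (-h x) 0 := fun x => (max_zero_sub_eq_self (h x)).symm
  have e' : ∀ x, |h x| = max (h x) 0 + max (-h x) 0 := fun x => by
    rw [max_comm, max_comm (-h x)]
    rcases le_total 0 (h x) with hx | hx
    · rw [abs_of_nonneg hx, max_eq_right hx, max_eq_left (by linarith), add_zero]
    · rw [abs_of_nonpos hx, max_eq_left hx, max_eq_right (by linarith), zero_add]
  have e1 : ∫ x, h x ∂m = ∫ x, max (h x) 0 ∂m - ∫ x, max (-h x) 0 ∂m := by
    rw [← integral_sub (integrable_of_le_withDensity hw hB hm hpi)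
      (integrable_of_le_withDensity hw hB hm hni)]
    exact integral_congr_ae (ae_of_all _ e)
  have e2 : ∫ x, h x * w x ∂σ = ∫ x, max (h x) 0 * w x ∂σ - ∫ x, max (-h x) 0 * w x ∂σ := by
    rw [← integral_sub (integrable_mul_of_abs_le hw hB hpi) (integrable_mul_of_abs_le hw hB hni)]
    refine integral_congr_ae (ae_of_all _ fun x => ?_)
    simp only
    rw [← sub_mul, ← e x]
  have e3 : ∫ x, |h x| ∂σ = ∫ x, max (h x) 0 ∂σ + ∫ x, max (-h x) 0 ∂σ := by
    rw [← integral_add hpi hni]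
    exact integral_congr_ae (ae_of_all _ e')
  rw [abs_le] at hp hn ⊢
  rw [e1, e2, e3, mul_add]
  constructor <;> linarith [hp.1, hp.2, hn.1, hn.2]

end DensityBounds

/-! ### First order change of variables on invariant sets. -/

section Flow

variable {N d : ℕ}
variable {V : EuclideanSpace ℝ (Fin N) → EuclideanSpace ℝ (Fin N)} {K : NNReal}
  {ψ : ℝ → EuclideanSpace ℝ (Fin N) → EuclideanSpace ℝ (Fin N)}
  {S : Set (EuclideanSpace ℝ (Fin N))} {δ : EuclideanSpace ℝ (Fin N) → ℝ}

theorem IsFlowOf.preimage_neg_eq_image (hψ : IsFlowOf V ψ) (hL : LipschitzWith K V) (t : ℝ)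
    (A : Set (EuclideanSpace ℝ (Fin N))) : ψ (-t) ⁻¹' A = ψ t '' A := by
  ext x
  constructor
  · exact fun hx => ⟨_, hx, hψ.apply_neg_apply hL t x⟩
  · rintro ⟨y, hy, rfl⟩
    rwa [Set.mem_preimage, hψ.neg_apply_apply hL]

theorem IsFlowOf.preimage_eq_self (hψ : IsFlowOf V ψ) (hL : LipschitzWith K V)
    (hinv : ∀ t, ∀ x ∈ S, ψ t x ∈ S) (t : ℝ) : ψ t ⁻¹' S = S := by
  ext x
  refine ⟨fun hx => ?_, hinv t x⟩
  have := hinv (-t) _ hx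
  rwa [hψ.neg_apply_apply hL] at this

theorem IsFlowOf.map_restrict_eq (hψ : IsFlowOf V ψ) (hL : LipschitzWith K V)
    (hS : MeasurableSet S) (hinv : ∀ t, ∀ x ∈ S, ψ t x ∈ S) (t : ℝ)
    (μ : Measure (EuclideanSpace ℝ (Fin N))) :
    (μ.restrict S).map (ψ t) = (μ.map (ψ t)).restrict S := by
  rw [Measure.restrict_map (hψ.continuous hL t).measurable hS, hψ.preimage_eq_self hL hinv]

/-- The push-forward by `ψ (-t)` measures a set by the measure of its image under `ψ t`. Half of `η`
pays for the local distortion, the other half for replacing `δ x` by `δ y` near `x`; the local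
bounds are then glued. -/
theorem IsFlowOf.exists_map_bounds (hψ : IsFlowOf V ψ) (hV : ContDiff ℝ ∞ V)
    (hL : LipschitzWith K V) (d : ℕ) (hS : MeasurableSet S) (hb : Bornology.IsBounded S)
    (hinv : ∀ t, ∀ x ∈ S, ψ t x ∈ S) (hδ : ContinuousOn δ S)
    (htan : ∀ x ∈ S, ∃ ι : EuclideanSpace ℝ (Fin d) →ₗᵢ[ℝ] EuclideanSpace ℝ (Fin N),
      IsTangentAt S x ι ∧
        LinearMap.trace ℝ _ (compress ι (fderiv ℝ V x)).toLinearMap = δ x)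
    {η : ℝ} (hη : 0 < η) :
    ∃ t₀ > 0, ∀ t : ℝ, |t| ≤ t₀ →
      ((μHE[d]).restrict S).map (ψ (-t)) ≤ ((μHE[d]).restrict S).withDensity
        (fun x => ENNReal.ofReal (1 + t * δ x + η * |t|)) ∧
      ((μHE[d]).restrict S).withDensity (fun x => ENNReal.ofReal (1 + t * δ x - η * |t|)) ≤
        ((μHE[d]).restrict S).map (ψ (-t)) := by
  obtain ⟨R, hR⟩ := hb.exists_norm_le
  obtain ⟨t₀, ht₀, hloc⟩ := hψ.exists_local_distortion hV hL d R (half_pos hη)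
  refine ⟨t₀, ht₀, fun t ht => ?_⟩
  rcases eq_or_ne t 0 with rfl | ht0
  · have h0 : ψ (-0) = id := by ext1 x; rw [neg_zero]; exact hψ.map_zero x
    rw [h0]
    simp
  rw [hψ.map_restrict_eq hL hS hinv, ← restrict_withDensity hS, ← restrict_withDensity hS]
  have key : ∀ x ∈ S, ∃ U ∈ 𝓝 x, ∀ A ⊆ S ∩ U, MeasurableSet A →
      (μHE[d]).map (ψ (-t)) A ≤ (μHE[d]).withDensity
        (fun x => ENNReal.ofReal (1 + t * δ x + η * |t|)) A ∧
      (μHE[d]).withDensity (fun x => ENNReal.ofReal (1 + t * δ x - η * |t|)) A ≤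
        (μHE[d]).map (ψ (-t)) A := by
    intro x hx
    obtain ⟨ι, hι, hιδ⟩ := htan x hx
    obtain ⟨U, hU, hUA⟩ := hloc t ht ht0 S x (hR x hx) ι hι
    rw [hιδ] at hUA
    have hc := Metric.continuousWithinAt_iff.1 (hδ x hx) (η / 2) (half_pos hη)
    obtain ⟨r, hr, hcr⟩ := hc
    refine ⟨U ∩ Metric.ball x r, inter_mem hU (Metric.ball_mem_nhds x hr), fun A hA hAm => ?_⟩
    have hclose : ∀ y ∈ A, |t * δ y - t * δ x| ≤ η / 2 * |t| := fun y hy => by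
      have h1 := (hcr (hA hy).1 (hA hy).2.2).le
      rw [Real.dist_eq] at h1
      rw [← mul_sub, abs_mul, mul_comm]
      exact mul_le_mul_of_nonneg_right h1 (abs_nonneg _)
    obtain ⟨h1, h2⟩ := hUA A fun y hy => ⟨(hA hy).1, (hA hy).2.1⟩
    rw [Measure.map_apply (hψ.continuous hL _).measurable hAm, hψ.preimage_neg_eq_image hL,
      withDensity_apply _ hAm, withDensity_apply _ hAm]
    constructor
    · refine h1.trans ?_
      rw [← setLIntegral_const]
      refine setLIntegral_mono' hAm fun y hy => ENNReal.ofReal_le_ofReal ?_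
      have := (abs_le.1 (hclose y hy)).1
      linarith
    · refine le_trans ?_ h2
      rw [← setLIntegral_const]
      refine setLIntegral_mono' hAm fun y hy => ENNReal.ofReal_le_ofReal ?_
      have := (abs_le.1 (hclose y hy)).2
      linarith
  constructor
  · refine restrict_le_restrict_of_nhds (fun x hx => ?_) hS
    obtain ⟨U, hU, h⟩ := key x hx
    exact ⟨U, hU, fun A hA hAm => (h A hA hAm).1⟩
  · refine restrict_le_restrict_of_nhds (fun x hx => ?_) hS
    obtain ⟨U, hU, h⟩ := key x hx
    exact ⟨U, hU, fun A hA hAm => (h A hA hAm).2⟩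

/-- First order change of variables for the flow on an invariant set. -/
def HasFirstOrderDistortion (ψ : ℝ → EuclideanSpace ℝ (Fin N) → EuclideanSpace ℝ (Fin N))
    (σ : Measure (EuclideanSpace ℝ (Fin N))) (δ : EuclideanSpace ℝ (Fin N) → ℝ) : Prop :=
  ∀ η : ℝ, 0 < η → ∃ t₀ > 0, ∀ t : ℝ, |t| ≤ t₀ → ∀ h : EuclideanSpace ℝ (Fin N) → ℝ,
    Integrable h σ → Integrable (fun x => h (ψ (-t) x)) σ ∧
      |∫ x, h (ψ (-t) x) ∂σ - ∫ x, h x * (1 + t * δ x) ∂σ| ≤ η * |t| * ∫ x, |h x| ∂σ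

/-- The push-forward is squeezed between densities `1 + t δ ± η |t|`. Because this is a bound on
measures, the threshold on `t` is independent of the integrand, which may later itself depend on
`t`. -/
theorem IsFlowOf.hasFirstOrderDistortion (hψ : IsFlowOf V ψ) (hV : ContDiff ℝ ∞ V)
    (hL : LipschitzWith K V) (d : ℕ) (hS : MeasurableSet S) (hb : Bornology.IsBounded S)
    (hinv : ∀ t, ∀ x ∈ S, ψ t x ∈ S) (hδ : ContinuousOn δ S) {B : ℝ} (hB : ∀ x ∈ S, |δ x| ≤ B)
    (htan : ∀ x ∈ S, ∃ ι : EuclideanSpace ℝ (Fin d) →ₗᵢ[ℝ] EuclideanSpace ℝ (Fin N),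
      IsTangentAt S x ι ∧
        LinearMap.trace ℝ _ (compress ι (fderiv ℝ V x)).toLinearMap = δ x) :
    HasFirstOrderDistortion ψ ((μHE[d]).restrict S) δ := by
  intro η hη
  obtain ⟨t₁, ht₁, hmap⟩ := hψ.exists_map_bounds hV hL d hS hb hinv hδ htan hη
  refine ⟨min t₁ (1 / (|B| + 1)), by positivity, fun t ht h hh => ?_⟩
  obtain ⟨h1, h2⟩ := hmap t (ht.trans (min_le_left _ _))
  have hw : AEMeasurable (fun x => 1 + t * δ x) ((μHE[d]).restrict S) :=
    ((hδ.aemeasurable hS).const_mul t).const_add 1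
  have htB : |t| * |B| ≤ 1 := by
    have h3 := mul_le_mul_of_nonneg_right (ht.trans (min_le_right _ _))
      (show (0 : ℝ) ≤ |B| + 1 by positivity)
    rw [one_div_mul_cancel (by positivity)] at h3
    nlinarith [abs_nonneg t]
  have hb1 : ∀ᵐ x ∂((μHE[d]).restrict S), |t * δ x| ≤ 1 := by
    filter_upwards [ae_restrict_mem hS] with x hx
    rw [abs_mul]
    exact (mul_le_mul_of_nonneg_left ((hB x hx).trans (le_abs_self B)) (abs_nonneg t)).trans htB
  have hb2 : ∀ᵐ x ∂((μHE[d]).restrict S), |1 + t * δ x| ≤ 2 := by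
    filter_upwards [hb1] with x hx
    rw [abs_le] at hx ⊢
    constructor <;> linarith
  have hκ : 0 ≤ η * |t| := by positivity
  have hb3 : ∀ᵐ x ∂((μHE[d]).restrict S), 0 ≤ 1 + t * δ x + η * |t| := by
    filter_upwards [hb1] with x hx
    linarith [(abs_le.1 hx).1]
  have hi := integrable_of_le_withDensity hw hb2 h1 hh
  have key := abs_integral_sub_le_of_withDensity hκ hw hb2 hb3 h1 h2 hh
  have hm := (hψ.continuous hL (-t)).aemeasurable (μ := (μHE[d]).restrict S)
  rw [integral_map hm hi.aestronglyMeasurable] at key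
  exact ⟨hi.comp_aemeasurable hm, key⟩

/-- A crude bound from the Lipschitz constant of the inverse map, enough for composition with the
flow to preserve `L^q`, uniformly for bounded times. -/
theorem IsFlowOf.exists_map_le_smul (hψ : IsFlowOf V ψ) (hL : LipschitzWith K V) (d : ℕ)
    (hinv : ∀ t, ∀ x ∈ S, ψ t x ∈ S) (T : ℝ) :
    ∃ c : NNReal, ∀ t, |t| ≤ T →
      ((μHE[d]).restrict S).map (ψ t) ≤ (c : ℝ≥0∞) • (μHE[d]).restrict S := by
  refine ⟨Real.toNNReal (Real.exp (K * T)) ^ d, fun t ht => Measure.le_iff.2 fun A hA => ?_⟩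
  rw [Measure.map_apply (hψ.continuous hL t).measurable hA,
    Measure.restrict_apply ((hψ.continuous hL t).measurable hA), Measure.smul_apply,
    Measure.restrict_apply hA, smul_eq_mul]
  have e : ψ t ⁻¹' A ∩ S = ψ (-t) '' (A ∩ S) := by
    rw [← hψ.preimage_neg_eq_image hL, neg_neg, Set.preimage_inter, hψ.preimage_eq_self hL hinv]
  have hle : Real.toNNReal (Real.exp (K * |-t|)) ≤ Real.toNNReal (Real.exp (K * T)) :=
    Real.toNNReal_le_toNNReal (Real.exp_le_exp.2
      (mul_le_mul_of_nonneg_left (by rwa [abs_neg]) K.2))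
  rw [e]
  refine (euclideanHausdorffMeasure_image_le d
    ((hψ.lipschitzWith hL (-t)).weaken hle).lipschitzOnWith).trans ?_
  rw [ENNReal.coe_pow]

theorem IsFlowOf.memLp_comp {F : Type*} [NormedAddCommGroup F] (hψ : IsFlowOf V ψ)
    (hL : LipschitzWith K V) (d : ℕ)
    (hinv : ∀ t, ∀ x ∈ S, ψ t x ∈ S) (t : ℝ) {q : ℝ≥0∞}
    {f : EuclideanSpace ℝ (Fin N) → F} (hf : MemLp f q ((μHE[d]).restrict S)) :
    MemLp (fun x => f (ψ t x)) q ((μHE[d]).restrict S) := by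
  obtain ⟨c, hc⟩ := hψ.exists_map_le_smul hL d hinv |t|
  exact (hf.of_measure_le_smul ENNReal.coe_ne_top (hc t le_rfl)).comp_of_map
    (hψ.continuous hL t).aemeasurable

end Flow

/-! ### The change of variables on the domain and on its boundary. -/

section Instances

variable {N : ℕ} {Ω : Set (EuclideanSpace ℝ (Fin N))} {x : EuclideanSpace ℝ (Fin N)}
variable {V ν : EuclideanSpace ℝ (Fin N) → EuclideanSpace ℝ (Fin N)} {K : NNReal}
  {ψ : ℝ → EuclideanSpace ℝ (Fin N) → EuclideanSpace ℝ (Fin N)}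

theorem continuous_divergence (hV : ContDiff ℝ ∞ V) : Continuous (divergence V) := by
  unfold divergence
  have h := hV.continuous_fderiv (by simp)
  exact continuous_finsetSum _ fun i _ =>
    (EuclideanSpace.proj (𝕜 := ℝ) i).continuous.comp (h.clm_apply continuous_const)

theorem continuousOn_tangentialDivergence (hΩ : IsBoundedSmoothDomain Ω)
    (hν : ∀ x ∈ frontier Ω, IsOuterUnitNormal Ω x (ν x)) (hV : ContDiff ℝ ∞ V) :
    ContinuousOn (fun x => tangentialDivergence V (ν x) x) (frontier Ω) := by
  have h := (hV.continuous_fderiv (by simp)).continuousOn (s := frontier Ω)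
  have hc := continuousOn_normal hΩ hν
  exact (continuous_divergence hV).continuousOn.sub ((h.clm_apply hc).inner hc)

theorem IsBoundedSmoothDomain.isCompact_closure (hΩ : IsBoundedSmoothDomain Ω) :
    IsCompact (closure Ω) :=
  hΩ.isBounded.isCompact_closure

theorem IsBoundedSmoothDomain.isCompact_frontier (hΩ : IsBoundedSmoothDomain Ω) :
    IsCompact (frontier Ω) :=
  hΩ.isCompact_closure.of_isClosed_subset isClosed_frontier frontier_subset_closure

theorem volume_restrict_eq (Ω : Set (EuclideanSpace ℝ (Fin N))) :
    volume.restrict Ω = (μHE[N]).restrict Ω := by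
  rw [EuclideanSpace.euclideanHausdorffMeasure_eq_volume]

theorem isTangentAt_frontier (hΩ : IsOpen Ω) {n : EuclideanSpace ℝ (Fin N)}
    (hn : IsOuterUnitNormal Ω x n)
    {ι : EuclideanSpace ℝ (Fin (N - 1)) →ₗᵢ[ℝ] EuclideanSpace ℝ (Fin N)}
    (hι : ∀ w, ι (ContinuousLinearMap.adjoint ι.toContinuousLinearMap w) = w - inner ℝ n w • n) :
    IsTangentAt (frontier Ω) x ι := by
  intro ε hε
  obtain ⟨U, hU, h⟩ := exists_abs_inner_sub_le hΩ hn hε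
  refine ⟨U, hU, fun y hy z hz => ?_⟩
  rw [hι, sub_sub_cancel, norm_smul, hn.norm_eq_one, mul_one]
  exact h y hy z hz

/-- The case `d = N` with the identity as tangent inclusion, so that compression does nothing and
its trace is the full divergence. No separate change of variables for volume is needed. -/
theorem IsFlowOf.hasFirstOrderDistortion_domain (hΩ : IsBoundedSmoothDomain Ω)
    (hν : ∀ x ∈ frontier Ω, IsOuterUnitNormal Ω x (ν x)) (hV : ContDiff ℝ ∞ V)
    (hL : LipschitzWith K V) (hVν : ∀ x ∈ frontier Ω, inner ℝ (V x) (ν x) = 0)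
    (hψ : IsFlowOf V ψ) : HasFirstOrderDistortion ψ (volume.restrict Ω) (divergence V) := by
  obtain ⟨B, hB⟩ := hΩ.isCompact_closure.exists_bound_of_continuousOn
    (continuous_divergence hV).continuousOn
  rw [volume_restrict_eq]
  refine hψ.hasFirstOrderDistortion hV hL N hΩ.isOpen.measurableSet hΩ.isBounded
    (fun t x hx => hψ.mem_domain hΩ hν hV hL hVν hx t) (continuous_divergence hV).continuousOn
    (fun x hx => hB x (subset_closure hx)) fun x _ => ⟨LinearIsometry.id, ?_, ?_⟩
  · intro ε hε
    refine ⟨Set.univ, univ_mem, fun y _ z _ => ?_⟩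
    have h : (ContinuousLinearMap.adjoint (LinearIsometry.id (R := ℝ)
        (E := EuclideanSpace ℝ (Fin N))).toContinuousLinearMap) (y - z) = y - z :=
      adjoint_apply_apply LinearIsometry.id (y - z)
    rw [h]
    simp only [LinearIsometry.id_apply, sub_self, norm_zero]
    positivity
  · have h : compress LinearIsometry.id (fderiv ℝ V x) = fderiv ℝ V x :=
      ContinuousLinearMap.ext fun w => adjoint_apply_apply LinearIsometry.id _
    rw [h]
    exact trace_eq_divergence V x

/-- The case `d = N - 1`: the tangent inclusion has range the orthogonal complement of the normal,
and the compressed trace is the tangential divergence. -/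
theorem IsFlowOf.hasFirstOrderDistortion_boundary (hN : 1 ≤ N) (hΩ : IsBoundedSmoothDomain Ω)
    (hν : ∀ x ∈ frontier Ω, IsOuterUnitNormal Ω x (ν x)) (hV : ContDiff ℝ ∞ V)
    (hL : LipschitzWith K V) (hVν : ∀ x ∈ frontier Ω, inner ℝ (V x) (ν x) = 0)
    (hψ : IsFlowOf V ψ) :
    HasFirstOrderDistortion ψ (surfaceMeasure Ω) (fun x => tangentialDivergence V (ν x) x) := by
  have hc := continuousOn_tangentialDivergence hΩ hν hV
  obtain ⟨B, hB⟩ := hΩ.isCompact_frontier.exists_bound_of_continuousOn hc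
  refine hψ.hasFirstOrderDistortion hV hL (N - 1) isClosed_frontier.measurableSet
    hΩ.isCompact_frontier.isBounded
    (fun t x hx => hψ.mem_frontier hΩ hν hV hL hVν hx t) hc hB fun x hx => ?_
  obtain ⟨ι, hι⟩ := exists_linearIsometry_orthogonal hN (hν x hx).norm_eq_one
  refine ⟨ι, isTangentAt_frontier hΩ.isOpen (hν x hx) hι, ?_⟩
  have h := trace_adjoint_comp ι (fderiv ℝ V x) hι
  have h2 := trace_eq_divergence V x
  rw [h2] at h
  exact h

end Instances

/-! ### The trace inequality for smooth functions. -/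

section TraceInequality

theorem lintegral_rpow_le {X : Type*} [MeasurableSpace X] {μ : Measure X} {p : ℝ} (hp : 1 < p)
    {h : X → ℝ≥0∞} (hh : AEMeasurable h μ) :
    (∫⁻ x, h x ∂μ) ^ p ≤ μ Set.univ ^ (p - 1) * ∫⁻ x, h x ^ p ∂μ := by
  have hpq := Real.HolderConjugate.conjExponent hp
  have hp0 : 0 < p := by linarith
  have h1 := ENNReal.lintegral_mul_le_Lp_mul_Lq μ hpq hh (aemeasurable_const (b := (1 : ℝ≥0∞)))
  simp only [Pi.mul_apply, mul_one, ENNReal.one_rpow, lintegral_const, one_mul] at h1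
  have h2 := ENNReal.rpow_le_rpow h1 hp0.le
  rw [ENNReal.mul_rpow_of_nonneg _ _ hp0.le, ← ENNReal.rpow_mul, ← ENNReal.rpow_mul,
    one_div_mul_cancel hp0.ne', ENNReal.rpow_one, mul_comm] at h2
  have e : 1 / Real.conjExponent p * p = p - 1 := by
    rw [Real.conjExponent]; field_simp
  rwa [e] at h2

/-- With the cutoff `1 - s / r`, which is one at `0` and zero at `r`, the value `g 0` is an integral
of `g` and `g'` by the fundamental theorem of calculus; Hölder's inequality gives the p-th power. -/
theorem exists_enorm_rpow_le_lintegral {p : ℝ} (hp : 1 < p) {r : ℝ} (hr : 0 < r) :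
    ∃ C : NNReal, ∀ g g' : ℝ → ℝ, (∀ s, HasDerivAt g (g' s) s) → Continuous g' →
      ‖g 0‖ₑ ^ p ≤ C * ∫⁻ s in Set.Ioc 0 r, (‖g s‖ₑ ^ p + ‖g' s‖ₑ ^ p) := by
  have hp0 : 0 < p := by linarith
  set c : ℝ≥0∞ := ENNReal.ofReal (max (1 / r) 1) with hc
  have hcp : c ^ p ≠ ⊤ := ENNReal.rpow_ne_top_of_nonneg hp0.le ENNReal.ofReal_ne_top
  have hrp : ENNReal.ofReal r ^ (p - 1) ≠ ⊤ :=
    ENNReal.rpow_ne_top_of_nonneg (by linarith) ENNReal.ofReal_ne_top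
  have h2p : (2 : ℝ≥0∞) ^ (p - 1) ≠ ⊤ :=
    ENNReal.rpow_ne_top_of_nonneg (by linarith) (by simp)
  refine ⟨(c ^ p * (ENNReal.ofReal r ^ (p - 1) * 2 ^ (p - 1))).toNNReal, fun g g' hg hg' => ?_⟩
  rw [ENNReal.coe_toNNReal (by finiteness)]
  have hgc : Continuous g := continuous_iff_continuousAt.2 fun s => (hg s).continuousAt
  have hval : ∫ s in (0 : ℝ)..r, (1 / r * g s - (1 - s / r) * g' s) = g 0 := by
    have hd : ∀ s ∈ Set.uIcc 0 r, HasDerivAt (fun s => -((1 - s / r) * g s))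
        (1 / r * g s - (1 - s / r) * g' s) s := fun s _ => by
      have h1 : HasDerivAt (fun s : ℝ => 1 - s / r) (-(1 / r)) s :=
        ((hasDerivAt_id s).div_const r).const_sub 1
      exact ((h1.mul (hg s)).neg).congr_deriv (by ring)
    rw [intervalIntegral.integral_eq_sub_of_hasDerivAt hd
      (Continuous.intervalIntegrable (by fun_prop) _ _)]
    field_simp
    ring
  have h1 : ‖g 0‖ₑ ≤ ∫⁻ s in Set.Ioc 0 r, c * (‖g s‖ₑ + ‖g' s‖ₑ) := by
    rw [← hval, intervalIntegral.integral_of_le hr.le]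
    refine (enorm_integral_le_lintegral_enorm _).trans
      (setLIntegral_mono' measurableSet_Ioc fun s hs => ?_)
    refine (enorm_sub_le).trans ?_
    rw [enorm_mul, enorm_mul, mul_add]
    refine add_le_add (mul_le_mul_left ?_ _) (mul_le_mul_left ?_ _)
    · rw [Real.enorm_eq_ofReal (by positivity)]
      exact ENNReal.ofReal_le_ofReal (le_max_left _ _)
    · have h3 : s / r ≤ 1 := (div_le_one hr).2 hs.2
      have h4 : 0 ≤ s / r := div_nonneg hs.1.le hr.le
      rw [Real.enorm_eq_ofReal (by linarith)]
      exact ENNReal.ofReal_le_ofReal (le_trans (by linarith) (le_max_right _ _))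
  have hm : Measurable fun s => ‖g s‖ₑ + ‖g' s‖ₑ :=
    hgc.measurable.enorm.add hg'.measurable.enorm
  rw [lintegral_const_mul _ hm] at h1
  refine (ENNReal.rpow_le_rpow h1 hp0.le).trans ?_
  rw [ENNReal.mul_rpow_of_nonneg _ _ hp0.le, mul_assoc]
  refine mul_le_mul_right ((lintegral_rpow_le hp hm.aemeasurable).trans ?_) _
  rw [Measure.restrict_apply_univ, Real.volume_Ioc, sub_zero, mul_assoc]
  refine mul_le_mul_right ?_ _
  rw [← lintegral_const_mul' _ _ h2p]
  exact lintegral_mono fun s => ENNReal.rpow_add_le_mul_rpow_add_rpow _ _ hp.le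

variable {N : ℕ} {Ω : Set (EuclideanSpace ℝ (Fin N))} {x n : EuclideanSpace ℝ (Fin N)}

/-- By strict differentiability at `x`, the single direction `-n` points inward at all nearby
boundary points, with one common length `r`. -/
theorem exists_nhds_sub_smul_mem (hΩ : IsOpen Ω) (hn : IsOuterUnitNormal Ω x n) :
    ∃ r : ℝ, 0 < r ∧ ∃ U ∈ 𝓝 x, ∀ y ∈ frontier Ω ∩ U, ∀ s ∈ Set.Ioc 0 r, y - s • n ∈ Ω := by
  have hn1 := hn.norm_eq_one
  obtain ⟨ρ, hρ, hnρ⟩ := hn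
  have hg : 0 < ‖gradient ρ x‖ := norm_pos_iff.2 hρ.gradient_ne_zero
  have h1 := (hρ.hasStrictFDerivAt x).isLittleO.def (half_pos hg)
  rw [nhds_prod_eq] at h1
  obtain ⟨U, hU, hUU⟩ := mem_prod_self_iff.1 h1
  obtain ⟨δ, hδ, hδU⟩ := Metric.mem_nhds_iff.1 (inter_mem hU
    (inter_mem (hρ.eventually_eq_zero hΩ) hρ.eventually_mem_iff))
  refine ⟨δ / 4, by positivity, Metric.ball x (δ / 4), Metric.ball_mem_nhds _ (by positivity),
    fun y hy s hs => ?_⟩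
  have hy1 := hy.2
  rw [Metric.mem_ball, dist_eq_norm] at hy1
  have hsn : ‖s • n‖ = s := by rw [norm_smul, hn1, mul_one, Real.norm_eq_abs, abs_of_pos hs.1]
  have hyU := hδU (show y ∈ Metric.ball x δ by rw [Metric.mem_ball, dist_eq_norm]; linarith)
  have hzU := hδU (show y - s • n ∈ Metric.ball x δ by
    rw [Metric.mem_ball, dist_eq_norm]
    have h2 := norm_sub_le (y - x) (s • n)
    have e : y - s • n - x = y - x - s • n := by abel
    rw [e]
    linarith [hs.2])
  refine hzU.2.2.2 ?_
  have h2 := hUU (Set.mk_mem_prod hzU.1 hyU.1)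
  have h0 : ρ y = 0 := hyU.2.1 hy.1
  have h3 : fderiv ℝ ρ x (y - s • n - y) = -(s * ‖gradient ρ x‖) := by
    rw [← inner_gradient_left, sub_sub_cancel_left, inner_neg_right, inner_smul_right, hnρ,
      inner_smul_right, real_inner_self_eq_norm_sq]
    field_simp
  simp only [Set.mem_ofPred_eq, h0, h3, sub_zero] at h2
  rw [sub_sub_cancel_left, norm_neg, hsn, Real.norm_eq_abs] at h2
  have h4 := (abs_le.1 h2).2
  have h5 : 0 < s * ‖gradient ρ x‖ := mul_pos hs.1 hg
  linarith

/-- The map `(v, τ) ↦ ι v + τ • n` is a linear isomorphism, so it carries product Lebesgue measure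
to a Haar measure. The value of the scalar factor is irrelevant for the trace inequality and is not
computed. -/
theorem exists_lintegral_slices_le {ι : EuclideanSpace ℝ (Fin (N - 1)) →ₗᵢ[ℝ] EuclideanSpace ℝ (Fin N)}
    (hn : ‖n‖ = 1)
    (hι : ∀ w, ι (ContinuousLinearMap.adjoint ι.toContinuousLinearMap w) = w - inner ℝ n w • n) :
    ∃ C : NNReal, ∀ h : EuclideanSpace ℝ (Fin N) → ℝ≥0∞, Measurable h →
      ∫⁻ v, ∫⁻ τ : ℝ, h (ι v + τ • n) ≤ C * ∫⁻ w, h w := by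
  have hPn : ContinuousLinearMap.adjoint ι.toContinuousLinearMap n = 0 := by
    apply ι.injective
    rw [hι, real_inner_self_eq_norm_sq, hn, map_zero]
    simp
  have hnι : ∀ v, inner ℝ n (ι v) = 0 := fun v => by
    have := ContinuousLinearMap.adjoint_inner_left ι.toContinuousLinearMap v n
    rw [hPn, inner_zero_left] at this
    exact this.symm
  let Λ : (EuclideanSpace ℝ (Fin (N - 1)) × ℝ) ≃ₗ[ℝ] EuclideanSpace ℝ (Fin N) :=
    { toFun := fun z => ι z.1 + z.2 • n
      map_add' := fun a b => by simp only [Prod.fst_add, Prod.snd_add, map_add, add_smul]; abel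
      map_smul' := fun c a => by
        simp only [Prod.smul_fst, Prod.smul_snd, map_smul, smul_add, smul_smul, smul_eq_mul,
          RingHom.id_apply]
      invFun := fun w =>
        (ContinuousLinearMap.adjoint ι.toContinuousLinearMap w, inner ℝ n w)
      left_inv := fun z => by
        refine Prod.ext ?_ ?_
        · simp only [map_add, map_smul, hPn, smul_zero, add_zero]
          exact adjoint_apply_apply ι z.1
        · simp only [inner_add_right, inner_smul_right, hnι, real_inner_self_eq_norm_sq, hn]
          ring
      right_inv := fun w => by simp only [hι, sub_add_cancel] }
  let Λc := Λ.toContinuousLinearEquiv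
  have hhaar : ((volume : Measure (EuclideanSpace ℝ (Fin (N - 1)))).prod
      (volume : Measure ℝ)).map Λc |>.IsAddHaarMeasure :=
    ContinuousLinearEquiv.isAddHaarMeasure_map Λc _
  have heq := Measure.isAddLeftInvariant_eq_smul (((volume : Measure (EuclideanSpace ℝ
    (Fin (N - 1)))).prod (volume : Measure ℝ)).map Λc) volume
  refine ⟨Measure.addHaarScalarFactor (((volume : Measure (EuclideanSpace ℝ
      (Fin (N - 1)))).prod (volume : Measure ℝ)).map Λc) volume, fun h hh => ?_⟩
  have h1 : ∫⁻ w, h w ∂(((volume : Measure (EuclideanSpace ℝ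
      (Fin (N - 1)))).prod (volume : Measure ℝ)).map Λc) = ∫⁻ v, ∫⁻ τ : ℝ, h (ι v + τ • n) := by
    rw [lintegral_map hh Λc.continuous.measurable,
      lintegral_prod (fun a => h (Λc a)) (hh.comp Λc.continuous.measurable).aemeasurable]
    rfl
  have h2 : ∫⁻ w, h w ∂(((volume : Measure (EuclideanSpace ℝ
      (Fin (N - 1)))).prod (volume : Measure ℝ)).map Λc) =
      (Measure.addHaarScalarFactor (((volume : Measure (EuclideanSpace ℝ
        (Fin (N - 1)))).prod (volume : Measure ℝ)).map Λc) volume : ℝ≥0∞) * ∫⁻ w, h w := by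
    conv_lhs => rw [heq]
    rw [lintegral_smul_measure]
    rfl
  exact (h1.symm.trans h2).le

/-- The lower Lipschitz bound on the projection says that `A` is a Lipschitz graph over the tangent
space, so the push-forward of its Hausdorff measure is at most `L ^ d` times Lebesgue measure. -/
theorem lintegral_comp_adjoint_le {d : ℕ}
    {ι : EuclideanSpace ℝ (Fin d) →ₗᵢ[ℝ] EuclideanSpace ℝ (Fin N)}
    {A : Set (EuclideanSpace ℝ (Fin N))} {L : ℝ} (hL : 0 ≤ L)
    (h : ∀ y ∈ A, ∀ z ∈ A,
      ‖y - z‖ ≤ L * ‖ContinuousLinearMap.adjoint ι.toContinuousLinearMap (y - z)‖)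
    {H : EuclideanSpace ℝ (Fin d) → ℝ≥0∞} (hH : Measurable H) :
    ∫⁻ y in A, H (ContinuousLinearMap.adjoint ι.toContinuousLinearMap y) ∂μHE[d] ≤
      ENNReal.ofReal (L ^ d) * ∫⁻ v, H v := by
  set P := ContinuousLinearMap.adjoint ι.toContinuousLinearMap with hP
  have hPm : Measurable fun y => P y := P.continuous.measurable
  have hle : ((μHE[d]).restrict A).map (fun y => P y) ≤ ENNReal.ofReal (L ^ d) • volume := by
    refine Measure.le_iff.2 fun B hB => ?_
    rw [Measure.map_apply hPm hB, Measure.restrict_apply (hPm hB), Measure.smul_apply, smul_eq_mul]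
    have h1 : μHE[d] ((fun y => y) '' ((fun y => P y) ⁻¹' B ∩ A)) ≤ ENNReal.ofReal (L ^ d) *
        μHE[d] ((fun y => P y) '' ((fun y => P y) ⁻¹' B ∩ A)) := by
      refine euclideanHausdorffMeasure_image_le_of_dist_le d hL fun y hy z hz => ?_
      rw [dist_eq_norm, dist_eq_norm, ← map_sub]
      exact h y hy.2 z hz.2
    rw [Set.image_id'] at h1
    refine h1.trans (mul_le_mul_right ?_ _)
    rw [EuclideanSpace.euclideanHausdorffMeasure_eq_volume]
    refine measure_mono ?_
    rintro _ ⟨y, hy, rfl⟩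
    exact hy.1
  rw [← lintegral_map hH hPm]
  refine (lintegral_mono' hle le_rfl).trans ?_
  rw [lintegral_smul_measure, smul_eq_mul]

/-- Without flattening the boundary, every boundary point is slid inward along the normal `n` of the
base point. The one-dimensional estimate holds on each segment, and Fubini over the hyperplane
orthogonal to `n` assembles them. -/
theorem exists_local_trace_inequality (hN : 1 ≤ N) (hΩ : IsOpen Ω) {p : ℝ} (hp : 1 < p)
    (hn : IsOuterUnitNormal Ω x n) :
    ∃ U ∈ 𝓝 x, ∃ C : NNReal, ∀ φ : EuclideanSpace ℝ (Fin N) → ℝ, ContDiff ℝ ∞ φ →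
      ∫⁻ y in frontier Ω ∩ U, ‖φ y‖ₑ ^ p ∂μHE[N - 1] ≤
        C * ∫⁻ y in Ω, (‖φ y‖ₑ ^ p + ‖gradient φ y‖ₑ ^ p) := by
  have hn1 := hn.norm_eq_one
  obtain ⟨ι, hι⟩ := exists_linearIsometry_orthogonal hN hn1
  obtain ⟨r, hr, U₁, hU₁, hmem⟩ := exists_nhds_sub_smul_mem hΩ hn
  obtain ⟨U₂, hU₂, hsec⟩ := exists_abs_inner_sub_le hΩ hn (ε := 1 / 2) (by norm_num)
  obtain ⟨C₁, hC₁⟩ := exists_enorm_rpow_le_lintegral hp hr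
  obtain ⟨C₂, hC₂⟩ := exists_lintegral_slices_le hn1 hι
  obtain ⟨U, hUs, hUo, hxU⟩ := mem_nhds_iff.1 (inter_mem hU₁ hU₂)
  refine ⟨U, hUo.mem_nhds hxU, C₁ * (Real.toNNReal (2 ^ (N - 1)) * C₂), fun φ hφ => ?_⟩
  set F : EuclideanSpace ℝ (Fin N) → ℝ≥0∞ := fun y => ‖φ y‖ₑ ^ p + ‖gradient φ y‖ₑ ^ p with hF
  have hgc := continuous_gradient hφ
  have hFm : Measurable F :=
    (hφ.continuous.measurable.enorm.pow_const p).add (hgc.measurable.enorm.pow_const p)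
  have hAm : MeasurableSet (frontier Ω ∩ U) := isClosed_frontier.measurableSet.inter
    hUo.measurableSet
  set h := Ω.indicator F with hh
  have hhm : Measurable h := hFm.indicator hΩ.measurableSet
  set H : EuclideanSpace ℝ (Fin (N - 1)) → ℝ≥0∞ := fun v => ∫⁻ τ : ℝ, h (ι v + τ • n) with hH
  have hHm : Measurable H := by
    refine Measurable.lintegral_prod_right' (f := fun z : EuclideanSpace ℝ (Fin (N - 1)) × ℝ =>
      h (ι z.1 + z.2 • n)) (hhm.comp ?_)
    exact ((ι.continuous.comp continuous_fst).add (continuous_snd.smul continuous_const)).measurable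
  -- The segment from `y` lies in `Ω`, so it may be enlarged to the whole line once the integrand is
  -- cut off outside `Ω`; that line depends only on the projection of `y`, and so does its integral
  -- `H`.
  have hpt : ∀ y ∈ frontier Ω ∩ U, ‖φ y‖ₑ ^ p ≤
      C₁ * H (ContinuousLinearMap.adjoint ι.toContinuousLinearMap y) := by
    intro y hy
    have hline : ∀ s : ℝ, HasDerivAt (fun s : ℝ => y - s • n) (-n) s := fun s => by
      simpa using ((hasDerivAt_id s).smul_const n).const_sub y
    have hd : ∀ s : ℝ, HasDerivAt (fun s : ℝ => φ (y - s • n)) (fderiv ℝ φ (y - s • n) (-n)) s :=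
      fun s => ((hφ.differentiable (by simp)) (y - s • n)).hasFDerivAt.comp_hasDerivAt s (hline s)
    have hlc : Continuous fun s : ℝ => y - s • n := by fun_prop
    have h1 := hC₁ _ _ hd (((hφ.continuous_fderiv (by simp)).comp hlc).clm_apply continuous_const)
    rw [zero_smul, sub_zero] at h1
    refine h1.trans (mul_le_mul_right ?_ _)
    calc _ ≤ ∫⁻ s in Set.Ioc 0 r, h (y - s • n) := by
          refine setLIntegral_mono' measurableSet_Ioc fun s hs => ?_
          rw [hh, Set.indicator_of_mem (hmem y ⟨hy.1, (hUs hy.2).1⟩ s hs)]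
          refine add_le_add le_rfl (ENNReal.rpow_le_rpow ?_ (by linarith))
          refine enorm_le_iff_norm_le.2 ?_
          rw [norm_gradient]
          refine (ContinuousLinearMap.le_opNorm _ _).trans ?_
          rw [norm_neg, hn1, mul_one]
      _ ≤ ∫⁻ s : ℝ, h (y - s • n) := setLIntegral_le_lintegral _ _
      _ = ∫⁻ s : ℝ, h (y - inner ℝ n y • n + (inner ℝ n y - s) • n) := by
          refine lintegral_congr fun s => ?_
          congr 1
          rw [sub_smul]; abel
      _ = ∫⁻ τ : ℝ, h (y - inner ℝ n y • n + τ • n) :=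
          lintegral_sub_left_eq_self (fun τ : ℝ => h (y - inner ℝ n y • n + τ • n)) (inner ℝ n y)
      _ = _ := by rw [hH]; simp only [hι]
  have hsec2 : ∀ y ∈ frontier Ω ∩ U, ∀ z ∈ frontier Ω ∩ U,
      ‖y - z‖ ≤ 2 * ‖ContinuousLinearMap.adjoint ι.toContinuousLinearMap (y - z)‖ := by
    intro y hy z hz
    have h1 := hsec y ⟨hy.1, (hUs hy.2).2⟩ z ⟨hz.1, (hUs hz.2).2⟩
    have h2 : ‖y - z‖ ≤ ‖ι (ContinuousLinearMap.adjoint ι.toContinuousLinearMap (y - z))‖ +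
        ‖inner ℝ n (y - z) • n‖ := by
      have := norm_add_le (ι (ContinuousLinearMap.adjoint ι.toContinuousLinearMap (y - z)))
        (inner ℝ n (y - z) • n)
      rwa [hι, sub_add_cancel, ← hι] at this
    rw [ι.norm_map, norm_smul, hn1, mul_one, Real.norm_eq_abs] at h2
    linarith
  calc ∫⁻ y in frontier Ω ∩ U, ‖φ y‖ₑ ^ p ∂μHE[N - 1]
      ≤ ∫⁻ y in frontier Ω ∩ U,
          C₁ * H (ContinuousLinearMap.adjoint ι.toContinuousLinearMap y) ∂μHE[N - 1] :=
        setLIntegral_mono' hAm hpt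
    _ = C₁ * ∫⁻ y in frontier Ω ∩ U,
          H (ContinuousLinearMap.adjoint ι.toContinuousLinearMap y) ∂μHE[N - 1] :=
        lintegral_const_mul' _ _ ENNReal.coe_ne_top
    _ ≤ C₁ * (ENNReal.ofReal (2 ^ (N - 1)) * ∫⁻ v, H v) :=
        mul_le_mul_right (lintegral_comp_adjoint_le zero_le_two hsec2 hHm) _
    _ ≤ C₁ * (ENNReal.ofReal (2 ^ (N - 1)) * (C₂ * ∫⁻ w, h w)) :=
        mul_le_mul_right (mul_le_mul_right (hC₂ h hhm) _) _
    _ = _ := by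
        rw [hh, lintegral_indicator hΩ.measurableSet, ENNReal.coe_mul, ENNReal.coe_mul,
          mul_assoc, mul_assoc]
        rfl

theorem exists_trace_inequality (hN : 1 ≤ N) (hΩ : IsBoundedSmoothDomain Ω) {p : ℝ} (hp : 1 < p) :
    ∃ C : NNReal, ∀ φ : EuclideanSpace ℝ (Fin N) → ℝ, ContDiff ℝ ∞ φ →
      ∫⁻ y, ‖φ y‖ₑ ^ p ∂surfaceMeasure Ω ≤
        C * ∫⁻ y in Ω, (‖φ y‖ₑ ^ p + ‖gradient φ y‖ₑ ^ p) := by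
  have key : ∃ C : NNReal, ∀ φ : EuclideanSpace ℝ (Fin N) → ℝ, ContDiff ℝ ∞ φ →
      ∫⁻ y in frontier Ω ∩ frontier Ω, ‖φ y‖ₑ ^ p ∂μHE[N - 1] ≤
        C * ∫⁻ y in Ω, (‖φ y‖ₑ ^ p + ‖gradient φ y‖ₑ ^ p) := by
    refine hΩ.isCompact_frontier.induction_on (p := fun s => ∃ C : NNReal,
      ∀ φ : EuclideanSpace ℝ (Fin N) → ℝ, ContDiff ℝ ∞ φ →
      ∫⁻ y in frontier Ω ∩ s, ‖φ y‖ₑ ^ p ∂μHE[N - 1] ≤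
        C * ∫⁻ y in Ω, (‖φ y‖ₑ ^ p + ‖gradient φ y‖ₑ ^ p)) ?_ ?_ ?_ ?_
    · exact ⟨0, fun φ _ => by simp⟩
    · rintro s t hst ⟨C, hC⟩
      exact ⟨C, fun φ hφ => (lintegral_mono_set (Set.inter_subset_inter_right _ hst)).trans
        (hC φ hφ)⟩
    · rintro s t ⟨C, hC⟩ ⟨C', hC'⟩
      refine ⟨C + C', fun φ hφ => ?_⟩
      rw [Set.inter_union_distrib_left, ENNReal.coe_add, add_mul]
      exact (lintegral_union_le _ _ _).trans (add_le_add (hC φ hφ) (hC' φ hφ))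
    · intro x hx
      obtain ⟨ρ, hρ⟩ := hΩ.smooth_boundary x hx
      obtain ⟨U, hU, C, hC⟩ := exists_local_trace_inequality hN hΩ.isOpen hp ⟨ρ, hρ, rfl⟩
      exact ⟨U, mem_nhdsWithin_of_mem_nhds hU, C, hC⟩
  rw [Set.inter_self] at key
  exact key

/-- The trace inequality applied to the constant function one, whose right side is a multiple of the
finite volume of `Ω`. -/
theorem isFiniteMeasure_surfaceMeasure (hN : 1 ≤ N) (hΩ : IsBoundedSmoothDomain Ω) :
    IsFiniteMeasure (surfaceMeasure Ω) := by
  obtain ⟨C, hC⟩ := exists_trace_inequality hN hΩ one_lt_two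
  have h := hC (fun _ => 1) contDiff_const
  have hg : ∀ y, gradient (fun _ : EuclideanSpace ℝ (Fin N) => (1 : ℝ)) y = 0 := fun y => by
    rw [← norm_eq_zero, norm_gradient]; simp
  simp only [hg, enorm_one, ENNReal.one_rpow, lintegral_const, one_mul, enorm_zero] at h
  rw [ENNReal.zero_rpow_of_pos two_pos, add_zero, one_mul, Measure.restrict_apply_univ] at h
  exact ⟨h.trans_lt (ENNReal.mul_lt_top ENNReal.coe_lt_top hΩ.isBounded.measure_lt_top)⟩

end TraceInequality

/-! ### Duality pairings between Lebesgue spaces. -/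

section Pairing

variable {α : Type*} [MeasurableSpace α] {p : ℝ}

theorem exists_pairing (hp : 1 < p) [Fact (1 ≤ ENNReal.ofReal p)]
    [Fact (1 ≤ ENNReal.ofReal (p / (p - 1)))] (W : Type*) [NormedAddCommGroup W]
    [InnerProductSpace ℝ W] (μ : Measure α) :
    ∃ Λ : Lp W (ENNReal.ofReal (p / (p - 1))) μ →L[ℝ] Lp W (ENNReal.ofReal p) μ →L[ℝ] ℝ,
      ∀ k g, Λ k g = ∫ x, inner ℝ (k x) (g x) ∂μ := by
  have h : (ENNReal.ofReal (p / (p - 1))).HolderConjugate (ENNReal.ofReal p) :=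
    (Real.HolderConjugate.conjExponent hp).symm.ennrealOfReal
  let B : W →L[ℝ] W →L[ℝ] ℝ :=
    (isBoundedBilinearMap_inner (𝕜 := ℝ) (E := W)).toContinuousLinearMap
  exact ⟨B.lpPairing μ _ _, fun k g => B.lpPairing_eq_integral k g⟩

theorem exists_pairing_of_memLp (hp : 1 < p) [Fact (1 ≤ ENNReal.ofReal p)] {W : Type*}
    [NormedAddCommGroup W] [InnerProductSpace ℝ W] {μ : Measure α} {k : α → W}
    (hk : MemLp k (ENNReal.ofReal (p / (p - 1))) μ) :
    ∃ l : Lp W (ENNReal.ofReal p) μ →L[ℝ] ℝ, ∀ g : Lp W (ENNReal.ofReal p) μ,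
      l g = ∫ x, inner ℝ (k x) (g x) ∂μ := by
  have hq : 1 < p / (p - 1) := by rw [one_lt_div (by linarith)]; linarith
  have := one_le_ofReal_of_one_lt hq
  obtain ⟨Λ, hΛ⟩ := exists_pairing hp W μ
  refine ⟨Λ (hk.toLp k), fun g => ?_⟩
  rw [hΛ]
  refine integral_congr_ae ?_
  filter_upwards [hk.coeFn_toLp] with x hx
  rw [hx]

theorem memLp_of_continuous {X : Type*} [TopologicalSpace X] [MeasurableSpace X]
    [OpensMeasurableSpace X] {W : Type*} [NormedAddCommGroup W] [SecondCountableTopology W]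
    {μ : Measure X} [IsFiniteMeasure μ] {K : Set X} (hK : IsCompact K)
    (hμ : ∀ᵐ x ∂μ, x ∈ K) {f : X → W} (hf : Continuous f) (q : ℝ≥0∞) : MemLp f q μ := by
  obtain ⟨C, hC⟩ := hK.exists_bound_of_continuousOn hf.continuousOn
  borelize W
  exact MemLp.of_bound hf.measurable.aestronglyMeasurable C (hμ.mono fun x hx => hC x hx)

theorem lintegral_enorm_rpow_eq {W : Type*} [NormedAddCommGroup W] {μ : Measure α} (hp : 0 < p)
    {a : α → W} (ha : MemLp a (ENNReal.ofReal p) μ) :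
    ∫⁻ x, ‖a x‖ₑ ^ p ∂μ = ENNReal.ofReal (∫ x, ‖a x‖ ^ p ∂μ) := by
  rw [ofReal_integral_eq_lintegral_ofReal (integrable_norm_rpow_of_memLp hp ha)
    (ae_of_all _ fun x => by positivity)]
  refine lintegral_congr fun x => ?_
  rw [← ofReal_norm, ENNReal.ofReal_rpow_of_nonneg (norm_nonneg _) hp.le]

end Pairing

/-! ### The space of Sobolev functions with gradients and traces. -/

section TraceSpace

variable {N : ℕ} {p : ℝ} {Ω : Set (EuclideanSpace ℝ (Fin N))}

theorem ae_mem_closure (hΩ : IsBoundedSmoothDomain Ω) :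
    ∀ᵐ x ∂(volume.restrict Ω), x ∈ closure Ω :=
  (ae_restrict_mem hΩ.isOpen.measurableSet).mono fun _ hx => subset_closure hx

theorem ae_mem_frontier (Ω : Set (EuclideanSpace ℝ (Fin N))) :
    ∀ᵐ x ∂(surfaceMeasure Ω), x ∈ frontier Ω :=
  ae_restrict_mem isClosed_frontier.measurableSet

theorem isFiniteMeasure_domain (hΩ : IsBoundedSmoothDomain Ω) :
    IsFiniteMeasure (volume.restrict Ω) :=
  ⟨by rw [Measure.restrict_apply_univ]; exact hΩ.isBounded.measure_lt_top⟩

theorem memLp_domain_of_continuous {W : Type*} [NormedAddCommGroup W] [SecondCountableTopology W]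
    (hΩ : IsBoundedSmoothDomain Ω) {f : EuclideanSpace ℝ (Fin N) → W} (hf : Continuous f)
    (q : ℝ≥0∞) : MemLp f q (volume.restrict Ω) :=
  have := isFiniteMeasure_domain hΩ
  memLp_of_continuous hΩ.isCompact_closure (ae_mem_closure hΩ) hf q

theorem memLp_boundary_of_continuous (hN : 1 ≤ N) (hΩ : IsBoundedSmoothDomain Ω)
    {f : EuclideanSpace ℝ (Fin N) → ℝ} (hf : Continuous f) (q : ℝ≥0∞) :
    MemLp f q (surfaceMeasure Ω) :=
  have := isFiniteMeasure_surfaceMeasure hN hΩ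
  memLp_of_continuous hΩ.isCompact_frontier (ae_mem_frontier Ω) hf q

theorem gradient_add {φ χ : EuclideanSpace ℝ (Fin N) → ℝ} (hφ : ContDiff ℝ ∞ φ)
    (hχ : ContDiff ℝ ∞ χ) (x : EuclideanSpace ℝ (Fin N)) :
    gradient (fun y => φ y + χ y) x = gradient φ x + gradient χ x := by
  unfold gradient
  rw [fderiv_fun_add (hφ.differentiable (by simp) x) (hχ.differentiable (by simp) x), map_add]

theorem gradient_const_mul {φ : EuclideanSpace ℝ (Fin N) → ℝ} (hφ : ContDiff ℝ ∞ φ) (c : ℝ)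
    (x : EuclideanSpace ℝ (Fin N)) :
    gradient (fun y => c * φ y) x = c • gradient φ x := by
  unfold gradient
  rw [fderiv_const_mul (hφ.differentiable (by simp) x), map_smul]

theorem gradient_zero (x : EuclideanSpace ℝ (Fin N)) :
    gradient (fun _ : EuclideanSpace ℝ (Fin N) => (0 : ℝ)) x = 0 := by
  rw [← norm_eq_zero, norm_gradient]; simp

variable [Fact (1 ≤ ENNReal.ofReal p)]

/-- Triples: function, gradient, boundary values. -/
abbrev Triple {N : ℕ} (p : ℝ) (Ω : Set (EuclideanSpace ℝ (Fin N))) : Type :=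
  Lp ℝ (ENNReal.ofReal p) (volume.restrict Ω) ×
    Lp (EuclideanSpace ℝ (Fin N)) (ENNReal.ofReal p) (volume.restrict Ω) ×
      Lp ℝ (ENNReal.ofReal p) (surfaceMeasure Ω)

/-- The triples given by smooth functions. -/
def smoothTriples (p : ℝ) [Fact (1 ≤ ENNReal.ofReal p)] (Ω : Set (EuclideanSpace ℝ (Fin N))) :
    Submodule ℝ (Triple p Ω) where
  carrier := {U | ∃ φ : EuclideanSpace ℝ (Fin N) → ℝ, ContDiff ℝ ∞ φ ∧
    U.1 =ᵐ[volume.restrict Ω] φ ∧ U.2.1 =ᵐ[volume.restrict Ω] gradient φ ∧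
      U.2.2 =ᵐ[surfaceMeasure Ω] φ}
  zero_mem' := ⟨fun _ => 0, contDiff_const, Lp.coeFn_zero _ _ _, by
    filter_upwards [Lp.coeFn_zero (EuclideanSpace ℝ (Fin N)) (ENNReal.ofReal p)
      (volume.restrict Ω)] with x hx
    rw [gradient_zero]
    exact hx, Lp.coeFn_zero _ _ _⟩
  add_mem' := by
    rintro U U' ⟨φ, hφ, h1, h2, h3⟩ ⟨χ, hχ, k1, k2, k3⟩
    refine ⟨fun y => φ y + χ y, hφ.add hχ, ?_, ?_, ?_⟩
    · filter_upwards [Lp.coeFn_add U.1 U'.1, h1, k1] with x e a b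
      rw [Prod.fst_add, e, Pi.add_apply, a, b]
    · filter_upwards [Lp.coeFn_add U.2.1 U'.2.1, h2, k2] with x e a b
      rw [Prod.snd_add, Prod.fst_add, e, Pi.add_apply, a, b, gradient_add hφ hχ]
    · filter_upwards [Lp.coeFn_add U.2.2 U'.2.2, h3, k3] with x e a b
      rw [Prod.snd_add, Prod.snd_add, e, Pi.add_apply, a, b]
  smul_mem' := by
    rintro c U ⟨φ, hφ, h1, h2, h3⟩
    refine ⟨fun y => c * φ y, contDiff_const.mul hφ, ?_, ?_, ?_⟩
    · filter_upwards [Lp.coeFn_smul c U.1, h1] with x e a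
      rw [Prod.smul_fst, e, Pi.smul_apply, a, smul_eq_mul]
    · filter_upwards [Lp.coeFn_smul c U.2.1, h2] with x e a
      rw [Prod.smul_snd, Prod.smul_fst, e, Pi.smul_apply, a, gradient_const_mul hφ]
    · filter_upwards [Lp.coeFn_smul c U.2.2, h3] with x e a
      rw [Prod.smul_snd, Prod.smul_snd, e, Pi.smul_apply, a, smul_eq_mul]

/-- The space of functions in `W^{1,p}` with their gradients and traces. -/
def traceSpace (p : ℝ) [Fact (1 ≤ ENNReal.ofReal p)] (Ω : Set (EuclideanSpace ℝ (Fin N))) :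
    Submodule ℝ (Triple p Ω) :=
  (smoothTriples p Ω).topologicalClosure

theorem isClosed_traceSpace : IsClosed (traceSpace p Ω : Set (Triple p Ω)) :=
  (smoothTriples p Ω).isClosed_topologicalClosure

/-- A property that holds for smooth functions and is closed holds in the whole space. -/
theorem traceSpace_induction {P : Triple p Ω → Prop} (hP : IsClosed {U | P U})
    (h : ∀ U ∈ smoothTriples p Ω, P U) {U : Triple p Ω} (hU : U ∈ traceSpace p Ω) : P U :=
  closure_minimal (s := (smoothTriples p Ω : Set (Triple p Ω))) h hP hU

theorem powerEnergy_eq_integral (hp : 0 < p) (U : Triple p Ω) :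
    powerEnergy p U = (∫ x in Ω, |U.1 x| ^ p) + ∫ x in Ω, ‖U.2.1 x‖ ^ p := by
  unfold powerEnergy
  rw [norm_rpow_eq_integral hp, norm_rpow_eq_integral hp]
  rfl

/-- A closed condition, known for smooth functions. It is the bound on the third component that the
abstract minimization requires. -/
theorem exists_norm_trace_rpow_le (hN : 1 ≤ N) (hΩ : IsBoundedSmoothDomain Ω) (hp : 1 < p) :
    ∃ C : ℝ, 0 ≤ C ∧ ∀ U ∈ traceSpace p Ω, ‖U.2.2‖ ^ p ≤ C * powerEnergy p U := by
  have hp0 : 0 < p := by linarith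
  obtain ⟨C, hC⟩ := exists_trace_inequality hN hΩ hp
  refine ⟨C, C.2, fun U hU => ?_⟩
  refine traceSpace_induction (P := fun U => ‖U.2.2‖ ^ p ≤ (C : ℝ) * powerEnergy p U) ?_ ?_ hU
  · refine isClosed_le ?_ (continuous_const.mul (continuous_powerEnergy hp0.le))
    exact Continuous.rpow_const (by fun_prop) fun _ => Or.inr hp0.le
  · rintro U ⟨φ, hφ, h1, h2, h3⟩
    have m1 := memLp_domain_of_continuous hΩ hφ.continuous (ENNReal.ofReal p)
    have m2 := memLp_domain_of_continuous hΩ (continuous_gradient hφ) (ENNReal.ofReal p)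
    have m3 := memLp_boundary_of_continuous hN hΩ hφ.continuous (ENNReal.ofReal p)
    have hle := hC φ hφ
    have i1 : 0 ≤ ∫ x in Ω, ‖φ x‖ ^ p := integral_nonneg fun x => by positivity
    have i2 : 0 ≤ ∫ x in Ω, ‖gradient φ x‖ ^ p := integral_nonneg fun x => by positivity
    rw [lintegral_add_left (hφ.continuous.measurable.enorm.pow_const p),
      lintegral_enorm_rpow_eq hp0 m1, lintegral_enorm_rpow_eq hp0 m2,
      lintegral_enorm_rpow_eq hp0 m3, ← ENNReal.ofReal_add i1 i2, ← ENNReal.ofReal_coe_nnreal,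
      ← ENNReal.ofReal_mul C.coe_nonneg, ENNReal.ofReal_le_ofReal_iff (by positivity)] at hle
    rw [powerEnergy_eq_integral hp0, norm_rpow_eq_integral hp0]
    refine le_trans (le_of_eq ?_) (hle.trans (le_of_eq ?_))
    · refine integral_congr_ae ?_
      filter_upwards [h3] with x hx
      rw [hx]
    · congr 2
      · refine integral_congr_ae ?_
        filter_upwards [h1] with x hx
        rw [hx, Real.norm_eq_abs]
      · refine integral_congr_ae ?_
        filter_upwards [h2] with x hx
        rw [hx]

/-- For each test function and direction the defining identity equates two continuous linear
functionals of the triple. -/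
theorem isClosed_hasWeakGradient (hΩ : IsBoundedSmoothDomain Ω) (hp : 1 < p) :
    IsClosed {U : Triple p Ω | HasWeakGradient Ω U.1 U.2.1} := by
  have hset : {U : Triple p Ω | HasWeakGradient Ω U.1 U.2.1} =
      ⋂ (φ : EuclideanSpace ℝ (Fin N) → ℝ) (_ : ContDiff ℝ ∞ φ) (_ : HasCompactSupport φ)
        (_ : tsupport φ ⊆ Ω) (e : EuclideanSpace ℝ (Fin N)),
        {U : Triple p Ω | ∫ x in Ω, U.1 x * fderiv ℝ φ x e =
          - ∫ x in Ω, φ x * inner ℝ (U.2.1 x) e} := by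
    ext U
    simp only [Set.mem_iInter]
    rfl
  rw [hset]
  refine isClosed_iInter fun φ => isClosed_iInter fun hφ => isClosed_iInter fun hc =>
    isClosed_iInter fun hs => isClosed_iInter fun e => ?_
  have c1 : Continuous fun x => fderiv ℝ φ x e :=
    (hφ.continuous_fderiv (by simp)).clm_apply continuous_const
  have c2 : Continuous fun x => φ x • e := hφ.continuous.smul continuous_const
  obtain ⟨l₁, hl₁⟩ := exists_pairing_of_memLp hp
    (memLp_domain_of_continuous hΩ c1 (ENNReal.ofReal (p / (p - 1))))
  obtain ⟨l₂, hl₂⟩ := exists_pairing_of_memLp hp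
    (memLp_domain_of_continuous hΩ c2 (ENNReal.ofReal (p / (p - 1))))
  have heq : {U : Triple p Ω | ∫ x in Ω, U.1 x * fderiv ℝ φ x e =
      - ∫ x in Ω, φ x * inner ℝ (U.2.1 x) e} = {U : Triple p Ω | l₁ U.1 = - l₂ U.2.1} := by
    ext U
    have e1 : l₁ U.1 = ∫ x in Ω, U.1 x * fderiv ℝ φ x e := by
      rw [hl₁]; rfl
    have e2 : l₂ U.2.1 = ∫ x in Ω, φ x * inner ℝ (U.2.1 x) e := by
      rw [hl₂]
      refine integral_congr_ae (ae_of_all _ fun x => ?_)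
      simp only [inner_smul_left, real_inner_comm, conj_trivial]
    rw [Set.mem_ofPred_eq, Set.mem_ofPred_eq, e1, e2]
  rw [heq]
  exact isClosed_eq (l₁.continuous.comp continuous_fst)
    ((l₂.continuous.comp (continuous_fst.comp continuous_snd)).neg)

theorem hasWeakGradient_of_contDiff {φ : EuclideanSpace ℝ (Fin N) → ℝ} (hφ : ContDiff ℝ ∞ φ) :
    HasWeakGradient Ω φ (gradient φ) := by
  intro χ hχ hc hs e
  have c1 : Continuous fun x => fderiv ℝ φ x e :=
    (hφ.continuous_fderiv (by simp)).clm_apply continuous_const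
  have c2 : Continuous fun x => fderiv ℝ χ x e :=
    (hχ.continuous_fderiv (by simp)).clm_apply continuous_const
  have hc2 : HasCompactSupport fun x => fderiv ℝ χ x e := hc.fderiv_apply (𝕜 := ℝ) e
  have hsupp : ∀ x ∉ Ω, χ x = 0 := fun x hx => image_eq_zero_of_notMem_tsupport fun h => hx (hs h)
  have hsupp' : ∀ x ∉ Ω, fderiv ℝ χ x = 0 := fun x hx =>
    image_eq_zero_of_notMem_tsupport fun h => hx (hs (tsupport_fderiv_subset ℝ h))
  rw [setIntegral_eq_integral_of_forall_compl_eq_zero fun x hx => by rw [hsupp' x hx]; simp,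
    setIntegral_eq_integral_of_forall_compl_eq_zero fun x hx => by rw [hsupp x hx, zero_mul],
    integral_mul_fderiv_eq_neg_fderiv_mul_of_integrable
      ((c1.mul hχ.continuous).integrable_of_hasCompactSupport hc.mul_left)
      ((hφ.continuous.mul c2).integrable_of_hasCompactSupport hc2.mul_left)
      ((hφ.continuous.mul hχ.continuous).integrable_of_hasCompactSupport hc.mul_left)
      (fun x _ => hφ.differentiable (by simp) x) (fun x _ => hχ.differentiable (by simp) x)]
  congr 1
  refine integral_congr_ae (ae_of_all _ fun x => ?_)
  simp only [inner_gradient_left]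
  ring

theorem HasWeakGradient.congr_ae {u u' : EuclideanSpace ℝ (Fin N) → ℝ}
    {G G' : EuclideanSpace ℝ (Fin N) → EuclideanSpace ℝ (Fin N)} (h : HasWeakGradient Ω u G)
    (hu : u' =ᵐ[volume.restrict Ω] u) (hG : G' =ᵐ[volume.restrict Ω] G) :
    HasWeakGradient Ω u' G' := by
  intro χ hχ hc hs e
  have e1 : ∫ x in Ω, u' x * fderiv ℝ χ x e = ∫ x in Ω, u x * fderiv ℝ χ x e :=
    integral_congr_ae (hu.mono fun x hx => by simp only [hx])
  have e2 : ∫ x in Ω, χ x * inner ℝ (G' x) e = ∫ x in Ω, χ x * inner ℝ (G x) e :=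
    integral_congr_ae (hG.mono fun x hx => by simp only [hx])
  rw [e1, e2]
  exact h χ hχ hc hs e

theorem memSobolev_of_mem_traceSpace (hΩ : IsBoundedSmoothDomain Ω) (hp : 1 < p) {U : Triple p Ω}
    (hU : U ∈ traceSpace p Ω) : MemSobolev p Ω U.1 U.2.1 where
  memLp := Lp.memLp _
  memLp_gradient := Lp.memLp _
  hasWeakGradient := by
    refine traceSpace_induction (isClosed_hasWeakGradient hΩ hp) ?_ hU
    rintro U ⟨φ, hφ, h1, h2, -⟩
    exact (hasWeakGradient_of_contDiff hφ).congr_ae h1 h2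

/-- Together with `mem_traceSpace_of_isTrace` this identifies the closed subspace `traceSpace` with
the admissible test functions of the weak formulation, so weak equation and minimization range over
the same objects. -/
theorem isTrace_of_mem_traceSpace {U : Triple p Ω} (hU : U ∈ traceSpace p Ω) :
    IsTrace p Ω U.1 U.2.1 U.2.2 := by
  refine ⟨Lp.memLp _, ?_⟩
  obtain ⟨Us, hUs, hlim⟩ := mem_closure_iff_seq_limit.1
    (show U ∈ closure (smoothTriples p Ω : Set (Triple p Ω)) from hU)
  choose φ hφ h1 h2 h3 using hUs
  have l1 := (Lp.tendsto_Lp_iff_tendsto_eLpNorm' _ _).1 ((continuous_fst.tendsto U).comp hlim)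
  have l2 := (Lp.tendsto_Lp_iff_tendsto_eLpNorm' _ _).1
    (((continuous_fst.comp continuous_snd).tendsto U).comp hlim)
  have l3 := (Lp.tendsto_Lp_iff_tendsto_eLpNorm' _ _).1
    (((continuous_snd.comp continuous_snd).tendsto U).comp hlim)
  refine ⟨φ, hφ, l1.congr fun k => ?_, l2.congr fun k => ?_, l3.congr fun k => ?_⟩
  · exact eLpNorm_congr_ae ((h1 k).mono fun x hx => by simpa using hx)
  · exact eLpNorm_congr_ae ((h2 k).mono fun x hx => by simpa using hx)
  · exact eLpNorm_congr_ae ((h3 k).mono fun x hx => by simpa using hx)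

theorem mem_traceSpace_of_isTrace (hN : 1 ≤ N) (hΩ : IsBoundedSmoothDomain Ω)
    {u g : EuclideanSpace ℝ (Fin N) → ℝ}
    {G : EuclideanSpace ℝ (Fin N) → EuclideanSpace ℝ (Fin N)} (hu : MemLp u (ENNReal.ofReal p)
      (volume.restrict Ω)) (hG : MemLp G (ENNReal.ofReal p) (volume.restrict Ω))
    (hg : MemLp g (ENNReal.ofReal p) (surfaceMeasure Ω)) (h : IsTrace p Ω u G g) :
    ((hu.toLp u, hG.toLp G, hg.toLp g) : Triple p Ω) ∈ traceSpace p Ω := by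
  obtain ⟨-, φ, hφ, h1, h2, h3⟩ := h
  have m1 := fun k => memLp_domain_of_continuous hΩ (hφ k).continuous (ENNReal.ofReal p)
  have m2 := fun k => memLp_domain_of_continuous hΩ (continuous_gradient (hφ k)) (ENNReal.ofReal p)
  have m3 := fun k => memLp_boundary_of_continuous hN hΩ (hφ k).continuous (ENNReal.ofReal p)
  refine mem_closure_of_tendsto (b := atTop) (f := fun k =>
    (((m1 k).toLp (φ k), (m2 k).toLp (gradient (φ k)), (m3 k).toLp (φ k)) : Triple p Ω)) ?_
    (Eventually.of_forall fun k => ⟨φ k, hφ k, (m1 k).coeFn_toLp, (m2 k).coeFn_toLp,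
      (m3 k).coeFn_toLp⟩)
  exact ((Lp.tendsto_Lp_iff_tendsto_eLpNorm'' _ m1 _ hu).2 h1).prodMk_nhds
    (((Lp.tendsto_Lp_iff_tendsto_eLpNorm'' _ m2 _ hG).2 h2).prodMk_nhds
      ((Lp.tendsto_Lp_iff_tendsto_eLpNorm'' _ m3 _ hg).2 h3))

end TraceSpace

/-! ### Directional derivatives and first order convexity of the `L^p` norm power. -/

section LpDerivative

variable {α : Type*} [MeasurableSpace α] {μ : Measure α}
  {W : Type*} [NormedAddCommGroup W] [InnerProductSpace ℝ W] {p : ℝ}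

theorem hasDerivAt_norm_add_smul_rpow (hp : 1 < p) [Fact (1 ≤ ENNReal.ofReal p)]
    (a b : Lp W (ENNReal.ofReal p) μ) :
    HasDerivAt (fun s : ℝ => ‖a + s • b‖ ^ p)
      (p * ∫ x, ‖a x‖ ^ (p - 2) * inner ℝ (a x) (b x) ∂μ) 0 := by
  refine (hasDerivAt_integral_norm_add_smul_rpow hp (Lp.memLp a) (Lp.memLp b)).congr_of_eventuallyEq
    (Eventually.of_forall fun s => ?_)
  simp only
  rw [norm_rpow_eq_integral (by linarith)]
  refine integral_congr_ae ?_
  filter_upwards [Lp.coeFn_add a (s • b), Lp.coeFn_smul s b] with x h1 h2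
  rw [h1, Pi.add_apply, h2, Pi.smul_apply]

theorem norm_rpow_add_mul_le (hp : 1 < p) [Fact (1 ≤ ENNReal.ofReal p)]
    (a b : Lp W (ENNReal.ofReal p) μ) :
    ‖a‖ ^ p + p * ∫ x, ‖a x‖ ^ (p - 2) * inner ℝ (a x) ((b - a : Lp W (ENNReal.ofReal p) μ) x) ∂μ ≤
      ‖b‖ ^ p := by
  have h := integral_norm_rpow_add_le hp (Lp.memLp a) (Lp.memLp b)
  rw [norm_rpow_eq_integral (by linarith), norm_rpow_eq_integral (by linarith)]
  have e : ∫ x, ‖a x‖ ^ (p - 2) * inner ℝ (a x) ((b - a : Lp W (ENNReal.ofReal p) μ) x) ∂μ =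
      ∫ x, ‖a x‖ ^ (p - 2) * inner ℝ (a x) (b x - a x) ∂μ := by
    refine integral_congr_ae ?_
    filter_upwards [Lp.coeFn_sub b a] with x hx
    rw [hx, Pi.sub_apply]
  rw [e]
  exact h

theorem norm_rpow_mul_inner_self (hp : 1 < p) (a : W) : ‖a‖ ^ (p - 2) * inner ℝ a a = ‖a‖ ^ p := by
  rcases eq_or_ne a 0 with rfl | ha
  · rw [inner_zero_left, mul_zero, norm_zero, Real.zero_rpow (by linarith)]
  · rw [real_inner_self_eq_norm_sq, ← Real.rpow_natCast, ← Real.rpow_add (norm_pos_iff.2 ha)]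
    norm_num

end LpDerivative

/-! ### Weak solutions as minimizers of the loaded energy. -/

section Solutions

variable {N : ℕ} {p : ℝ} {Ω : Set (EuclideanSpace ℝ (Fin N))} [Fact (1 ≤ ENNReal.ofReal p)]

/-- The derivative of `powerEnergy p / p` at `U` in the direction `W`. -/
def energyForm (U W : Triple p Ω) : ℝ :=
  ∫ x in Ω, (‖U.2.1 x‖ ^ (p - 2) * inner ℝ (U.2.1 x) (W.2.1 x) +
    |U.1 x| ^ (p - 2) * U.1 x * W.1 x)

theorem energyForm_eq (hp : 1 < p) (U W : Triple p Ω) :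
    energyForm U W = (∫ x in Ω, ‖U.1 x‖ ^ (p - 2) * inner ℝ (U.1 x) (W.1 x)) +
      ∫ x in Ω, ‖U.2.1 x‖ ^ (p - 2) * inner ℝ (U.2.1 x) (W.2.1 x) := by
  rw [add_comm, ← integral_add (integrable_norm_rpow_mul_inner hp (Lp.memLp _) (Lp.memLp _))
    (integrable_norm_rpow_mul_inner hp (Lp.memLp _) (Lp.memLp _))]
  refine integral_congr_ae (ae_of_all _ fun x => ?_)
  simp only [Real.norm_eq_abs]
  rw [show inner ℝ (U.1 x) (W.1 x) = W.1 x * U.1 x from rfl]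
  ring

theorem energyForm_self (hp : 1 < p) (U : Triple p Ω) : energyForm U U = powerEnergy p U := by
  rw [energyForm_eq hp, powerEnergy, norm_rpow_eq_integral (by linarith),
    norm_rpow_eq_integral (by linarith)]
  congr 1
  · exact integral_congr_ae (ae_of_all _ fun x => norm_rpow_mul_inner_self hp _)
  · exact integral_congr_ae (ae_of_all _ fun x => norm_rpow_mul_inner_self hp _)

theorem hasDerivAt_loadedEnergy (hp : 1 < p) (l : Lp ℝ (ENNReal.ofReal p) (surfaceMeasure Ω) →L[ℝ] ℝ)
    (U W : Triple p Ω) :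
    HasDerivAt (fun s : ℝ => loadedEnergy p l (U + s • W)) (energyForm U W - l W.2.2) 0 := by
  have hp0 : p ≠ 0 := by linarith
  have h1 := hasDerivAt_norm_add_smul_rpow hp U.1 W.1
  have h2 := hasDerivAt_norm_add_smul_rpow hp U.2.1 W.2.1
  have h3 : HasDerivAt (fun s : ℝ => l (U.2.2 + s • W.2.2)) (l W.2.2) 0 := by
    have : HasDerivAt (fun s : ℝ => l U.2.2 + s * l W.2.2) (l W.2.2) 0 := by
      simpa using ((hasDerivAt_id (0 : ℝ)).mul_const (l W.2.2)).const_add (l U.2.2)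
    refine this.congr_of_eventuallyEq (Eventually.of_forall fun s => ?_)
    simp only [map_add, map_smul, smul_eq_mul]
  refine (((h1.add h2).div_const p).sub h3).congr_deriv ?_
  rw [energyForm_eq hp]
  field_simp

/-- Minimizers of the energy satisfy the weak equation. -/
theorem energyForm_eq_of_minimizer (hp : 1 < p)
    {l : Lp ℝ (ENNReal.ofReal p) (surfaceMeasure Ω) →L[ℝ] ℝ} {U : Triple p Ω}
    (hU : U ∈ traceSpace p Ω)
    (hmin : ∀ W ∈ traceSpace p Ω, loadedEnergy p l U ≤ loadedEnergy p l W)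
    {W : Triple p Ω} (hW : W ∈ traceSpace p Ω) : energyForm U W = l W.2.2 := by
  have hloc : IsLocalMin (fun s : ℝ => loadedEnergy p l (U + s • W)) 0 :=
    Eventually.of_forall fun s => by
      simp only [zero_smul, add_zero]
      exact hmin _ (Submodule.add_mem _ hU (Submodule.smul_mem _ s hW))
  exact sub_eq_zero.1 (hloc.hasDerivAt_eq_zero (hasDerivAt_loadedEnergy hp l U W))

/-- Solutions of the weak equation minimize the energy. -/
theorem le_loadedEnergy_of_energyForm_eq (hp : 1 < p)
    {l : Lp ℝ (ENNReal.ofReal p) (surfaceMeasure Ω) →L[ℝ] ℝ} {U : Triple p Ω}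
    (hU : U ∈ traceSpace p Ω)
    (hweak : ∀ W ∈ traceSpace p Ω, energyForm U W = l W.2.2)
    {W : Triple p Ω} (hW : W ∈ traceSpace p Ω) : loadedEnergy p l U ≤ loadedEnergy p l W := by
  have hp0 : 0 < p := by linarith
  have h1 := norm_rpow_add_mul_le hp U.1 W.1
  have h2 := norm_rpow_add_mul_le hp U.2.1 W.2.1
  have h3 := hweak (W - U) (Submodule.sub_mem _ hW hU)
  rw [energyForm_eq hp] at h3
  have h4 : l (W - U).2.2 = l W.2.2 - l U.2.2 := map_sub l _ _
  rw [h4] at h3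
  have h5 : powerEnergy p U + p * (l W.2.2 - l U.2.2) ≤ powerEnergy p W := by
    rw [← h3, mul_add]
    unfold powerEnergy
    simp only [Prod.fst_sub, Prod.snd_sub] at h1 h2 ⊢
    linarith
  unfold loadedEnergy
  have h6 := div_le_div_of_nonneg_right h5 hp0.le
  rw [add_div, mul_div_cancel_left₀ _ hp0.ne'] at h6
  linarith

/-- Testing with the solution itself gives `powerEnergy p U = l U.2.2`, so the minimal energy is `(1
/ p - 1)` times the load term. This converts the derivative of `I` into the derivative of a minimum.
-/
theorem loadedEnergy_eq_of_energyForm_eq (hp : 1 < p)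
    {l : Lp ℝ (ENNReal.ofReal p) (surfaceMeasure Ω) →L[ℝ] ℝ} {U : Triple p Ω}
    (hweak : energyForm U U = l U.2.2) : l U.2.2 = -(p / (p - 1)) * loadedEnergy p l U := by
  have hp1 : p - 1 ≠ 0 := by linarith
  have hp0 : p ≠ 0 := by linarith
  rw [energyForm_self hp] at hweak
  rw [loadedEnergy, hweak]
  field_simp
  ring

/-- `l` is integration against `k` on the boundary. -/
def IsLoad (k : EuclideanSpace ℝ (Fin N) → ℝ)
    (l : Lp ℝ (ENNReal.ofReal p) (surfaceMeasure Ω) →L[ℝ] ℝ) : Prop :=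
  ∀ g, l g = ∫ x, k x * g x ∂(surfaceMeasure Ω)

variable {k u g : EuclideanSpace ℝ (Fin N) → ℝ}
  {G : EuclideanSpace ℝ (Fin N) → EuclideanSpace ℝ (Fin N)}
  {l : Lp ℝ (ENNReal.ofReal p) (surfaceMeasure Ω) →L[ℝ] ℝ}

theorem exists_isLoad (hp : 1 < p) (hk : MemLp k (ENNReal.ofReal (p / (p - 1))) (surfaceMeasure Ω)) :
    ∃ l : Lp ℝ (ENNReal.ofReal p) (surfaceMeasure Ω) →L[ℝ] ℝ, IsLoad k l := by
  obtain ⟨l, hl⟩ := exists_pairing_of_memLp hp hk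
  refine ⟨l, fun g => ?_⟩
  rw [hl]
  refine integral_congr_ae (ae_of_all _ fun x => ?_)
  simp only [show inner ℝ (k x) (g x) = g x * k x from rfl, mul_comm]

/-- The triple of a weak solution. -/
def IsWeakSolution.triple (h : IsWeakSolution p Ω k u G g) : Triple p Ω :=
  (h.memSobolev.memLp.toLp u, h.memSobolev.memLp_gradient.toLp G, h.isTrace.1.toLp g)

theorem IsWeakSolution.triple_mem (hN : 1 ≤ N) (hΩ : IsBoundedSmoothDomain Ω)
    (h : IsWeakSolution p Ω k u G g) : h.triple ∈ traceSpace p Ω :=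
  mem_traceSpace_of_isTrace hN hΩ _ _ _ h.isTrace

theorem IsWeakSolution.energyForm_eq (hΩ : IsBoundedSmoothDomain Ω) (hp : 1 < p)
    (h : IsWeakSolution p Ω k u G g) (hl : IsLoad k l) {W : Triple p Ω}
    (hW : W ∈ traceSpace p Ω) : energyForm h.triple W = l W.2.2 := by
  rw [hl, ← h.weak_equation _ _ _ (memSobolev_of_mem_traceSpace hΩ hp hW)
    (isTrace_of_mem_traceSpace hW)]
  refine integral_congr_ae ?_
  filter_upwards [h.memSobolev.memLp.coeFn_toLp, h.memSobolev.memLp_gradient.coeFn_toLp]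
    with x h1 h2
  simp only [IsWeakSolution.triple, h1, h2]

theorem IsWeakSolution.minimizes (hN : 1 ≤ N) (hΩ : IsBoundedSmoothDomain Ω) (hp : 1 < p)
    (h : IsWeakSolution p Ω k u G g) (hl : IsLoad k l) :
    ∀ W ∈ traceSpace p Ω, loadedEnergy p l h.triple ≤ loadedEnergy p l W := fun _ hW =>
  le_loadedEnergy_of_energyForm_eq hp (h.triple_mem hN hΩ)
    (fun _ hW => h.energyForm_eq hΩ hp hl hW) hW

theorem IsWeakSolution.integral_eq (hN : 1 ≤ N) (hΩ : IsBoundedSmoothDomain Ω) (hp : 1 < p)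
    (h : IsWeakSolution p Ω k u G g) (hl : IsLoad k l) :
    ∫ x, g x * k x ∂(surfaceMeasure Ω) = -(p / (p - 1)) * loadedEnergy p l h.triple := by
  rw [← loadedEnergy_eq_of_energyForm_eq hp (h.energyForm_eq hΩ hp hl (h.triple_mem hN hΩ)), hl]
  refine integral_congr_ae ?_
  filter_upwards [h.isTrace.1.coeFn_toLp] with x h1
  simp only [IsWeakSolution.triple, h1, mul_comm]

theorem isWeakSolution_of_minimizer (hN : 1 ≤ N) (hΩ : IsBoundedSmoothDomain Ω) (hp : 1 < p)
    (hl : IsLoad k l) {U : Triple p Ω} (hU : U ∈ traceSpace p Ω)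
    (hmin : ∀ W ∈ traceSpace p Ω, loadedEnergy p l U ≤ loadedEnergy p l W) :
    IsWeakSolution p Ω k U.1 U.2.1 U.2.2 where
  memSobolev := memSobolev_of_mem_traceSpace hΩ hp hU
  isTrace := isTrace_of_mem_traceSpace hU
  weak_equation := fun v H h hv ht => by
    have hW := mem_traceSpace_of_isTrace hN hΩ hv.memLp hv.memLp_gradient ht.1 ht
    have h1 := energyForm_eq_of_minimizer hp hU hmin hW
    rw [hl] at h1
    refine Eq.trans ?_ (h1.trans ?_)
    · refine integral_congr_ae ?_
      filter_upwards [hv.memLp.coeFn_toLp, hv.memLp_gradient.coeFn_toLp] with x e1 e2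
      simp only [e1, e2]
    · refine integral_congr_ae ?_
      filter_upwards [ht.1.coeFn_toLp] with x e1
      simp only [e1]

theorem exists_traceSpace_minimizer (hN : 1 ≤ N) (hΩ : IsBoundedSmoothDomain Ω) (hp : 1 < p)
    (l : Lp ℝ (ENNReal.ofReal p) (surfaceMeasure Ω) →L[ℝ] ℝ) :
    ∃ U ∈ traceSpace p Ω, ∀ W ∈ traceSpace p Ω, loadedEnergy p l U ≤ loadedEnergy p l W := by
  obtain ⟨C, hC, htr⟩ := exists_norm_trace_rpow_le hN hΩ hp
  exact exists_minimizer (X := traceSpace p Ω) isClosed_traceSpace hp hC htr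
    (uniformlyConvexRpow_Lp hp) (uniformlyConvexRpow_Lp hp) l

theorem exists_isWeakSolution (hN : 1 ≤ N) (hΩ : IsBoundedSmoothDomain Ω) (hp : 1 < p)
    (hk : MemLp k (ENNReal.ofReal (p / (p - 1))) (surfaceMeasure Ω)) :
    ∃ u G g, IsWeakSolution p Ω k u G g := by
  obtain ⟨l, hl⟩ := exists_isLoad hp hk
  obtain ⟨U, hU, hmin⟩ := exists_traceSpace_minimizer hN hΩ hp l
  exact ⟨U.1, U.2.1, U.2.2, isWeakSolution_of_minimizer hN hΩ hp hl hU hmin⟩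

theorem traceSpace_minimizer_unique (hN : 1 ≤ N) (hΩ : IsBoundedSmoothDomain Ω) (hp : 1 < p)
    {U U' : Triple p Ω} (hU : U ∈ traceSpace p Ω) (hU' : U' ∈ traceSpace p Ω)
    (hUm : ∀ W ∈ traceSpace p Ω, loadedEnergy p l U ≤ loadedEnergy p l W)
    (hUm' : ∀ W ∈ traceSpace p Ω, loadedEnergy p l U' ≤ loadedEnergy p l W) : U = U' := by
  obtain ⟨C, hC, htr⟩ := exists_norm_trace_rpow_le hN hΩ hp
  exact minimizer_unique (X := traceSpace p Ω) hp hC htr (uniformlyConvexRpow_Lp hp)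
    (uniformlyConvexRpow_Lp hp) l hU hU' hUm hUm'

theorem IsWeakSolution.triple_eq (hN : 1 ≤ N) (hΩ : IsBoundedSmoothDomain Ω) (hp : 1 < p)
    (hk : MemLp k (ENNReal.ofReal (p / (p - 1))) (surfaceMeasure Ω))
    {u' g' : EuclideanSpace ℝ (Fin N) → ℝ}
    {G' : EuclideanSpace ℝ (Fin N) → EuclideanSpace ℝ (Fin N)}
    (h : IsWeakSolution p Ω k u G g) (h' : IsWeakSolution p Ω k u' G' g') :
    h.triple = h'.triple := by
  obtain ⟨l, hl⟩ := exists_isLoad hp hk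
  exact traceSpace_minimizer_unique hN hΩ hp (h.triple_mem hN hΩ) (h'.triple_mem hN hΩ)
    (h.minimizes hN hΩ hp hl) (h'.minimizes hN hΩ hp hl)

theorem IsWeakSolution.ae_eq_of_triple_eq
    {u' g' : EuclideanSpace ℝ (Fin N) → ℝ}
    {G' : EuclideanSpace ℝ (Fin N) → EuclideanSpace ℝ (Fin N)}
    (h : IsWeakSolution p Ω k u G g) (h' : IsWeakSolution p Ω k u' G' g')
    (heq : h.triple = h'.triple) :
    u =ᵐ[volume.restrict Ω] u' ∧ G =ᵐ[volume.restrict Ω] G' ∧ g =ᵐ[surfaceMeasure Ω] g' := by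
  refine ⟨(MemLp.toLp_eq_toLp_iff h.memSobolev.memLp h'.memSobolev.memLp).1 ?_,
    (MemLp.toLp_eq_toLp_iff h.memSobolev.memLp_gradient h'.memSobolev.memLp_gradient).1 ?_,
    (MemLp.toLp_eq_toLp_iff h.isTrace.1 h'.isTrace.1).1 ?_⟩
  · exact congrArg Prod.fst heq
  · exact congrArg (fun U => U.2.1) heq
  · exact congrArg (fun U => U.2.2) heq

end Solutions

/-! ### Smooth competitors approximating transport by the flow. -/

section SmoothPerturbation

/-- Only the points with vanishing vector are delicate, since `p - 2` may be negative; there the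
expression is bounded by `‖a‖ ^ (p - 1) * ‖M a‖`, which tends to zero. -/
theorem continuous_norm_rpow_mul_inner {W : Type*} [NormedAddCommGroup W] [InnerProductSpace ℝ W]
    {p : ℝ} (hp : 1 < p) :
    Continuous fun q : (W →L[ℝ] W) × W => ‖q.2‖ ^ (p - 2) * inner ℝ q.2 (q.1 q.2) := by
  rw [continuous_iff_continuousAt]
  rintro ⟨M, a⟩
  have happ : Continuous fun q : (W →L[ℝ] W) × W => q.1 q.2 := continuous_fst.clm_apply continuous_snd
  rcases eq_or_ne a 0 with rfl | ha
  · rw [ContinuousAt]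
    simp only [inner_zero_left, mul_zero]
    have hb : Continuous fun q : (W →L[ℝ] W) × W => ‖q.2‖ ^ (p - 1) * ‖q.1 q.2‖ :=
      (Continuous.rpow_const (by fun_prop) fun _ => Or.inr (by linarith)).mul happ.norm
    refine squeeze_zero_norm (fun q => abs_norm_rpow_mul_inner_le hp q.2 (q.1 q.2)) ?_
    have := hb.tendsto (M, 0)
    simpa using this
  · refine ContinuousAt.mul ?_ (continuous_snd.inner happ).continuousAt
    exact continuous_snd.norm.continuousAt.rpow_const (Or.inl (norm_ne_zero_iff.2 ha))

variable {N : ℕ} {Ω : Set (EuclideanSpace ℝ (Fin N))} {p : ℝ}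
variable {V : EuclideanSpace ℝ (Fin N) → EuclideanSpace ℝ (Fin N)} {K : NNReal}
  {ψ : ℝ → EuclideanSpace ℝ (Fin N) → EuclideanSpace ℝ (Fin N)}

theorem gradient_comp {φ : EuclideanSpace ℝ (Fin N) → ℝ}
    {Φ : EuclideanSpace ℝ (Fin N) → EuclideanSpace ℝ (Fin N)} (hφ : ContDiff ℝ ∞ φ)
    (hΦ : ContDiff ℝ ∞ Φ) (x : EuclideanSpace ℝ (Fin N)) :
    gradient (fun y => φ (Φ y)) x =
      ContinuousLinearMap.adjoint (fderiv ℝ Φ x) (gradient φ (Φ x)) := by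
  refine ext_inner_right ℝ fun v => ?_
  rw [inner_gradient_left, ContinuousLinearMap.adjoint_inner_left, inner_gradient_left]
  have h := ((hφ.differentiable (by simp) (Φ x)).hasFDerivAt.comp x
    (hΦ.differentiable (by simp) x).hasFDerivAt).fderiv
  exact congrArg (fun A : EuclideanSpace ℝ (Fin N) →L[ℝ] ℝ => A v) h

theorem norm_gradient_comp_le {φ : EuclideanSpace ℝ (Fin N) → ℝ}
    {Φ : EuclideanSpace ℝ (Fin N) → EuclideanSpace ℝ (Fin N)} (hφ : ContDiff ℝ ∞ φ)
    (hΦ : ContDiff ℝ ∞ Φ) {x : EuclideanSpace ℝ (Fin N)} {t C : ℝ}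
    {A : EuclideanSpace ℝ (Fin N) →L[ℝ] EuclideanSpace ℝ (Fin N)}
    (hA : ‖fderiv ℝ Φ x - (ContinuousLinearMap.id ℝ _ + (-t) • A)‖ ≤ C * t ^ 2) :
    ‖gradient (fun y => φ (Φ y)) x‖ ≤
      ‖gradient φ (Φ x) - t • ContinuousLinearMap.adjoint A (gradient φ (Φ x))‖ +
        C * t ^ 2 * ‖gradient φ (Φ x)‖ := by
  set z := gradient φ (Φ x) with hz
  have h1 : ContinuousLinearMap.adjoint (fderiv ℝ Φ x) z =
      (z - t • ContinuousLinearMap.adjoint A z) + ContinuousLinearMap.adjoint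
        (fderiv ℝ Φ x - (ContinuousLinearMap.id ℝ _ + (-t) • A)) z := by
    refine ext_inner_right ℝ fun v => ?_
    rw [inner_add_left, inner_sub_left, inner_smul_left, ContinuousLinearMap.adjoint_inner_left,
      ContinuousLinearMap.adjoint_inner_left, ContinuousLinearMap.adjoint_inner_left]
    simp only [sub_apply, add_apply, smul_apply, ContinuousLinearMap.id_apply, inner_sub_right,
      inner_add_right, inner_smul_right, conj_trivial]
    ring
  rw [gradient_comp hφ hΦ, h1]
  refine (norm_add_le _ _).trans (add_le_add le_rfl ?_)
  refine (ContinuousLinearMap.le_opNorm _ _).trans ?_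
  rw [LinearIsometryEquiv.norm_map]
  exact mul_le_mul_of_nonneg_right hA (norm_nonneg _)

theorem tendsto_integral_mul_comp {μ : Measure (EuclideanSpace ℝ (Fin N))}
    {w h : EuclideanSpace ℝ (Fin N) → ℝ} (hw : Integrable w μ) (hh : Continuous h)
    {Φ : ℕ → EuclideanSpace ℝ (Fin N) → EuclideanSpace ℝ (Fin N)}
    {Ψ : EuclideanSpace ℝ (Fin N) → EuclideanSpace ℝ (Fin N)} (hΦ : ∀ n, Continuous (Φ n)) {R : ℝ}
    (hb : ∀ᵐ x ∂μ, ∀ n, ‖Φ n x‖ ≤ R) (hlim : ∀ᵐ x ∂μ, Tendsto (fun n => Φ n x) atTop (𝓝 (Ψ x))) :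
    Tendsto (fun n => ∫ x, w x * h (Φ n x) ∂μ) atTop (𝓝 (∫ x, w x * h (Ψ x) ∂μ)) := by
  obtain ⟨B, hB⟩ := (isCompact_closedBall (0 : EuclideanSpace ℝ (Fin N)) R
    ).exists_bound_of_continuousOn hh.continuousOn
  refine tendsto_integral_of_dominated_convergence (fun x => ‖w x‖ * B)
    (fun n => hw.aestronglyMeasurable.mul (hh.comp (hΦ n)).aestronglyMeasurable)
    (hw.norm.mul_const B) (fun n => ?_) ?_
  · filter_upwards [hb] with x hx
    rw [norm_mul]
    exact mul_le_mul_of_nonneg_left (hB _ (by simpa using hx n)) (norm_nonneg _)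
  · filter_upwards [hlim] with x hx
    exact ((hh.tendsto _).comp hx).const_mul _

/-- First order expansion of `‖∇(φ ∘ ψ₋ₜ)‖ ^ p` with an error term of relative size `η |t|`. -/
def gradientExpansion (p : ℝ) (V : EuclideanSpace ℝ (Fin N) → EuclideanSpace ℝ (Fin N)) (η t : ℝ)
    (φ : EuclideanSpace ℝ (Fin N) → ℝ) (y : EuclideanSpace ℝ (Fin N)) : ℝ :=
  ‖gradient φ y‖ ^ p - p * t * (‖gradient φ y‖ ^ (p - 2) *
    inner ℝ (gradient φ y) (ContinuousLinearMap.adjoint (fderiv ℝ V y) (gradient φ y))) +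
      η * |t| * ‖gradient φ y‖ ^ p

theorem continuous_adjoint_fderiv (hV : ContDiff ℝ ∞ V) :
    Continuous fun y => ContinuousLinearMap.adjoint (fderiv ℝ V y) :=
  (LinearIsometryEquiv.continuous _).comp (hV.continuous_fderiv (by simp))

theorem continuous_gradient_form (hp : 1 < p) (hV : ContDiff ℝ ∞ V)
    {φ : EuclideanSpace ℝ (Fin N) → ℝ} (hφ : ContDiff ℝ ∞ φ) :
    Continuous fun y => ‖gradient φ y‖ ^ (p - 2) *
      inner ℝ (gradient φ y) (ContinuousLinearMap.adjoint (fderiv ℝ V y) (gradient φ y)) :=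
  (continuous_norm_rpow_mul_inner hp).comp
    ((continuous_adjoint_fderiv hV).prodMk (continuous_gradient hφ))

theorem continuous_norm_gradient_rpow (hp : 1 < p)
    {φ : EuclideanSpace ℝ (Fin N) → ℝ} (hφ : ContDiff ℝ ∞ φ) :
    Continuous fun y => ‖gradient φ y‖ ^ p :=
  (continuous_gradient hφ).norm.rpow_const fun _ => Or.inr (by linarith)

theorem continuous_gradientExpansion (hp : 1 < p) (hV : ContDiff ℝ ∞ V) (η t : ℝ)
    {φ : EuclideanSpace ℝ (Fin N) → ℝ} (hφ : ContDiff ℝ ∞ φ) :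
    Continuous (gradientExpansion p V η t φ) := by
  have h1 := continuous_norm_gradient_rpow hp hφ
  have h2 := continuous_gradient_form hp hV hφ
  unfold gradientExpansion
  exact (h1.sub (h2.const_mul (p * t))).add (h1.const_mul (η * |t|))

theorem exists_norm_fderiv_sub_le (hV : ContDiff ℝ ∞ V) (R : ℝ) :
    ∃ L : ℝ, 0 ≤ L ∧ ∀ x y, ‖x‖ ≤ R → ‖y‖ ≤ R → ‖fderiv ℝ V x - fderiv ℝ V y‖ ≤ L * ‖x - y‖ := by
  have hc : ContDiff ℝ 1 (fderiv ℝ V) := hV.fderiv_right (by norm_cast)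
  obtain ⟨L, hL⟩ := (hc.locallyLipschitz.locallyLipschitzOn).exists_lipschitzOnWith_of_compact
    (isCompact_closedBall (0 : EuclideanSpace ℝ (Fin N)) R)
  refine ⟨L, L.2, fun x y hx hy => ?_⟩
  have := hL.dist_le_mul x (by simpa using hx) y (by simpa using hy)
  rwa [dist_eq_norm, dist_eq_norm] at this

/-- Smooth approximations of `φ ∘ ψ₋ₜ` whose gradients satisfy the expected expansion. -/
theorem IsFlowOf.exists_smooth_perturbation (hΩ : IsBoundedSmoothDomain Ω)
    (hψ : IsFlowOf V ψ) (hV : ContDiff ℝ ∞ V) (hL : LipschitzWith K V) (hp : 1 < p)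
    {η : ℝ} (hη : 0 < η) :
    ∃ t₀ > 0, ∀ t : ℝ, |t| ≤ t₀ → ∀ φ : EuclideanSpace ℝ (Fin N) → ℝ, ContDiff ℝ ∞ φ →
      ∃ Φ : ℕ → EuclideanSpace ℝ (Fin N) → EuclideanSpace ℝ (Fin N), (∀ n, ContDiff ℝ ∞ (Φ n)) ∧
        (∃ R : ℝ, ∀ x ∈ closure Ω, ∀ n, ‖Φ n x‖ ≤ R) ∧
        (∀ x ∈ closure Ω, Tendsto (fun n => Φ n x) atTop (𝓝 (ψ (-t) x))) ∧
        ∀ᶠ n in atTop, ∀ x ∈ closure Ω, ‖gradient (fun y => φ (Φ n y)) x‖ ^ p ≤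
          gradientExpansion p V η t φ (Φ n x) := by
  obtain ⟨R, hR⟩ := hΩ.isCompact_closure.isBounded.exists_norm_le
  obtain ⟨C, hC, happrox⟩ := hψ.exists_smooth_approx hV hL (R + 1)
  obtain ⟨M, hM, hmove⟩ := hψ.exists_norm_sub_le hL (R + 1)
  obtain ⟨L, hL0, hlip⟩ := exists_norm_fderiv_sub_le hV (|R| + 1 + M + C)
  obtain ⟨t₀, ht₀, hpow⟩ := exists_norm_sub_smul_rpow_le (W := EuclideanSpace ℝ (Fin N)) hp
    (show (0 : ℝ) ≤ K from K.2) (show 0 ≤ C + L * (M + C) by positivity) hη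
  refine ⟨min t₀ 1, by positivity, fun t ht φ hφ => ?_⟩
  have ht0 := ht.trans (min_le_left _ _)
  have ht1 := ht.trans (min_le_right _ _)
  obtain ⟨Φ, hΦ, hΦ1, hΦ2⟩ := happrox (-t) (by rwa [abs_neg])
  have hn : ∀ n : ℕ, 1 / ((n : ℝ) + 1) ≤ 1 := fun n => by
    rw [div_le_one (by positivity)]; linarith [(Nat.cast_nonneg n : (0 : ℝ) ≤ n)]
  have hle : ∀ x ∈ closure Ω, ‖x‖ ≤ R + 1 := fun x hx => (hR x hx).trans (by linarith)
  have hΦx : ∀ x ∈ closure Ω, ∀ n, ‖Φ n x - x‖ ≤ M * |t| + C * (1 / ((n : ℝ) + 1)) := by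
    intro x hx n
    have h1 := hΦ1 n x (hle x hx)
    have h2 := hmove (-t) (by rwa [abs_neg]) x (hle x hx)
    rw [abs_neg] at h2
    have h3 := norm_add_le (Φ n x - ψ (-t) x) (ψ (-t) x - x)
    rw [sub_add_sub_cancel] at h3
    linarith
  have hΦb : ∀ x ∈ closure Ω, ∀ n, ‖Φ n x‖ ≤ |R| + 1 + M + C := by
    intro x hx n
    have h1 := hΦx x hx n
    have h2 := norm_add_le (Φ n x - x) x
    rw [sub_add_cancel] at h2
    have h3 : M * |t| ≤ M * 1 := mul_le_mul_of_nonneg_left ht1 hM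
    have h4 : C * (1 / ((n : ℝ) + 1)) ≤ C * 1 := mul_le_mul_of_nonneg_left (hn n) hC
    linarith [hR x hx, le_abs_self R]
  have hlim0 : Tendsto (fun n : ℕ => C * (1 / ((n : ℝ) + 1))) atTop (𝓝 0) := by
    simpa using tendsto_one_div_add_atTop_nhds_zero_nat.const_mul C
  refine ⟨Φ, hΦ, ⟨_, hΦb⟩, fun x hx => ?_, ?_⟩
  · rw [tendsto_iff_norm_sub_tendsto_zero]
    exact squeeze_zero (fun n => norm_nonneg _) (fun n => hΦ1 n x (hle x hx)) hlim0
  -- The approximation error `1 / (n + 1)`, multiplied by `|t|`, must be of second order in `t`;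
  -- this holds for `n` large depending on `t`, and trivially for `t = 0`.
  have hev : ∀ᶠ n : ℕ in atTop, |t| * (C * (1 / ((n : ℝ) + 1))) ≤ C * t ^ 2 := by
    rcases eq_or_ne t 0 with rfl | htne
    · simp
    · have hpos : 0 < |t| := abs_pos.2 htne
      filter_upwards [tendsto_one_div_add_atTop_nhds_zero_nat.eventually (gt_mem_nhds hpos)]
        with n hn
      calc |t| * (C * (1 / ((n : ℝ) + 1))) ≤ |t| * (C * |t|) :=
            mul_le_mul_of_nonneg_left (mul_le_mul_of_nonneg_left hn.le hC) (abs_nonneg _)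
        _ = C * t ^ 2 := by rw [← sq_abs t]; ring
  filter_upwards [hev] with n hn' x hx
  have hKV : ‖ContinuousLinearMap.adjoint (fderiv ℝ V (Φ n x))‖ ≤ K := by
    rw [LinearIsometryEquiv.norm_map]; exact norm_fderiv_le_of_lipschitz ℝ hL
  -- The derivative of `V` is moved from `x` to `Φ n x`, at a cost of order `t ^ 2`. The resulting
  -- gradient bound is then a function of `Φ n x` alone, so that in the limit the change of
  -- variables for the flow applies to it.
  have hA : ‖fderiv ℝ (Φ n) x - (ContinuousLinearMap.id ℝ _ + (-t) • fderiv ℝ V (Φ n x))‖ ≤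
      (C + L * (M + C)) * t ^ 2 := by
    have h1 := hΦ2 n x (by linarith [hR x hx])
    rw [neg_sq] at h1
    have h2 : fderiv ℝ (Φ n) x - (ContinuousLinearMap.id ℝ _ + (-t) • fderiv ℝ V (Φ n x)) =
        (fderiv ℝ (Φ n) x - (ContinuousLinearMap.id ℝ _ + (-t) • fderiv ℝ V x)) +
          t • (fderiv ℝ V (Φ n x) - fderiv ℝ V x) := by
      refine ContinuousLinearMap.ext fun v => ?_
      simp only [sub_apply, add_apply, smul_apply, neg_smul, smul_sub]
      abel
    rw [h2]
    refine (norm_add_le _ _).trans ?_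
    rw [norm_smul, Real.norm_eq_abs]
    have h3 := hlip (Φ n x) x (hΦb x hx n) (by linarith [hR x hx, le_abs_self R])
    have h4 : |t| * ‖fderiv ℝ V (Φ n x) - fderiv ℝ V x‖ ≤
        |t| * (L * (M * |t| + C * (1 / ((n : ℝ) + 1)))) :=
      mul_le_mul_of_nonneg_left (h3.trans (mul_le_mul_of_nonneg_left (hΦx x hx n) hL0))
        (abs_nonneg _)
    have h5 : |t| * (L * (M * |t| + C * (1 / ((n : ℝ) + 1)))) =
        L * (M * t ^ 2) + L * (|t| * (C * (1 / ((n : ℝ) + 1)))) := by rw [← sq_abs t]; ring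
    have h6 := mul_le_mul_of_nonneg_left hn' hL0
    have h7 : (C + L * (M + C)) * t ^ 2 = C * t ^ 2 + (L * (M * t ^ 2) + L * (C * t ^ 2)) := by ring
    linarith
  exact (Real.rpow_le_rpow (norm_nonneg _) (norm_gradient_comp_le hφ (hΦ n) hA)
    (by linarith)).trans (hpow t ht0 _ hKV (gradient φ (Φ n x)))

end SmoothPerturbation

/-! ### The energy of a transported competitor. -/

section PerturbationInequality

variable {N : ℕ} {Ω : Set (EuclideanSpace ℝ (Fin N))} {p : ℝ}
variable {V ν : EuclideanSpace ℝ (Fin N) → EuclideanSpace ℝ (Fin N)} {K : NNReal}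
  {ψ : ℝ → EuclideanSpace ℝ (Fin N) → EuclideanSpace ℝ (Fin N)}
  {k φ : EuclideanSpace ℝ (Fin N) → ℝ}

theorem integrable_domain_of_continuous (hΩ : IsBoundedSmoothDomain Ω)
    {f : EuclideanSpace ℝ (Fin N) → ℝ} (hf : Continuous f) : Integrable f (volume.restrict Ω) :=
  memLp_one_iff_integrable.1 (memLp_domain_of_continuous hΩ hf 1)

/-- Product of the gradient expansion with the volume factor `1 + t * d`, plus the distortion error.
The constant `6` counts multiples of `η * |t| * P`: one from the expansion, three from the
distortion error, one from the cross term quadratic in `t`, and one from the expansion error times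
`t * d`. -/
theorem expansion_mul_le {P Q d t η B κ : ℝ} (hη0 : 0 ≤ η) (hη1 : η ≤ 1) (hp : 0 ≤ p) (hP : 0 ≤ P)
    (hQ : |Q| ≤ κ * P) (hd : |d| ≤ B) (ht1 : |t| ≤ 1) (htB : |t| * B ≤ 1)
    (htκ : p * |t| * κ ≤ 1) (htκB : p * |t| * κ * B ≤ η) :
    (P - p * t * Q + η * |t| * P) * (1 + t * d) + η * |t| * |P - p * t * Q + η * |t| * P| ≤
      P + t * (P * d) - p * t * Q + 6 * η * |t| * P := by
  have ht0 := abs_nonneg t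
  have hB : 0 ≤ B := (abs_nonneg d).trans hd
  have hptQ : |p * t * Q| ≤ P := by
    rw [abs_mul, abs_mul, abs_of_nonneg hp]
    calc p * |t| * |Q| ≤ p * |t| * (κ * P) := mul_le_mul_of_nonneg_left hQ (by positivity)
      _ = p * |t| * κ * P := by ring
      _ ≤ 1 * P := mul_le_mul_of_nonneg_right htκ hP
      _ = P := one_mul P
  have hηtP : 0 ≤ η * |t| * P := by positivity
  have hηt : η * |t| ≤ 1 := mul_le_one₀ hη1 ht0 ht1
  have hg : |P - p * t * Q + η * |t| * P| ≤ 3 * P := by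
    have h1 : η * |t| * P ≤ 1 * P := mul_le_mul_of_nonneg_right hηt hP
    rw [abs_le] at hptQ ⊢
    constructor <;> linarith [hptQ.1, hptQ.2]
  have h1 : η * |t| * |P - p * t * Q + η * |t| * P| ≤ η * |t| * (3 * P) :=
    mul_le_mul_of_nonneg_left hg (by positivity)
  have h2 : |p * t * Q * (t * d)| ≤ η * |t| * P := by
    rw [abs_mul, abs_mul, abs_mul, abs_mul, abs_of_nonneg hp]
    calc p * |t| * |Q| * (|t| * |d|) ≤ p * |t| * (κ * P) * (|t| * B) := by
          refine mul_le_mul (mul_le_mul_of_nonneg_left hQ (by positivity))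
            (mul_le_mul_of_nonneg_left hd ht0) (by positivity) ?_
          exact mul_nonneg (by positivity) ((abs_nonneg _).trans hQ)
      _ = (p * |t| * κ * B) * (|t| * P) := by ring
      _ ≤ η * (|t| * P) := mul_le_mul_of_nonneg_right htκB (by positivity)
      _ = η * |t| * P := by ring
  have h3 : |t * d| ≤ 1 := by
    rw [abs_mul]; exact (mul_le_mul_of_nonneg_left hd ht0).trans htB
  have h4 : η * |t| * P * (t * d) ≤ η * |t| * P * 1 :=
    mul_le_mul_of_nonneg_left ((le_abs_self _).trans h3) hηtP
  have e : (P - p * t * Q + η * |t| * P) * (1 + t * d) =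
      P + t * (P * d) - p * t * Q - p * t * Q * (t * d) + η * |t| * P + η * |t| * P * (t * d) := by
    ring
  have h5 := neg_abs_le (p * t * Q * (t * d))
  linarith

theorem integral_expansion_comp_le (hΩ : IsBoundedSmoothDomain Ω) (hV : ContDiff ℝ ∞ V)
    (hL : LipschitzWith K V) (hp : 1 < p) (hφ : ContDiff ℝ ∞ φ) {t η B : ℝ} (hη0 : 0 ≤ η)
    (hη1 : η ≤ 1) (hB : ∀ x ∈ Ω, |divergence V x| ≤ B) (ht1 : |t| ≤ 1) (htB : |t| * B ≤ 1)
    (htκ : p * |t| * K ≤ 1) (htκB : p * |t| * K * B ≤ η)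
    (hdist : |(∫ x in Ω, gradientExpansion p V η t φ (ψ (-t) x)) -
      ∫ x in Ω, gradientExpansion p V η t φ x * (1 + t * divergence V x)| ≤
        η * |t| * ∫ x in Ω, |gradientExpansion p V η t φ x|) :
    ∫ x in Ω, gradientExpansion p V η t φ (ψ (-t) x) ≤
      (∫ x in Ω, ‖gradient φ x‖ ^ p) + t * (∫ x in Ω, ‖gradient φ x‖ ^ p * divergence V x) -
        p * t * (∫ x in Ω, ‖gradient φ x‖ ^ (p - 2) * inner ℝ (gradient φ x)
          (ContinuousLinearMap.adjoint (fderiv ℝ V x) (gradient φ x))) +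
        6 * η * |t| * ∫ x in Ω, ‖gradient φ x‖ ^ p := by
  have hp0 : 0 < p := by linarith
  have c1 := continuous_norm_gradient_rpow hp hφ
  have c2 := continuous_gradient_form hp hV hφ
  have c3 := continuous_gradientExpansion hp hV η t hφ
  have c4 := continuous_divergence hV
  have i1 := integrable_domain_of_continuous hΩ c1
  have i2 := integrable_domain_of_continuous hΩ c2
  have i4 : Integrable (fun x => ‖gradient φ x‖ ^ p * divergence V x) (volume.restrict Ω) :=
    integrable_domain_of_continuous hΩ (c1.mul c4)
  have i5 : Integrable (fun x => gradientExpansion p V η t φ x * (1 + t * divergence V x))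
      (volume.restrict Ω) :=
    integrable_domain_of_continuous hΩ (c3.mul (continuous_const.add (c4.const_mul t)))
  have i6 : Integrable (fun x => η * |t| * |gradientExpansion p V η t φ x|) (volume.restrict Ω) :=
    integrable_domain_of_continuous hΩ (c3.abs.const_mul _)
  have i7 : Integrable (fun x => ‖gradient φ x‖ ^ p + t * (‖gradient φ x‖ ^ p * divergence V x))
      (volume.restrict Ω) := i1.add (i4.const_mul t)
  have i8 : Integrable (fun x => ‖gradient φ x‖ ^ p + t * (‖gradient φ x‖ ^ p * divergence V x) -
      p * t * (‖gradient φ x‖ ^ (p - 2) * inner ℝ (gradient φ x)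
          (ContinuousLinearMap.adjoint (fderiv ℝ V x) (gradient φ x)))) (volume.restrict Ω) :=
    i7.sub (i2.const_mul (p * t))
  have h1 := (abs_le.1 hdist).2
  have h2 : (∫ x in Ω, gradientExpansion p V η t φ x * (1 + t * divergence V x)) +
      ∫ x in Ω, η * |t| * |gradientExpansion p V η t φ x| ≤
      ∫ x in Ω, (‖gradient φ x‖ ^ p + t * (‖gradient φ x‖ ^ p * divergence V x) -
        p * t * (‖gradient φ x‖ ^ (p - 2) * inner ℝ (gradient φ x)
          (ContinuousLinearMap.adjoint (fderiv ℝ V x) (gradient φ x))) +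
        6 * η * |t| * ‖gradient φ x‖ ^ p) := by
    rw [← integral_add i5 i6]
    refine setIntegral_mono_on (i5.add i6) (i8.add (i1.const_mul _)) hΩ.isOpen.measurableSet
      fun x hx => ?_
    refine expansion_mul_le (κ := K) hη0 hη1 hp0.le (by positivity) ?_ (hB x hx) ht1 htB htκ htκB
    refine (abs_norm_rpow_mul_inner_le hp _ _).trans ?_
    have h3 : ‖ContinuousLinearMap.adjoint (fderiv ℝ V x) (gradient φ x)‖ ≤
        K * ‖gradient φ x‖ := by
      refine (ContinuousLinearMap.le_opNorm _ _).trans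
        (mul_le_mul_of_nonneg_right ?_ (norm_nonneg _))
      rw [LinearIsometryEquiv.norm_map]
      exact norm_fderiv_le_of_lipschitz ℝ hL
    calc ‖gradient φ x‖ ^ (p - 1) * ‖ContinuousLinearMap.adjoint (fderiv ℝ V x) (gradient φ x)‖
        ≤ ‖gradient φ x‖ ^ (p - 1) * (K * ‖gradient φ x‖) :=
          mul_le_mul_of_nonneg_left h3 (by positivity)
      _ = K * (‖gradient φ x‖ ^ (p - 1) * ‖gradient φ x‖) := by ring
      _ = K * ‖gradient φ x‖ ^ p := by
          rw [← Real.rpow_add_one' (norm_nonneg _) (by linarith), sub_add_cancel]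
  rw [integral_add i8 (i1.const_mul _), integral_sub i7 (i2.const_mul _),
    integral_add i1 (i4.const_mul t), integral_const_mul, integral_const_mul,
    integral_const_mul, integral_const_mul] at h2
  linarith

variable [Fact (1 ≤ ENNReal.ofReal p)]

theorem exists_smooth_triple (hN : 1 ≤ N) (hΩ : IsBoundedSmoothDomain Ω) (hp : 0 < p)
    (hφ : ContDiff ℝ ∞ φ) :
    ∃ W ∈ traceSpace p Ω, powerEnergy p W = (∫ x in Ω, ‖φ x‖ ^ p) + ∫ x in Ω, ‖gradient φ x‖ ^ p ∧
      W.2.2 =ᵐ[surfaceMeasure Ω] φ := by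
  have m1 := memLp_domain_of_continuous hΩ hφ.continuous (ENNReal.ofReal p)
  have m2 := memLp_domain_of_continuous hΩ (continuous_gradient hφ) (ENNReal.ofReal p)
  have m3 := memLp_boundary_of_continuous hN hΩ hφ.continuous (ENNReal.ofReal p)
  refine ⟨(m1.toLp φ, m2.toLp (gradient φ), m3.toLp φ), ?_, ?_, m3.coeFn_toLp⟩
  · exact Submodule.le_topologicalClosure _
      ⟨φ, hφ, m1.coeFn_toLp, m2.coeFn_toLp, m3.coeFn_toLp⟩
  · unfold powerEnergy
    rw [norm_toLp_rpow_eq_integral hp, norm_toLp_rpow_eq_integral hp]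

/-- The infimum of the energy with transported load is bounded by the transported energy. -/
theorem le_transported_energy (hN : 1 ≤ N) (hΩ : IsBoundedSmoothDomain Ω) (hV : ContDiff ℝ ∞ V)
    (hp : 1 < p) {w : EuclideanSpace ℝ (Fin N) → ℝ} (hw : Integrable w (surfaceMeasure Ω))
    {l : Lp ℝ (ENNReal.ofReal p) (surfaceMeasure Ω) →L[ℝ] ℝ} (hl : IsLoad w l) {m : ℝ}
    (hm : ∀ W ∈ traceSpace p Ω, m ≤ loadedEnergy p l W) (hφ : ContDiff ℝ ∞ φ) {η t : ℝ}
    {Φ : ℕ → EuclideanSpace ℝ (Fin N) → EuclideanSpace ℝ (Fin N)}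
    {Ψ : EuclideanSpace ℝ (Fin N) → EuclideanSpace ℝ (Fin N)} (hΦ : ∀ n, ContDiff ℝ ∞ (Φ n))
    {R : ℝ} (hR : ∀ x ∈ closure Ω, ∀ n, ‖Φ n x‖ ≤ R)
    (hlim : ∀ x ∈ closure Ω, Tendsto (fun n => Φ n x) atTop (𝓝 (Ψ x)))
    (hgrad : ∀ᶠ n in atTop, ∀ x ∈ closure Ω, ‖gradient (fun y => φ (Φ n y)) x‖ ^ p ≤
      gradientExpansion p V η t φ (Φ n x)) :
    m ≤ ((∫ x in Ω, ‖φ (Ψ x)‖ ^ p) + ∫ x in Ω, gradientExpansion p V η t φ (Ψ x)) / p -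
      ∫ x, w x * φ (Ψ x) ∂(surfaceMeasure Ω) := by
  have hp0 : 0 < p := by linarith
  have c1 : Continuous fun y => ‖φ y‖ ^ p :=
    hφ.continuous.norm.rpow_const fun _ => Or.inr hp0.le
  have c2 := continuous_gradientExpansion hp hV η t hφ
  have ae1 : ∀ᵐ x ∂(volume.restrict Ω), x ∈ closure Ω := ae_mem_closure hΩ
  have ae2 : ∀ᵐ x ∂(surfaceMeasure Ω), x ∈ closure Ω :=
    (ae_mem_frontier Ω).mono fun x hx => frontier_subset_closure hx
  have hΦc : ∀ n, Continuous (Φ n) := fun n => (hΦ n).continuous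
  have hone : Integrable (fun _ : EuclideanSpace ℝ (Fin N) => (1 : ℝ)) (volume.restrict Ω) :=
    integrable_domain_of_continuous hΩ continuous_const
  have l1 := tendsto_integral_mul_comp hone c1 hΦc (ae1.mono fun x hx => hR x hx)
    (ae1.mono fun x hx => hlim x hx)
  have l2 := tendsto_integral_mul_comp hone c2 hΦc (ae1.mono fun x hx => hR x hx)
    (ae1.mono fun x hx => hlim x hx)
  have l3 := tendsto_integral_mul_comp hw hφ.continuous hΦc (ae2.mono fun x hx => hR x hx)
    (ae2.mono fun x hx => hlim x hx)
  simp only [one_mul] at l1 l2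
  -- For each large `n` the composition `φ ∘ Φ n` is a smooth and hence admissible competitor; only
  -- the integrals are passed to the limit, so `φ ∘ ψ (-t)` itself is never shown to lie in the
  -- Sobolev space.
  refine ge_of_tendsto (((l1.add l2).div_const p).sub l3) ?_
  filter_upwards [hgrad] with n hn
  have hcomp : ContDiff ℝ ∞ fun y => φ (Φ n y) := hφ.comp (hΦ n)
  obtain ⟨W, hW, hWe, hWt⟩ := exists_smooth_triple (p := p) hN hΩ hp0 hcomp
  refine (hm W hW).trans ?_
  unfold loadedEnergy
  have e : l W.2.2 = ∫ x, w x * φ (Φ n x) ∂(surfaceMeasure Ω) := by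
    rw [hl]
    refine integral_congr_ae ?_
    filter_upwards [hWt] with x hx
    rw [hx]
  rw [hWe, e]
  refine sub_le_sub_right (div_le_div_of_nonneg_right (add_le_add le_rfl ?_) hp0.le) _
  exact setIntegral_mono_on
    (integrable_domain_of_continuous hΩ (continuous_norm_gradient_rpow hp hcomp))
    (integrable_domain_of_continuous hΩ (c2.comp (hΦc n))) hΩ.isOpen.measurableSet
    fun x hx => hn x (subset_closure hx)

/-- The derivative of the energy under transport by the flow of `V`. -/
def energyVariation (V : EuclideanSpace ℝ (Fin N) → EuclideanSpace ℝ (Fin N)) (U : Triple p Ω) : ℝ :=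
  ((∫ x in Ω, ‖U.1 x‖ ^ p * divergence V x) + ∫ x in Ω, ‖U.2.1 x‖ ^ p * divergence V x) / p -
    ∫ x in Ω, ‖U.2.1 x‖ ^ (p - 2) * inner ℝ (U.2.1 x)
      (ContinuousLinearMap.adjoint (fderiv ℝ V x) (U.2.1 x))

/-- All integrands are continuous and `p`-homogeneous. Continuity is used twice: to extend the
perturbation inequality from smooth triples to their closure, and to pass to the limit along the
minimizers. -/
theorem continuous_energyVariation (hΩ : IsBoundedSmoothDomain Ω) (hV : ContDiff ℝ ∞ V)
    (hp : 1 < p) : Continuous (energyVariation V : Triple p Ω → ℝ) := by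
  have hp0 : 0 < p := by linarith
  have hz : AEStronglyMeasurable (fun x : EuclideanSpace ℝ (Fin N) => x) (volume.restrict Ω) :=
    aestronglyMeasurable_id
  have c1 : Continuous fun a : Lp ℝ (ENNReal.ofReal p) (volume.restrict Ω) =>
      ∫ x in Ω, ‖a x‖ ^ p * divergence V x := by
    refine continuous_integral_of_homogeneous (F := fun x a => ‖a‖ ^ p * divergence V x) hp0
      hΩ.isCompact_closure ?_ ?_ hz (ae_mem_closure hΩ)
    · exact (continuous_snd.norm.rpow_const fun _ => Or.inr hp0.le).mul
        ((continuous_divergence hV).comp continuous_fst)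
    · intro x _ r hr a
      rw [norm_smul, Real.norm_of_nonneg hr, Real.mul_rpow hr (norm_nonneg _), mul_assoc]
  have c2 : Continuous fun a : Lp (EuclideanSpace ℝ (Fin N)) (ENNReal.ofReal p)
      (volume.restrict Ω) => ∫ x in Ω, ‖a x‖ ^ p * divergence V x := by
    refine continuous_integral_of_homogeneous (F := fun x a => ‖a‖ ^ p * divergence V x) hp0
      hΩ.isCompact_closure ?_ ?_ hz (ae_mem_closure hΩ)
    · exact (continuous_snd.norm.rpow_const fun _ => Or.inr hp0.le).mul
        ((continuous_divergence hV).comp continuous_fst)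
    · intro x _ r hr a
      rw [norm_smul, Real.norm_of_nonneg hr, Real.mul_rpow hr (norm_nonneg _), mul_assoc]
  have c3 : Continuous fun a : Lp (EuclideanSpace ℝ (Fin N)) (ENNReal.ofReal p)
      (volume.restrict Ω) => ∫ x in Ω, ‖a x‖ ^ (p - 2) * inner ℝ (a x)
        (ContinuousLinearMap.adjoint (fderiv ℝ V x) (a x)) := by
    refine continuous_integral_of_homogeneous (F := fun x a => ‖a‖ ^ (p - 2) * inner ℝ a
      (ContinuousLinearMap.adjoint (fderiv ℝ V x) a)) hp0
      hΩ.isCompact_closure ?_ ?_ hz (ae_mem_closure hΩ)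
    · exact (continuous_norm_rpow_mul_inner hp).comp
        (((continuous_adjoint_fderiv hV).comp continuous_fst).prodMk continuous_snd)
    · intro x _ r hr a
      rcases hr.eq_or_lt with rfl | hr
      · rw [zero_smul, inner_zero_left, mul_zero, Real.zero_rpow hp0.ne', zero_mul]
      · rw [norm_smul, Real.norm_of_nonneg hr.le, Real.mul_rpow hr.le (norm_nonneg _), map_smul,
          inner_smul_left, inner_smul_right, conj_trivial]
        have : r ^ p = r ^ (p - 2) * r * r := by
          rw [mul_assoc, ← sq, ← Real.rpow_natCast, ← Real.rpow_add hr]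
          norm_num
        rw [this]
        ring
  unfold energyVariation
  exact (((c1.comp continuous_fst).add
    (c2.comp (continuous_fst.comp continuous_snd))).div_const p).sub
      (c3.comp (continuous_fst.comp continuous_snd))

end PerturbationInequality

/-! ### The perturbation inequality for the minimal energy. -/

section LoadPerturbation

variable {N : ℕ} {Ω : Set (EuclideanSpace ℝ (Fin N))} {p : ℝ}
variable {V ν : EuclideanSpace ℝ (Fin N) → EuclideanSpace ℝ (Fin N)} {K : NNReal}
  {ψ : ℝ → EuclideanSpace ℝ (Fin N) → EuclideanSpace ℝ (Fin N)}
  {k φ : EuclideanSpace ℝ (Fin N) → ℝ}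

theorem memLp_top_tangentialDivergence (hΩ : IsBoundedSmoothDomain Ω)
    (hν : ∀ x ∈ frontier Ω, IsOuterUnitNormal Ω x (ν x)) (hV : ContDiff ℝ ∞ V) :
    MemLp (fun x => tangentialDivergence V (ν x) x) ⊤ (surfaceMeasure Ω) := by
  have hc := continuousOn_tangentialDivergence hΩ hν hV
  obtain ⟨B, hB⟩ := hΩ.isCompact_frontier.exists_bound_of_continuousOn hc
  exact memLp_top_of_bound (hc.aestronglyMeasurable isClosed_frontier.measurableSet) B
    ((ae_mem_frontier Ω).mono fun x hx => hB x hx)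

theorem abs_integral_comp_sub_le {σ : Measure (EuclideanSpace ℝ (Fin N))}
    {h δ : EuclideanSpace ℝ (Fin N) → ℝ} {t η : ℝ} (hh : Integrable h σ)
    (hδ : Integrable (fun x => h x * δ x) σ)
    (hdist : |(∫ x, h (ψ (-t) x) ∂σ) - ∫ x, h x * (1 + t * δ x) ∂σ| ≤ η * |t| * ∫ x, |h x| ∂σ) :
    |(∫ x, h (ψ (-t) x) ∂σ) - ((∫ x, h x ∂σ) + t * ∫ x, h x * δ x ∂σ)| ≤
      η * |t| * ∫ x, |h x| ∂σ := by
  rw [← integral_const_mul, ← integral_add hh (hδ.const_mul t)]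
  have e : (fun x => h x + t * (h x * δ x)) = fun x => h x * (1 + t * δ x) := by
    ext x
    ring
  rw [e]
  exact hdist

theorem exists_forall_abs_mul_le {A c : ℝ} (hA : 0 ≤ A) (hc : 0 < c) :
    ∃ r : ℝ, 0 < r ∧ ∀ t : ℝ, |t| ≤ r → |t| * A ≤ c := by
  refine ⟨c / (A + 1), by positivity, fun t ht => ?_⟩
  calc |t| * A ≤ c / (A + 1) * (A + 1) := mul_le_mul ht (by linarith) hA (by positivity)
    _ = c := div_mul_cancel₀ _ (by positivity)

/-- Bookkeeping: `a`, `b`, `c` are the transported function, gradient and load integrals, `A`, `P`,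
`L` the original ones, `d`, `Pd`, `Ld` the same weighted by divergences, and `Q` the form with the
transposed Jacobian. The variables `a'` and `b'` are the integrals of absolute values supplied by
the change of variables. -/
theorem perturbation_scalar {m p t η ε a a' b b' c A d P Pd Q L Ld S κ : ℝ} (hp : 1 ≤ p)
    (hε : 0 ≤ ε) (hεη : 6 * ε ≤ η) (hA : 0 ≤ A) (hP : 0 ≤ P) (hS : S ≤ κ) (hS0 : 0 ≤ S)
    (hm : m ≤ (a + b) / p - c) (ha : |a - (A + t * d)| ≤ ε * |t| * a') (ha' : a' = A)
    (hb : b ≤ P + t * Pd - p * t * Q + 6 * ε * |t| * P)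
    (hc : |c - (L + t * Ld)| ≤ ε * |t| * b') (hb' : b' = S) :
    m ≤ (A + P) / p - L + t * ((d + Pd) / p - Q - Ld) + η * |t| * (A + P + κ) := by
  have hp0 : 0 < p := by linarith
  subst ha' hb'
  have h1 := (abs_le.1 ha).2
  have h2 := (abs_le.1 hc).1
  have h0 : 0 ≤ ε * |t| := by positivity
  have h3 : a + b ≤ a' + P + t * (d + Pd) - p * t * Q + 6 * (ε * |t|) * (a' + P) := by nlinarith
  have h4 : (a + b) / p ≤ (a' + P + t * (d + Pd) - p * t * Q + 6 * (ε * |t|) * (a' + P)) / p :=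
    div_le_div_of_nonneg_right h3 hp0.le
  have h5 : (a' + P + t * (d + Pd) - p * t * Q + 6 * (ε * |t|) * (a' + P)) / p =
      (a' + P) / p + t * ((d + Pd) / p - Q) + 6 * (ε * |t|) * (a' + P) / p := by
    field_simp
    ring
  have h6 : 6 * (ε * |t|) * (a' + P) / p ≤ 6 * (ε * |t|) * (a' + P) :=
    div_le_self (by positivity) hp
  have h7 : 6 * (ε * |t|) * (a' + P) ≤ η * |t| * (a' + P) := by
    have := mul_le_mul_of_nonneg_right hεη (mul_nonneg (abs_nonneg t) (add_nonneg hA hP))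
    linarith
  have h8 : ε * |t| * b' ≤ η * |t| * κ := by
    have h9 : ε * |t| ≤ η * |t| := mul_le_mul_of_nonneg_right (by linarith) (abs_nonneg t)
    exact mul_le_mul h9 hS hS0 (h0.trans h9)
  linarith

variable [Fact (1 ≤ ENNReal.ofReal p)]

theorem memLp_mul_tangentialDivergence (hΩ : IsBoundedSmoothDomain Ω)
    (hν : ∀ x ∈ frontier Ω, IsOuterUnitNormal Ω x (ν x)) (hV : ContDiff ℝ ∞ V) {q : ℝ≥0∞}
    (hk : MemLp k q (surfaceMeasure Ω)) :
    MemLp (fun x => k x * tangentialDivergence V (ν x) x) q (surfaceMeasure Ω) :=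
  (memLp_top_tangentialDivergence hΩ hν hV).mul' hk

theorem integral_load_mul_eq {l : Lp ℝ (ENNReal.ofReal p) (surfaceMeasure Ω) →L[ℝ] ℝ}
    {δ : EuclideanSpace ℝ (Fin N) → ℝ} (hl : IsLoad (fun x => k x * δ x) l)
    (g : Lp ℝ (ENNReal.ofReal p) (surfaceMeasure Ω)) :
    ∫ x, k x * g x * δ x ∂(surfaceMeasure Ω) = l g := by
  rw [hl]
  exact integral_congr_ae (ae_of_all _ fun x => by ring)

/-- First order upper bound for the minimal energy under the transported load. -/
theorem IsFlowOf.exists_perturbation_inequality (hN : 1 ≤ N) (hΩ : IsBoundedSmoothDomain Ω)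
    (hν : ∀ x ∈ frontier Ω, IsOuterUnitNormal Ω x (ν x)) (hV : ContDiff ℝ ∞ V)
    (hL : LipschitzWith K V) (hVν : ∀ x ∈ frontier Ω, inner ℝ (V x) (ν x) = 0)
    (hψ : IsFlowOf V ψ) (hp : 1 < p) {η : ℝ} (hη : 0 < η) :
    ∃ t₀ : ℝ, 0 < t₀ ∧ ∀ t : ℝ, |t| ≤ t₀ → ∀ k : EuclideanSpace ℝ (Fin N) → ℝ,
      MemLp k (ENNReal.ofReal (p / (p - 1))) (surfaceMeasure Ω) →
      ∀ l lt : Lp ℝ (ENNReal.ofReal p) (surfaceMeasure Ω) →L[ℝ] ℝ, IsLoad k l →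
      IsLoad (fun x => k (ψ (-t) x)) lt → ∀ κ m : ℝ,
      (∀ g : Lp ℝ (ENNReal.ofReal p) (surfaceMeasure Ω),
        ∫ x, |k x * g x| ∂(surfaceMeasure Ω) ≤ κ * ‖g‖) →
      (∀ W ∈ traceSpace p Ω, m ≤ loadedEnergy p lt W) → ∀ U ∈ traceSpace p Ω,
      m ≤ loadedEnergy p l U + t * (energyVariation V U -
          ∫ x, k x * U.2.2 x * tangentialDivergence V (ν x) x ∂(surfaceMeasure Ω)) +
        η * |t| * (powerEnergy p U + κ * ‖U.2.2‖) := by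
  have hp0 : 0 < p := by linarith
  have hq : 1 < p / (p - 1) := by rw [one_lt_div (by linarith)]; linarith
  have hfin := isFiniteMeasure_surfaceMeasure hN hΩ
  -- The factor `6` is the error constant of `expansion_mul_le`.
  obtain ⟨ε, hε, hε1, hεη⟩ : ∃ ε : ℝ, 0 < ε ∧ ε ≤ 1 ∧ 6 * ε ≤ η :=
    ⟨min (η / 6) 1, by positivity, min_le_right _ _, by
      have := min_le_left (η / 6) 1; linarith⟩
  obtain ⟨B, hB⟩ := hΩ.isCompact_closure.exists_bound_of_continuousOn
    (continuous_divergence hV).continuousOn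
  have hB' : ∀ x ∈ Ω, |divergence V x| ≤ |B| := fun x hx =>
    (hB x (subset_closure hx)).trans (le_abs_self B)
  obtain ⟨r₁, hr₁, h₁⟩ := exists_forall_abs_mul_le (abs_nonneg B) one_pos
  obtain ⟨r₂, hr₂, h₂⟩ := exists_forall_abs_mul_le (show 0 ≤ p * K by positivity) one_pos
  obtain ⟨r₃, hr₃, h₃⟩ := exists_forall_abs_mul_le (show 0 ≤ p * K * |B| by positivity) hε
  obtain ⟨r₄, hr₄, h₄⟩ := hψ.exists_smooth_perturbation hΩ hV hL hp hε
  obtain ⟨r₅, hr₅, h₅⟩ := hψ.hasFirstOrderDistortion_domain hΩ hν hV hL hVν ε hε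
  obtain ⟨r₆, hr₆, h₆⟩ := hψ.hasFirstOrderDistortion_boundary hN hΩ hν hV hL hVν ε hε
  obtain ⟨t₀, ht₀, hle⟩ : ∃ t₀ : ℝ, 0 < t₀ ∧ ∀ t, |t| ≤ t₀ →
      |t| ≤ 1 ∧ |t| ≤ r₁ ∧ |t| ≤ r₂ ∧ |t| ≤ r₃ ∧ |t| ≤ r₄ ∧ |t| ≤ r₅ ∧ |t| ≤ r₆ := by
    refine ⟨min 1 (min r₁ (min r₂ (min r₃ (min r₄ (min r₅ r₆))))), by positivity, fun t ht => ?_⟩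
    simpa only [le_min_iff] using ht
  -- The threshold is fixed before the load and the competitor are introduced. This uniformity is
  -- essential, since the inequality is later applied with a load and a minimizer that vary with
  -- `t`.
  refine ⟨t₀, ht₀, fun t ht k hk l lt hl hlt κ m hκ hm U hU => ?_⟩
  obtain ⟨t1, t2, t3, t4, t5, t6, t7⟩ := hle t ht
  have hk1 : Integrable k (surfaceMeasure Ω) := memLp_one_iff_integrable.1
    (hk.mono_exponent (one_le_ofReal_of_one_lt hq).out)
  obtain ⟨l', hl'⟩ := exists_isLoad (p := p) hp (memLp_mul_tangentialDivergence hΩ hν hV hk)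
  -- The right side is continuous in `U`, so smooth triples suffice. For this purpose the boundary
  -- error is stated through the Hölder bound `κ * ‖U.2.2‖`, which is visibly continuous.
  refine traceSpace_induction (P := fun U : Triple p Ω => m ≤ loadedEnergy p l U +
      t * (energyVariation V U -
        ∫ x, k x * U.2.2 x * tangentialDivergence V (ν x) x ∂(surfaceMeasure Ω)) +
      η * |t| * (powerEnergy p U + κ * ‖U.2.2‖)) ?_ ?_ hU
  · simp only [integral_load_mul_eq hl']
    refine isClosed_le continuous_const ?_
    refine ((continuous_loadedEnergy hp0.le l).add (((continuous_energyVariation hΩ hV hp).sub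
      ?_).const_mul t)).add (((continuous_powerEnergy hp0.le).add ?_).const_mul _)
    · exact l'.continuous.comp (continuous_snd.comp continuous_snd)
    · exact (continuous_norm.comp (continuous_snd.comp continuous_snd)).const_mul κ
  · rintro W ⟨φ, hφ, e1, e2, e3⟩
    obtain ⟨Φ, hΦ, ⟨R, hR⟩, hlim, hgrad⟩ := h₄ t t5 φ hφ
    have c1 : Continuous fun y => ‖φ y‖ ^ p :=
      hφ.continuous.norm.rpow_const fun _ => Or.inr hp0.le
    have i1 := integrable_domain_of_continuous hΩ c1
    have i2 : Integrable (fun x => ‖φ x‖ ^ p * divergence V x) (volume.restrict Ω) :=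
      integrable_domain_of_continuous hΩ (c1.mul (continuous_divergence hV))
    have i3 := integrable_domain_of_continuous hΩ (continuous_gradientExpansion hp hV ε t hφ)
    have m3 : MemLp φ ⊤ (surfaceMeasure Ω) := memLp_boundary_of_continuous hN hΩ hφ.continuous ⊤
    have hkφ : MemLp (fun x => k x * φ x) (ENNReal.ofReal (p / (p - 1))) (surfaceMeasure Ω) :=
      m3.mul' hk
    have i4 : Integrable (fun x => k x * φ x) (surfaceMeasure Ω) := memLp_one_iff_integrable.1
      (hkφ.mono_exponent (one_le_ofReal_of_one_lt hq).out)
    have i5 : Integrable (fun x => k x * φ x * tangentialDivergence V (ν x) x)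
        (surfaceMeasure Ω) := memLp_one_iff_integrable.1
      ((memLp_mul_tangentialDivergence hΩ hν hV hkφ).mono_exponent
        (one_le_ofReal_of_one_lt hq).out)
    have main := le_transported_energy hN hΩ hV hp (h₆ t t7 k hk1).1 hlt hm hφ hΦ hR hlim hgrad
    have ea : powerEnergy p W = (∫ x in Ω, ‖φ x‖ ^ p) + ∫ x in Ω, ‖gradient φ x‖ ^ p := by
      rw [powerEnergy, norm_rpow_eq_integral hp0, norm_rpow_eq_integral hp0]
      congr 1
      · exact integral_congr_ae (e1.mono fun x hx => by simp only [hx])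
      · exact integral_congr_ae (e2.mono fun x hx => by simp only [hx])
    have eb : l W.2.2 = ∫ x, k x * φ x ∂(surfaceMeasure Ω) := by
      rw [hl]
      exact integral_congr_ae (e3.mono fun x hx => by simp only [hx])
    have ec : energyVariation V W = ((∫ x in Ω, ‖φ x‖ ^ p * divergence V x) +
        ∫ x in Ω, ‖gradient φ x‖ ^ p * divergence V x) / p -
        ∫ x in Ω, ‖gradient φ x‖ ^ (p - 2) * inner ℝ (gradient φ x)
          (ContinuousLinearMap.adjoint (fderiv ℝ V x) (gradient φ x)) := by
      rw [energyVariation]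
      refine congrArg₂ _ (congrArg (· / p) (congrArg₂ _ ?_ ?_)) ?_
      · exact integral_congr_ae (e1.mono fun x hx => by simp only [hx])
      · exact integral_congr_ae (e2.mono fun x hx => by simp only [hx])
      · exact integral_congr_ae (e2.mono fun x hx => by simp only [hx])
    have ed : ∫ x, k x * W.2.2 x * tangentialDivergence V (ν x) x ∂(surfaceMeasure Ω) =
        ∫ x, k x * φ x * tangentialDivergence V (ν x) x ∂(surfaceMeasure Ω) :=
      integral_congr_ae (e3.mono fun x hx => by simp only [hx])
    have ee : ∫ x, |k x * φ x| ∂(surfaceMeasure Ω) ≤ κ * ‖W.2.2‖ := by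
      refine le_of_eq_of_le ?_ (hκ W.2.2)
      exact integral_congr_ae (e3.mono fun x hx => by simp only [hx])
    rw [loadedEnergy, ea, eb, ec, ed]
    refine perturbation_scalar hp.le hε.le hεη (integral_nonneg fun x => by positivity)
      (integral_nonneg fun x => by positivity) ee (integral_nonneg fun x => abs_nonneg _) main
      (abs_integral_comp_sub_le i1 i2 (h₅ t t6 _ i1).2) ?_ ?_
      (abs_integral_comp_sub_le i4 i5 (h₆ t t7 _ i4).2) rfl
    · refine integral_congr_ae (ae_of_all _ fun x => ?_)
      simp only
      exact abs_of_nonneg (by positivity)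
    · refine integral_expansion_comp_le hΩ hV hL hp hφ hε.le hε1 hB' t1 (h₁ t t2) ?_ ?_
        (h₅ t t6 _ i3).2
      · rw [mul_right_comm, mul_comm]
        exact h₂ t t3
      · rw [mul_right_comm p, mul_right_comm (p * (K : ℝ)), mul_comm]
        exact h₃ t t4

end LoadPerturbation

/-- The envelope principle with two one-sided bounds: the upper one comes from transporting the
minimizer at time `0`, the lower one from transporting the minimizer at time `t` back. Continuity of
`D` and `R` at `0` suffices; nothing is differentiated except `m`. -/
theorem hasDerivAt_of_envelope {m D R : ℝ → ℝ} (hD : Tendsto D (𝓝 0) (𝓝 (D 0)))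
    (hR : Tendsto R (𝓝 0) (𝓝 (R 0))) (hR0 : ∀ t, 0 ≤ R t)
    (h : ∀ η : ℝ, 0 < η → ∃ t₀ : ℝ, 0 < t₀ ∧ ∀ t, |t| ≤ t₀ →
      m t ≤ m 0 + t * D 0 + η * |t| * R 0 ∧ m 0 ≤ m t - t * D t + η * |t| * R t) :
    HasDerivAt m (D 0) 0 := by
  rw [hasDerivAt_iff_isLittleO, Asymptotics.isLittleO_iff]
  intro c hc
  have hR1 : 0 < R 0 + 1 := by linarith [hR0 0]
  -- Near `0` one has `R t < R 0 + 1`, so this choice keeps the error below `c / 2 * |t|`; the other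
  -- half of `c` is reserved for `t * (D t - D 0)`.
  obtain ⟨t₀, ht₀, ht⟩ := h (c / 2 / (R 0 + 1)) (by positivity)
  have hη : c / 2 / (R 0 + 1) * (R 0 + 1) = c / 2 := div_mul_cancel₀ _ hR1.ne'
  have e1 : ∀ᶠ t in 𝓝 (0 : ℝ), |t| ≤ t₀ := by
    filter_upwards [Metric.closedBall_mem_nhds (0 : ℝ) ht₀] with t h
    simpa using h
  have e2 : ∀ᶠ t in 𝓝 (0 : ℝ), |D t - D 0| < c / 2 := by
    filter_upwards [hD (Metric.ball_mem_nhds _ (show 0 < c / 2 by positivity))] with t h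
    exact h
  have e3 : ∀ᶠ t in 𝓝 (0 : ℝ), R t < R 0 + 1 := hR.eventually_lt_const (by linarith)
  filter_upwards [e1, e2, e3] with t h1 h2 h3
  obtain ⟨h4, h5⟩ := ht t h1
  have h0 : 0 ≤ c / 2 / (R 0 + 1) * |t| := by positivity
  have h6 : c / 2 / (R 0 + 1) * |t| * R 0 ≤ c / 2 * |t| := by
    calc _ ≤ c / 2 / (R 0 + 1) * |t| * (R 0 + 1) := mul_le_mul_of_nonneg_left (by linarith) h0
      _ = c / 2 / (R 0 + 1) * (R 0 + 1) * |t| := by ring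
      _ = c / 2 * |t| := by rw [hη]
  have h7 : c / 2 / (R 0 + 1) * |t| * R t ≤ c / 2 * |t| := by
    calc _ ≤ c / 2 / (R 0 + 1) * |t| * (R 0 + 1) := mul_le_mul_of_nonneg_left h3.le h0
      _ = c / 2 / (R 0 + 1) * (R 0 + 1) * |t| := by ring
      _ = c / 2 * |t| := by rw [hη]
  have h8 : |t * (D t - D 0)| ≤ c / 2 * |t| := by
    rw [abs_mul, mul_comm]
    exact mul_le_mul_of_nonneg_right h2.le (abs_nonneg t)
  have h9 : 0 ≤ c / 2 * |t| := by positivity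
  rw [Real.norm_eq_abs, Real.norm_eq_abs, smul_eq_mul, sub_zero, abs_le]
  have h10 := (abs_le.1 h8).1
  constructor <;> linarith

/-! ### Continuity in time of the transported load. -/

section FlowLoad

variable {N : ℕ} {Ω : Set (EuclideanSpace ℝ (Fin N))} {p : ℝ}
variable {V ν : EuclideanSpace ℝ (Fin N) → EuclideanSpace ℝ (Fin N)} {K : NNReal}
  {ψ : ℝ → EuclideanSpace ℝ (Fin N) → EuclideanSpace ℝ (Fin N)}
  {f : EuclideanSpace ℝ (Fin N) → ℝ}

theorem IsFlowOf.exists_abs_comp_sub_le (hψ : IsFlowOf V ψ) (hL : LipschitzWith K V) (r : ℝ)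
    {h : EuclideanSpace ℝ (Fin N) → ℝ} (hh : Continuous h) {ε : ℝ} (hε : 0 < ε) :
    ∀ᶠ t in 𝓝 (0 : ℝ), ∀ x, ‖x‖ ≤ r → ‖h (ψ (-t) x) - h x‖ ≤ ε := by
  obtain ⟨M, hM, hmove⟩ := hψ.exists_norm_sub_le hL r
  have hu := (isCompact_closedBall (0 : EuclideanSpace ℝ (Fin N)) (r + M)
    ).uniformContinuousOn_of_continuous hh.continuousOn
  rw [Metric.uniformContinuousOn_iff] at hu
  obtain ⟨d, hd, hclose⟩ := hu ε hε
  obtain ⟨s, hs, hsd⟩ := exists_forall_abs_mul_le hM (half_pos hd)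
  filter_upwards [Metric.closedBall_mem_nhds (0 : ℝ) one_pos, Metric.closedBall_mem_nhds (0 : ℝ) hs]
    with t h1 h2 x hx
  rw [mem_closedBall_zero_iff, Real.norm_eq_abs] at h1 h2
  have h3 := hmove (-t) (by rwa [abs_neg]) x hx
  rw [abs_neg] at h3
  have h4 : M * |t| ≤ M := mul_le_of_le_one_right hM h1
  have h5 := hsd t h2
  rw [← dist_eq_norm]
  refine (hclose _ ?_ _ ?_ ?_).le
  · rw [mem_closedBall_zero_iff]
    have := norm_le_norm_add_norm_sub' (ψ (-t) x) x
    linarith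
  · rw [mem_closedBall_zero_iff]; linarith
  · rw [dist_eq_norm]; linarith

/-- Continuity in `L^q` of the transport of a function by the flow. -/
theorem IsFlowOf.tendsto_eLpNorm_comp_sub (hψ : IsFlowOf V ψ) (hL : LipschitzWith K V) (d : ℕ)
    {S : Set (EuclideanSpace ℝ (Fin N))} (hS : MeasurableSet S) (hb : Bornology.IsBounded S)
    (hinv : ∀ t, ∀ x ∈ S, ψ t x ∈ S) [IsFiniteMeasure ((μHE[d]).restrict S)] {q : ℝ≥0∞}
    (hq1 : 1 ≤ q) (hq : q ≠ ⊤) (hf : MemLp f q ((μHE[d]).restrict S)) :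
    Tendsto (fun t => eLpNorm (fun x => f (ψ (-t) x) - f x) q ((μHE[d]).restrict S)) (𝓝 0)
      (𝓝 0) := by
  set σ := (μHE[d] : Measure (EuclideanSpace ℝ (Fin N))).restrict S with hσ
  obtain ⟨c, hc⟩ := hψ.exists_map_le_smul hL d hinv 1
  obtain ⟨r, hr⟩ := hb.exists_norm_le
  set A : ℝ≥0∞ := (c : ℝ≥0∞) ^ (1 / q).toReal with hA
  have hAt : A + 1 ≠ ⊤ :=
    ENNReal.add_ne_top.2 ⟨ENNReal.rpow_ne_top_of_nonneg (by positivity) ENNReal.coe_ne_top, by simp⟩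
  have hBt : σ Set.univ ^ q.toReal⁻¹ ≠ ⊤ :=
    ENNReal.rpow_ne_top_of_nonneg (by positivity) (measure_ne_top _ _)
  rw [ENNReal.tendsto_nhds_zero]
  intro ε hε
  have hε2 : ε / 2 ≠ 0 := (ENNReal.half_pos hε.ne').ne'
  obtain ⟨e₁, he₁, hlt₁⟩ := ENNReal.exists_nnreal_pos_mul_lt hAt hε2
  obtain ⟨e₂, he₂, hlt₂⟩ := ENNReal.exists_nnreal_pos_mul_lt hBt hε2
  -- Bounded continuous functions are dense in `L^q`. Transport enlarges the approximation error by
  -- at most the factor `A`, and for the continuous approximant convergence is uniform on `S`.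
  obtain ⟨h, hh, hmem⟩ := hf.exists_boundedContinuous_eLpNorm_sub_le hq
    (ε := (e₁ : ℝ≥0∞)) (by exact_mod_cast he₁.ne')
  filter_upwards [hψ.exists_abs_comp_sub_le hL r h.continuous (NNReal.coe_pos.2 he₂),
    Metric.closedBall_mem_nhds (0 : ℝ) one_pos] with t h1 h2
  rw [mem_closedBall_zero_iff, Real.norm_eq_abs, ← abs_neg] at h2
  have hft := hψ.memLp_comp hL d hinv (-t) hf
  have hht := hψ.memLp_comp hL d hinv (-t) hmem
  have hsub := hf.sub hmem
  have b1 : eLpNorm (fun x => f (ψ (-t) x) - h (ψ (-t) x)) q σ ≤ A * e₁ := by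
    have hm : AEStronglyMeasurable (f - ⇑h) (σ.map (ψ (-t))) :=
      (hsub.of_measure_le_smul ENNReal.coe_ne_top (hc (-t) h2)).1
    have e := eLpNorm_map_measure (p := q) hm (hψ.continuous hL (-t)).aemeasurable
    calc eLpNorm (fun x => f (ψ (-t) x) - h (ψ (-t) x)) q σ
        = eLpNorm (f - ⇑h) q (σ.map (ψ (-t))) := e.symm
      _ ≤ eLpNorm (f - ⇑h) q ((c : ℝ≥0∞) • σ) := eLpNorm_mono_measure _ (hc (-t) h2)
      _ = A * eLpNorm (f - ⇑h) q σ := by rw [eLpNorm_smul_measure_of_ne_top hq, smul_eq_mul]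
      _ ≤ A * e₁ := by gcongr
  have b2 : eLpNorm (fun x => h (ψ (-t) x) - h x) q σ ≤ ε / 2 := by
    refine (eLpNorm_le_of_ae_bound (C := e₂) ?_).trans ?_
    · filter_upwards [ae_restrict_mem hS] with x hx
      exact h1 x (hr x hx)
    · rw [ENNReal.ofReal_coe_nnreal, mul_comm]
      exact hlt₂.le
  have b3 : eLpNorm (fun x => h x - f x) q σ ≤ e₁ := by
    have e := eLpNorm_neg (f - ⇑h) q σ
    rw [neg_sub] at e
    exact e.trans_le hh
  have hsum : (fun x => f (ψ (-t) x) - f x) =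
      (fun x => f (ψ (-t) x) - h (ψ (-t) x)) +
        ((fun x => h (ψ (-t) x) - h x) + fun x => h x - f x) := by
    ext x
    simp only [Pi.add_apply]
    ring
  rw [hsum]
  calc _ ≤ A * e₁ + (ε / 2 + e₁) := by
        refine (eLpNorm_add_le (hft.sub hht).1 ((hht.sub hmem).add (hmem.sub hf)).1 hq1).trans ?_
        exact add_le_add b1
          ((eLpNorm_add_le (hht.sub hmem).1 (hmem.sub hf).1 hq1).trans (add_le_add b2 b3))
    _ = e₁ * (A + 1) + ε / 2 := by ring
    _ ≤ ε / 2 + ε / 2 := by gcongr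
    _ = ε := ENNReal.add_halves ε

end FlowLoad

/-! ### Hölder pairings used in the limit of the boundary terms. -/

section Derivative

variable {α : Type*} {m : MeasurableSpace α} {p : ℝ}

/-- Packages the boundary term with a bounded weight as a continuous bilinear map, so that it
converges when load and trace both vary with time. -/
theorem exists_weighted_pairing (hp : 1 < p) [Fact (1 ≤ ENNReal.ofReal p)]
    [Fact (1 ≤ ENNReal.ofReal (p / (p - 1)))] {μ : Measure α} {δ : α → ℝ} (hδ : MemLp δ ⊤ μ) :
    ∃ Λ : Lp ℝ (ENNReal.ofReal (p / (p - 1))) μ →L[ℝ] Lp ℝ (ENNReal.ofReal p) μ →L[ℝ] ℝ,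
      ∀ k g, Λ k g = ∫ x, k x * g x * δ x ∂μ := by
  obtain ⟨Λ, hΛ⟩ := exists_pairing hp ℝ μ
  let T := (ContinuousLinearMap.mul ℝ ℝ).holderL μ ⊤ (ENNReal.ofReal (p / (p - 1)))
    (ENNReal.ofReal (p / (p - 1))) (hδ.toLp δ)
  refine ⟨Λ.comp T, fun k g => ?_⟩
  rw [ContinuousLinearMap.comp_apply, hΛ]
  refine integral_congr_ae ?_
  filter_upwards [(ContinuousLinearMap.mul ℝ ℝ).coeFn_holder
    (r := ENNReal.ofReal (p / (p - 1))) (hδ.toLp δ) k, hδ.coeFn_toLp] with x h1 h2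
  have h3 : T k x = δ x * k x := by
    rw [← h2]
    exact h1
  rw [h3]
  simp only [show inner ℝ (δ x * k x) (g x) = g x * (δ x * k x) from rfl]
  ring

theorem integral_abs_mul_le (hp : 1 < p) {μ : Measure α} [Fact (1 ≤ ENNReal.ofReal p)]
    [Fact (1 ≤ ENNReal.ofReal (p / (p - 1)))] {k : α → ℝ}
    (hk : MemLp k (ENNReal.ofReal (p / (p - 1))) μ) (g : Lp ℝ (ENNReal.ofReal p) μ) :
    ∫ x, |k x * g x| ∂μ ≤ ‖hk.toLp k‖ * ‖g‖ := by
  have hp0 : 0 < p := by linarith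
  have hpq : (p / (p - 1)).HolderConjugate p := (Real.HolderConjugate.conjExponent hp).symm
  have h := integral_mul_norm_le_Lp_mul_Lq hpq hk (Lp.memLp g)
  rw [← norm_toLp_rpow_eq_integral hpq.pos hk, ← norm_rpow_eq_integral hp0, one_div, one_div,
    Real.rpow_rpow_inv (norm_nonneg _) hpq.pos.ne', Real.rpow_rpow_inv (norm_nonneg _) hp0.ne'] at h
  simpa only [abs_mul, Real.norm_eq_abs] using h

end Derivative

/-! ### Derivative of the minimal energy. -/

section MinimalEnergy

variable {N : ℕ} {Ω : Set (EuclideanSpace ℝ (Fin N))} {p : ℝ}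
variable {V ν : EuclideanSpace ℝ (Fin N) → EuclideanSpace ℝ (Fin N)} {K : NNReal}
  {ψ : ℝ → EuclideanSpace ℝ (Fin N) → EuclideanSpace ℝ (Fin N)}
  {f : EuclideanSpace ℝ (Fin N) → ℝ}

theorem IsFlowOf.memLp_comp_boundary (hΩ : IsBoundedSmoothDomain Ω)
    (hν : ∀ x ∈ frontier Ω, IsOuterUnitNormal Ω x (ν x)) (hV : ContDiff ℝ ∞ V)
    (hL : LipschitzWith K V) (hVν : ∀ x ∈ frontier Ω, inner ℝ (V x) (ν x) = 0)
    (hψ : IsFlowOf V ψ) {q : ℝ≥0∞} (hf : MemLp f q (surfaceMeasure Ω)) (t : ℝ) :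
    MemLp (fun x => f (ψ t x)) q (surfaceMeasure Ω) :=
  hψ.memLp_comp hL (N - 1) (fun t _ hx => hψ.mem_frontier hΩ hν hV hL hVν hx t) t hf

theorem integral_add_mul_divergence (hΩ : IsBoundedSmoothDomain Ω) (hV : ContDiff ℝ ∞ V)
    (hp : 0 < p) {a : EuclideanSpace ℝ (Fin N) → ℝ}
    {b : EuclideanSpace ℝ (Fin N) → EuclideanSpace ℝ (Fin N)}
    (ha : MemLp a (ENNReal.ofReal p) (volume.restrict Ω))
    (hb : MemLp b (ENNReal.ofReal p) (volume.restrict Ω)) :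
    ∫ x in Ω, (‖b x‖ ^ p + |a x| ^ p) * divergence V x =
      (∫ x in Ω, ‖a x‖ ^ p * divergence V x) + ∫ x in Ω, ‖b x‖ ^ p * divergence V x := by
  have hδ := memLp_domain_of_continuous hΩ (continuous_divergence hV) ⊤
  have i1 : Integrable (fun x => ‖a x‖ ^ p * divergence V x) (volume.restrict Ω) :=
    memLp_one_iff_integrable.1
      (hδ.mul' (memLp_one_iff_integrable.2 (integrable_norm_rpow_of_memLp hp ha)))
  have i2 : Integrable (fun x => ‖b x‖ ^ p * divergence V x) (volume.restrict Ω) :=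
    memLp_one_iff_integrable.1
      (hδ.mul' (memLp_one_iff_integrable.2 (integrable_norm_rpow_of_memLp hp hb)))
  rw [← integral_add i1 i2]
  refine integral_congr_ae (ae_of_all _ fun x => ?_)
  simp only [Real.norm_eq_abs]
  ring

theorem IsWeakSolution.energyVariation_triple (hΩ : IsBoundedSmoothDomain Ω)
    (hV : ContDiff ℝ ∞ V) (hp : 0 < p) {k u g : EuclideanSpace ℝ (Fin N) → ℝ}
    {G : EuclideanSpace ℝ (Fin N) → EuclideanSpace ℝ (Fin N)} (h : IsWeakSolution p Ω k u G g) :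
    energyVariation V h.triple =
      (∫ x in Ω, (‖G x‖ ^ p + |u x| ^ p) * divergence V x) / p -
        ∫ x in Ω, ‖G x‖ ^ (p - 2) * inner ℝ (G x)
          (ContinuousLinearMap.adjoint (fderiv ℝ V x) (G x)) := by
  have e1 := h.memSobolev.memLp.coeFn_toLp
  have e2 := h.memSobolev.memLp_gradient.coeFn_toLp
  rw [integral_add_mul_divergence hΩ hV hp h.memSobolev.memLp h.memSobolev.memLp_gradient,
    energyVariation]
  refine congrArg₂ _ (congrArg (· / p) (congrArg₂ _ ?_ ?_)) ?_
  · exact integral_congr_ae (e1.mono fun x hx => by simp only [IsWeakSolution.triple, hx])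
  · exact integral_congr_ae (e2.mono fun x hx => by simp only [IsWeakSolution.triple, hx])
  · exact integral_congr_ae (e2.mono fun x hx => by simp only [IsWeakSolution.triple, hx])

variable [Fact (1 ≤ ENNReal.ofReal p)]

/-- The minimal energy is differentiable along the transport of the load, by the envelope
argument: the variation of the energy is taken at the fixed minimizer. -/
theorem IsFlowOf.hasDerivAt_minimal_energy (hN : 1 ≤ N) (hΩ : IsBoundedSmoothDomain Ω)
    (hν : ∀ x ∈ frontier Ω, IsOuterUnitNormal Ω x (ν x)) (hV : ContDiff ℝ ∞ V)
    (hL : LipschitzWith K V) (hVν : ∀ x ∈ frontier Ω, inner ℝ (V x) (ν x) = 0)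
    (hψ : IsFlowOf V ψ) (hp : 1 < p)
    (hf : MemLp f (ENNReal.ofReal (p / (p - 1))) (surfaceMeasure Ω))
    {l : ℝ → Lp ℝ (ENNReal.ofReal p) (surfaceMeasure Ω) →L[ℝ] ℝ}
    (hl : ∀ t, IsLoad (fun x => f (ψ (-t) x)) (l t)) {U : ℝ → Triple p Ω}
    (hU : ∀ t, U t ∈ traceSpace p Ω)
    (hUm : ∀ t, ∀ W ∈ traceSpace p Ω, loadedEnergy p (l t) (U t) ≤ loadedEnergy p (l t) W) :
    HasDerivAt (fun t => loadedEnergy p (l t) (U t))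
      (energyVariation V (U 0) -
        ∫ x, f x * (U 0).2.2 x * tangentialDivergence V (ν x) x ∂(surfaceMeasure Ω)) 0 := by
  have hp0 : 0 < p := by linarith
  have hq : 1 < p / (p - 1) := by rw [one_lt_div (by linarith)]; linarith
  have hqF := one_le_ofReal_of_one_lt hq
  have hfin := isFiniteMeasure_surfaceMeasure hN hΩ
  have hft : ∀ t, MemLp (fun x => f (ψ (-t) x)) (ENNReal.ofReal (p / (p - 1)))
      (surfaceMeasure Ω) := fun t => hψ.memLp_comp_boundary hΩ hν hV hL hVν hf (-t)
  have hf0 : (fun x => f (ψ (-0) x)) = f := by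
    ext x
    rw [neg_zero, hψ.map_zero]
  set F : ℝ → Lp ℝ (ENNReal.ofReal (p / (p - 1))) (surfaceMeasure Ω) :=
    fun t => (hft t).toLp _ with hF
  -- The chain of limits starts here: transported loads converge in `L^q`, hence as functionals,
  -- hence the minimizers converge in norm, hence so do the variation of the energy and the error
  -- factor.
  have hFlim : Tendsto F (𝓝 0) (𝓝 (F 0)) := by
    have : IsFiniteMeasure ((μHE[N - 1]).restrict (frontier Ω)) := hfin
    have h := hψ.tendsto_eLpNorm_comp_sub hL (N - 1) isClosed_frontier.measurableSet
      hΩ.isCompact_frontier.isBounded (fun t _ hx => hψ.mem_frontier hΩ hν hV hL hVν hx t)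
      hqF.out ENNReal.ofReal_ne_top hf
    refine (Lp.tendsto_Lp_iff_tendsto_eLpNorm'' _ hft _ (hft 0)).2 ?_
    simp only [hf0]
    exact h
  obtain ⟨Λ, hΛ⟩ := exists_pairing hp ℝ (surfaceMeasure Ω)
  have hlΛ : ∀ t, l t = Λ (F t) := fun t => by
    ext g
    rw [hl, hΛ]
    refine integral_congr_ae ?_
    filter_upwards [(hft t).coeFn_toLp] with x hx
    simp only [hF, hx, show inner ℝ (f (ψ (-t) x)) (g x) = g x * f (ψ (-t) x) from rfl, mul_comm]
  have hllim : Tendsto l (𝓝 0) (𝓝 (l 0)) := by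
    rw [show l = fun t => Λ (F t) from funext hlΛ]
    exact (Λ.continuous.tendsto _).comp hFlim
  obtain ⟨C, hC, htr⟩ := exists_norm_trace_rpow_le hN hΩ hp
  have hUlim : Tendsto U (𝓝 0) (𝓝 (U 0)) :=
    tendsto_minimizer (X := traceSpace p Ω) hp hC htr (uniformlyConvexRpow_Lp hp)
      (uniformlyConvexRpow_Lp hp) hllim hU (hU 0) hUm (hUm 0)
  have hglim : Tendsto (fun t => (U t).2.2) (𝓝 0) (𝓝 (U 0).2.2) :=
    ((continuous_snd.comp continuous_snd).tendsto (U 0)).comp hUlim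
  obtain ⟨Θ, hΘ⟩ := exists_weighted_pairing hp (memLp_top_tangentialDivergence hΩ hν hV)
  have hΘ' : ∀ t, Θ (F t) (U t).2.2 = ∫ x, f (ψ (-t) x) * (U t).2.2 x *
      tangentialDivergence V (ν x) x ∂(surfaceMeasure Ω) := fun t => by
    rw [hΘ]
    refine integral_congr_ae ?_
    filter_upwards [(hft t).coeFn_toLp] with x hx
    simp only [hF, hx]
  have hD : Tendsto (fun t => energyVariation V (U t) - Θ (F t) (U t).2.2) (𝓝 0)
      (𝓝 (energyVariation V (U 0) - Θ (F 0) (U 0).2.2)) :=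
    (((continuous_energyVariation hΩ hV hp).tendsto (U 0)).comp hUlim).sub
      ((isBoundedBilinearMap_apply.continuous.tendsto (Θ (F 0), (U 0).2.2)).comp
        (((Θ.continuous.tendsto _).comp hFlim).prodMk_nhds hglim))
  have hR : Tendsto (fun t => powerEnergy p (U t) + ‖F t‖ * ‖(U t).2.2‖) (𝓝 0)
      (𝓝 (powerEnergy p (U 0) + ‖F 0‖ * ‖(U 0).2.2‖)) :=
    (((continuous_powerEnergy hp0.le).tendsto (U 0)).comp hUlim).add (hFlim.norm.mul hglim.norm)
  have key := hasDerivAt_of_envelope (m := fun t => loadedEnergy p (l t) (U t)) hD hR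
    (fun t => by have := powerEnergy_nonneg p (U t); positivity) fun η hη => ?_
  · rw [hΘ'] at key
    simpa only [neg_zero, hψ.map_zero] using key
  obtain ⟨t₀, ht₀, hper⟩ := hψ.exists_perturbation_inequality hN hΩ hν hV hL hVν hp hη
  refine ⟨t₀, ht₀, fun t ht => ⟨?_, ?_⟩⟩
  · have h := hper t ht _ (hft 0) (l 0) (l t) (hl 0) (by
        simpa only [neg_zero, hψ.map_zero] using hl t) ‖F 0‖ _
      (fun g => integral_abs_mul_le hp (hft 0) g) (hUm t) (U 0) (hU 0)
    rw [← hΘ'] at h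
    exact h
  -- The inequality is run from time `t` with the flow for time `-t`, which transports the load at
  -- time `t` back to `f`; the competitor is the minimizer at time `t`.
  · have h := hper (-t) (by rwa [abs_neg]) _ (hft t) (l t) (l 0) (hl t) (by
        have := hl 0
        simpa only [neg_neg, hψ.neg_apply_apply hL, hf0] using this) ‖F t‖ _
      (fun g => integral_abs_mul_le hp (hft t) g) (hUm 0) (U t) (hU t)
    rw [← hΘ', abs_neg, neg_mul, ← sub_eq_add_neg] at h
    exact h

end MinimalEnergy

end PLaplace

end

/-! ### Assembly of existence, uniqueness and the derivative formula. -/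

theorem theorem2 {N : ℕ} (hN : 1 ≤ N) {p : ℝ} (hp : 1 < p)
    (Ω : Set (EuclideanSpace ℝ (Fin N))) (hΩ : PLaplace.IsBoundedSmoothDomain Ω)
    (ν : EuclideanSpace ℝ (Fin N) → EuclideanSpace ℝ (Fin N))
    (hν : ∀ x ∈ frontier Ω, PLaplace.IsOuterUnitNormal Ω x (ν x))
    (V : EuclideanSpace ℝ (Fin N) → EuclideanSpace ℝ (Fin N))
    (hV : ContDiff ℝ ∞ V) (hVlip : ∃ K, LipschitzWith K V)
    (hVν : ∀ x ∈ frontier Ω, inner ℝ (V x) (ν x) = 0)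
    (ψ : ℝ → EuclideanSpace ℝ (Fin N) → EuclideanSpace ℝ (Fin N))
    (hψ : PLaplace.IsFlowOf V ψ)
    (f : EuclideanSpace ℝ (Fin N) → ℝ)
    (hf : MemLp f (ENNReal.ofReal (p / (p - 1))) (PLaplace.surfaceMeasure Ω)) :
    -- for every `t` the problem with load `f_t` has a weak solution,
    (∀ t : ℝ, ∃ u G g, PLaplace.IsWeakSolution p Ω (PLaplace.perturbedLoad ψ f t) u G g) ∧
    -- which is unique (together with its weak gradient and its trace),
    (∀ t : ℝ, ∀ u G g u' G' g',
      PLaplace.IsWeakSolution p Ω (PLaplace.perturbedLoad ψ f t) u G g →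
      PLaplace.IsWeakSolution p Ω (PLaplace.perturbedLoad ψ f t) u' G' g' →
      u =ᵐ[volume.restrict Ω] u' ∧ G =ᵐ[volume.restrict Ω] G' ∧
        g =ᵐ[PLaplace.surfaceMeasure Ω] g') ∧
    -- and, with `u t` this solution, `I(t) = ∫_{∂Ω} u_t f_t` is differentiable at `0`.
    (∀ (u : ℝ → EuclideanSpace ℝ (Fin N) → ℝ)
      (G : ℝ → EuclideanSpace ℝ (Fin N) → EuclideanSpace ℝ (Fin N))
      (g : ℝ → EuclideanSpace ℝ (Fin N) → ℝ),
      (∀ t, PLaplace.IsWeakSolution p Ω (PLaplace.perturbedLoad ψ f t) (u t) (G t) (g t)) →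
      HasDerivAt
        (fun t => ∫ x, g t x * PLaplace.perturbedLoad ψ f t x ∂(PLaplace.surfaceMeasure Ω))
        (1 / (p - 1) *
          (p * (∫ x, g 0 x * f x * PLaplace.tangentialDivergence V (ν x) x
              ∂(PLaplace.surfaceMeasure Ω))
            + p * (∫ x in Ω, ‖G 0 x‖ ^ (p - 2) *
                inner ℝ (G 0 x) (ContinuousLinearMap.adjoint (fderiv ℝ V x) (G 0 x)))
            - ∫ x in Ω, (‖G 0 x‖ ^ p + |u 0 x| ^ p) * PLaplace.divergence V x))
        0) := by
  have hF := PLaplace.one_le_ofReal_of_one_lt hp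
  obtain ⟨K, hL⟩ := hVlip
  have hp1 : p - 1 ≠ 0 := by linarith
  have hp0 : p ≠ 0 := by linarith
  have hload := hψ.perturbedLoad_eq hL f
  have hft : ∀ t, MemLp (PLaplace.perturbedLoad ψ f t) (ENNReal.ofReal (p / (p - 1)))
      (PLaplace.surfaceMeasure Ω) := fun t => by
    rw [hload]
    exact hψ.memLp_comp_boundary hΩ hν hV hL hVν hf (-t)
  refine ⟨fun t => PLaplace.exists_isWeakSolution hN hΩ hp (hft t),
    fun t u G g u' G' g' h h' => h.ae_eq_of_triple_eq h' (h.triple_eq hN hΩ hp (hft t) h'),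
    fun u G g h => ?_⟩
  choose l hl using fun t => PLaplace.exists_isLoad (p := p) hp (hft t)
  have hm := hψ.hasDerivAt_minimal_energy hN hΩ hν hV hL hVν hp hf
    (fun t => by simpa only [hload] using hl t) (fun t => (h t).triple_mem hN hΩ)
    fun t => (h t).minimizes hN hΩ hp (hl t)
  -- This identity holds at every `t`, so differentiability of the minimal energy transfers to `I`,
  -- and the factor `-(p / (p - 1))` fixes the signs and coefficients of the three integrals.
  have hI : (fun t => ∫ x, g t x * PLaplace.perturbedLoad ψ f t x ∂(PLaplace.surfaceMeasure Ω)) =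
      fun t => -(p / (p - 1)) * PLaplace.loadedEnergy p (l t) (h t).triple :=
    funext fun t => (h t).integral_eq hN hΩ hp (hl t)
  rw [hI]
  refine (hm.const_mul (-(p / (p - 1)))).congr_deriv ?_
  have hb : ∫ x, f x * (h 0).triple.2.2 x * PLaplace.tangentialDivergence V (ν x) x
      ∂(PLaplace.surfaceMeasure Ω) = ∫ x, g 0 x * f x * PLaplace.tangentialDivergence V (ν x) x
      ∂(PLaplace.surfaceMeasure Ω) := by
    refine integral_congr_ae ((h 0).isTrace.1.coeFn_toLp.mono fun x hx => ?_)
    simp only [PLaplace.IsWeakSolution.triple, hx, mul_comm (f x)]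
  rw [hb, (h 0).energyVariation_triple hΩ hV (by linarith)]
  field_simp
  ring
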